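/- Let $\mathbb{R}^5_1$ be $\mathbb{R}^5$ with the form $\langle x,y\rangle=\sum_{i=1}^4x^iy^i-x^5y^5$, let $\mathbb{H}^4=\{x\in\mathbb{R}^5_1:\langle x,x\rangle=-1,\ x^5>0\}$, and let $\iota:\mathbb{H}^4\to\mathbb{R}^5_1$ be the inclusion. Let $M^2$ be a connected smooth surface and $\varphi:M^2\to\mathbb{H}^4$ a smooth immersion; $M$ carries the induced metric. Let $B$ be the second fundamental form, $H=\frac12\operatorname{trace}B$ the mean curvature vector field and $f=|H|$ the mean curvature function of $\varphi$. Suppose that $\varphi$ is a (non-CMC) PNMC biconservative immersion, that is: - $f>0$, $\operatorname{grad}f$ vanishes nowhere, and $\nabla^\perp(H/|H|)=0$; - $\varphi$ is biconservative: the tangential part of the bitension field $\tau_2(\varphi)=-\Delta^\varphi\tau(\varphi)-\operatorname{trace}R^{\mathbb{H}^4}(\varphi_*,\tau(\varphi))\varphi_*$, with $\tau(\varphi)=2H$ and $\Delta^\varphi=-\operatorname{trace}(\nabla^\varphi\nabla^\varphi-\nabla^\varphi_\nabla)$, is zero; - no non-empty open subset of $M$ is mapped into a totally geodesic hypersurface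 $\mathbb{H}^3\subset\mathbb{H}^4$. Put $\Phi=\iota\circ\varphi$. Then there are real constants $c\neq0$ and $C$ such that on $M$ $$|\operatorname{grad}f|=\tfrac43f\sqrt{1+9Cf^{3/2}-9f^2-c^2f^3};$$ since $f$ is not constant, $C$ (the integration constant of the surface) and $c^2$ are determined by this relation. If $C=0$, that is, if the relation holds on $M$ with $C=0$ and some real $c$, then $c\ne0$ and every point $p_0\in M$ has a neighbourhood with local coordinates $(u,v)\in(-\varepsilon,\varepsilon)\times(-\delta,\delta)$, centred at $p_0$, in which $$\Phi(u,v)=\hat\sigma(u)+v\,\overline b_1+v^2f^{3/4}(u)\,\overline b_2,$$ where 1. $f=f(u)$ is the mean curvature function, which depends only on $u$, is positive and satisfies $f'=\frac43f\sqrt{1-9f^2-c^2f^3}>0$; 2. $\overline b_1,\overline b_2\in\mathbb{R}^5_1$ are constant vectors with $\langle\overline b_1,\overline b_1\rangle=1$, $\overline b_2\neq0$ and $\langle\overline b_2,\overline b_2\rangle=\langle\overline b_1,\overline b_2\rangle=0$; 3. $\hat\sigma=\iota\circ\tilde\sigma$, where $\tilde\sigma$ is a smooth curve, parametrized by arc length,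 in the totally geodesic hypersurface $\mathbb{H}^3=\mathbb{H}^4\cap\Pi$, with $\Pi$ the hyperplane through the origin orthogonal to $\overline b_1$. Its curvature and (unsigned) torsion as a curve in $\mathbb{H}^3$ are $$\kappa=f\sqrt{1+c^2f},\qquad\tau=\frac{2|c|\sqrt f}{3(1+c^2f)}\sqrt{1-9f^2-c^2f^3},$$ and $\langle\hat\sigma(u),\overline b_2\rangle=-\dfrac1{2f^{3/4}(u)}$ for all $u$. -/

import Mathlib

open scoped Manifold ContDiff

noncomputable section

namespace BiconservativeH4

/-- The vector space underlying the Minkowski space `ℝ⁵₁`. The norm of this type is only used for its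
topology and for derivatives; the geometry comes from `mink`. -/
abbrev R51 : Type := Fin 5 → ℝ

/-- The parameter plane, the model space of surfaces. -/
abbrev Plane : Type := EuclideanSpace ℝ (Fin 2)

/-- The Minkowski form `x¹y¹ + x²y² + x³y³ + x⁴y⁴ - x⁵y⁵`. -/
def mink (x y : R51) : ℝ :=
  x 0 * y 0 + x 1 * y 1 + x 2 * y 2 + x 3 * y 3 - x 4 * y 4

/-- The length of a spacelike vector. -/
def len (w : R51) : ℝ := Real.sqrt (mink w w)

/-- The hyperboloid model of hyperbolic `4`-space. -/
def H4 : Set R51 := {y | mink y y = -1 ∧ 0 < y 4}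

/-- The intersection of `H4` with the hyperplane through the origin orthogonal to `n`; for spacelike
`n` these are precisely the totally geodesic hypersurfaces `ℍ³` of `ℍ⁴`. -/
def hypersurfaceH3 (n : R51) : Set R51 := {y | y ∈ H4 ∧ mink y n = 0}

/-! ### The Levi-Civita connection and the curvature tensor of `ℍ⁴` -/

/-- For `y ∈ H4`, the orthogonal projection of `ℝ⁵₁` onto the tangent space
`T_y ℍ⁴ = {w | ⟨w, y⟩ = 0}`. -/
def projH (y w : R51) : R51 := w + mink w y • y

/-- The Levi-Civita connection of `ℍ⁴`: the tangential part of the flat derivative. -/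
def connH (X Y : R51 → R51) : R51 → R51 := fun y => projH y (fderiv ℝ Y y (X y))

/-- A vector field tangent to `ℍ⁴` whose value at `y ∈ H4` is `w` if `w ∈ T_y ℍ⁴`. -/
def extendH (w : R51) : R51 → R51 := fun y => projH y w

/-- The curvature tensor of `ℍ⁴` at `y` on tangent vectors `a`, `b`, `d`,
`R(X,Y)Z = ∇_X ∇_Y Z - ∇_Y ∇_X Z - ∇_[X,Y] Z`, computed with vector fields that extend them. -/
def curvH (y a b d : R51) : R51 :=
  connH (extendH a) (connH (extendH b) (extendH d)) y
    - connH (extendH b) (connH (extendH a) (extendH d)) y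
    - connH (VectorField.lieBracket ℝ (extendH a) (extendH b)) (extendH d) y

/-! ### Local geometry of a parametrized surface `x : Plane → ℍ⁴ ⊂ ℝ⁵₁` -/

section Surface

/-- The `i`-th partial derivative. -/
def pd {F : Type*} [NormedAddCommGroup F] [NormedSpace ℝ F] (V : Plane → F) (i : Fin 2) :
    Plane → F :=
  fun q => fderiv ℝ V q (EuclideanSpace.single i 1)

/-- The induced metric `g_ij`. -/
def metric (x : Plane → R51) (q : Plane) : Matrix (Fin 2) (Fin 2) ℝ :=
  Matrix.of fun i j => mink (pd x i q) (pd x j q)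

/-- The Christoffel symbols `Γ^k_ij` of the induced metric. -/
def christoffel (x : Plane → R51) (k i j : Fin 2) (q : Plane) : ℝ :=
  (1 / 2) * ∑ l, (metric x q)⁻¹ k l *
    (pd (fun r => metric x r j l) i q + pd (fun r => metric x r i l) j q
      - pd (fun r => metric x r i j) l q)

/-- The component of `w` tangent to the surface. -/
def tangentPart (x : Plane → R51) (q : Plane) (w : R51) : R51 :=
  ∑ i, ∑ j, ((metric x q)⁻¹ i j * mink w (pd x i q)) • pd x j q

/-- The component of `w` in the normal space of the surface in `ℍ⁴`. -/
def normalPart (x : Plane → R51) (q : Plane) (w : R51) : R51 :=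
  projH (x q) w - tangentPart x q w

/-- The second fundamental form `B(∂_i, ∂_j)` of the surface in `ℍ⁴`. -/
def secondFF (x : Plane → R51) (i j : Fin 2) (q : Plane) : R51 :=
  normalPart x q (pd (pd x j) i q)

/-- The mean curvature vector field `H = (trace B) / 2`. -/
def meanCurvVec (x : Plane → R51) (q : Plane) : R51 :=
  (1 / 2 : ℝ) • ∑ i, ∑ j, (metric x q)⁻¹ i j • secondFF x i j q

/-- The mean curvature function `f = |H|`. -/
def meanCurv (x : Plane → R51) (q : Plane) : ℝ := len (meanCurvVec x q)

/-- The gradient of the mean curvature function, as a vector of `ℝ⁵₁` tangent to the surface. -/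
def gradMeanCurv (x : Plane → R51) (q : Plane) : R51 :=
  ∑ i, ∑ j, ((metric x q)⁻¹ i j * pd (meanCurv x) i q) • pd x j q

/-- The normalized mean curvature vector field `H / |H|`. -/
def unitMeanCurvVec (x : Plane → R51) (q : Plane) : R51 :=
  (meanCurv x q)⁻¹ • meanCurvVec x q

/-- The normal connection `∇^⊥_{∂_i} V`. -/
def normalConn (x V : Plane → R51) (i : Fin 2) (q : Plane) : R51 :=
  normalPart x q (pd V i q)

/-- The pull-back connection `∇^φ_{∂_i} V` on vector fields of `ℍ⁴` along the surface. -/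
def pullbackConn (x V : Plane → R51) (i : Fin 2) : Plane → R51 :=
  fun q => projH (x q) (pd V i q)

/-- The rough Laplacian `Δ^φ V = -trace (∇^φ ∇^φ - ∇^φ_∇) V`. -/
def roughLaplacian (x V : Plane → R51) (q : Plane) : R51 :=
  -∑ i, ∑ j, (metric x q)⁻¹ i j •
    (pullbackConn x (pullbackConn x V j) i q
      - ∑ k, christoffel x k i j q • pullbackConn x V k q)

/-- The tension field `τ(φ) = 2 H`. -/
def tension (x : Plane → R51) (q : Plane) : R51 := (2 : ℝ) • meanCurvVec x q

/-- The bitension field `τ₂(φ) = -Δ^φ τ(φ) - trace R(φ_*, τ(φ)) φ_*`. -/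
def bitension (x : Plane → R51) (q : Plane) : R51 :=
  -roughLaplacian x (tension x) q
    - ∑ i, ∑ j, (metric x q)⁻¹ i j • curvH (x q) (pd x i q) (tension x q) (pd x j q)

end Surface

/-! ### Curves in `ℍ⁴` -/

section Curve

/-- The covariant derivative in `ℍ⁴` of a vector field `V` along the curve `γ`. -/
def curveConn (γ V : ℝ → R51) (u : ℝ) : R51 := projH (γ u) (deriv V u)

/-- The curvature `κ = |∇_{γ'} γ'|` of a curve parametrized by arc length. -/
def curveCurvature (γ : ℝ → R51) (u : ℝ) : ℝ := len (curveConn γ (deriv γ) u)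

/-- The principal normal `κ⁻¹ ∇_{γ'} γ'`. -/
def principalNormal (γ : ℝ → R51) (u : ℝ) : R51 :=
  (curveCurvature γ u)⁻¹ • curveConn γ (deriv γ) u

/-- The torsion (second Frenet curvature) `|∇_{γ'} V₂ + κ γ'|`, with `V₂` the principal normal.
A totally geodesic `ℍ³` containing the curve has the same covariant derivative along it, so this
and `curveCurvature` are also the curvature and torsion of the curve in `ℍ³`. -/
def curveTorsion (γ : ℝ → R51) (u : ℝ) : ℝ :=
  len (curveConn γ (principalNormal γ) u + curveCurvature γ u • deriv γ u)

end Curve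

/-! ### Surfaces in `ℍ⁴` -/

section Manifold

variable {M : Type*} [TopologicalSpace M] [ChartedSpace Plane M]

/-- The map `Φ = ι ∘ φ` into `ℝ⁵₁`. -/
def toR51 (φ : M → H4) : M → R51 := fun p => (φ p : R51)

/-- The immersion read in a chart. -/
def inChart (φ : M → H4) (e : OpenPartialHomeomorph M Plane) : Plane → R51 :=
  fun q => toR51 φ (e.symm q)

/-- PNMC biconservative immersions `φ : M² → ℍ⁴`, where `M` has the induced metric. All the
quantities below are independent of the chart. -/
structure IsPNMCBiconservative (φ : M → H4) : Prop where
  smooth : ContMDiff (𝓡 2) 𝓘(ℝ, R51) ∞ (toR51 φ)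
  immersion : ∀ p : M, Function.Injective (mfderiv (𝓡 2) 𝓘(ℝ, R51) (toR51 φ) p)
  /-- the mean curvature function is positive -/
  meanCurv_pos : ∀ e ∈ IsManifold.maximalAtlas (𝓡 2) ∞ M, ∀ q ∈ e.target,
    0 < meanCurv (inChart φ e) q
  /-- its gradient vanishes nowhere (in particular the surface is non-CMC) -/
  grad_ne_zero : ∀ e ∈ IsManifold.maximalAtlas (𝓡 2) ∞ M, ∀ q ∈ e.target,
    gradMeanCurv (inChart φ e) q ≠ 0
  /-- `∇^⊥ (H / |H|) = 0` -/
  parallel : ∀ e ∈ IsManifold.maximalAtlas (𝓡 2) ∞ M, ∀ q ∈ e.target, ∀ i,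
    normalConn (inChart φ e) (unitMeanCurvVec (inChart φ e)) i q = 0
  /-- `τ₂(φ)^⊤ = 0` -/
  biconservative : ∀ e ∈ IsManifold.maximalAtlas (𝓡 2) ∞ M, ∀ q ∈ e.target,
    tangentPart (inChart φ e) q (bitension (inChart φ e) q) = 0
  /-- no non-empty open subset lies in a totally geodesic `ℍ³` -/
  full : ∀ U : Set M, IsOpen U → U.Nonempty → ∀ n : R51, 0 < mink n n →
    ¬ ∀ p ∈ U, toR51 φ p ∈ hypersurfaceH3 n

/-- `|grad f| = (4/3) f √(1 + 9 C f^{3/2} - 9 f² - c² f³)` for the mean curvature function `f`; here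
`|grad f| = E₁ f` for `E₁ = grad f / |grad f|`. As `f` is not constant, this determines the
integration constant `C` and the number `c²`. -/
def HasIntegrationConstants (φ : M → H4) (c C : ℝ) : Prop :=
  ∀ e ∈ IsManifold.maximalAtlas (𝓡 2) ∞ M, ∀ q ∈ e.target,
    len (gradMeanCurv (inChart φ e) q) =
      4 / 3 * meanCurv (inChart φ e) q *
        Real.sqrt (1 + 9 * C * meanCurv (inChart φ e) q ^ (3 / 2 : ℝ)
          - 9 * meanCurv (inChart φ e) q ^ 2 - c ^ 2 * meanCurv (inChart φ e) q ^ 3)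

end Manifold

end BiconservativeH4

end

open BiconservativeH4

open scoped Manifold ContDiff

open BiconservativeH4

noncomputable section

namespace BiconservativeH4

/-! Near any point the surface carries a frame `x, E₁, E₂, E₃, E₄` of `ℝ⁵₁` with `E₁ = grad f /
|grad f|` and `E₃ = H / |H|`. Since `E₃` is parallel, so is `E₄`, and the structure equations
involve only the connection coefficients `α`, `β` of the surface and its two second fundamental
forms. `ℍ⁴` has constant curvature, so the curvature term of the bitension field is normal, and
biconservativity is a condition on the rough Laplacian of `2f E₃` alone. Combined with the Codazzi
equations, it forces the shape operator of `E₃` to be diagonal with eigenvalues `-f` and `3f`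
(`StructureEquations.principal_curvatures`).

The remaining Codazzi, Ricci and Gauss equations (`StructureEquations.isBiconsFrame`) leave three
functions that are constant along `E₂` and satisfy `E₁f = (4/3)fβ`, `E₁k = 2βk`, `E₁β = β² - 1 - 3f²
- k²`. The weight `w = f^(-3/4)` satisfies `E₁w = -βw`. Hence `k w²` and `(β² - 1 + 9f² + k²) w²`
are constants, called `c` and `9C` (`IsBiconsFrame.exists_constants`). As `|grad f| = E₁f =
(4/3)fβ`, this is the asserted relation. If `c = 0`, then `k = 0`, the vector `E₄` is constant, and
an open piece of the surface lies in the `ℍ³` orthogonal to it, against fullness. Two different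
values of `f` determine `c²` and `C` (`constants_unique`), so these are locally constant, hence
global on the connected `M`.

If `C = 0`, the vector `N = x + βE₁ + 3fE₃ - kE₄`, which is the flat derivative of `E₂` along
itself, is lightlike, and `wN` is a constant vector `2b₂`. Since `E₂` is also parallel along `E₁`,
it follows that `E₂ = b₁ + 2v f^(3/4) b₂` with `b₁` constant and `v = ⟨x, b₁⟩`
(`IsBiconsFrame.exists_constant_vectors`). Integrating in `v` exhibits the integral curves of `E₂`
as parabolas. The other coordinate is `u = G(f)`, where `G` is a primitive of `1 / ((4/3) t √(1 -
9t² - c²t³))`, so that `E₁u = 1`. The directrix `v = 0` is then an integral curve of `E₁`, and its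
curvature and torsion follow from the structure equations (`IsBiconsFrame.curve_geometry`).

The geometric quantities are defined by coordinate formulas. They are converted to frame formulas
through `IsOrthonormalAt.metric_inv`, and compared between charts by
`IsPNMCBiconservative.chart_independence`. -/

/-! ### The Minkowski form -/

/-- The Minkowski form as a continuous bilinear map. -/
def minkB : R51 →L[ℝ] R51 →L[ℝ] ℝ :=
  ∑ i : Fin 5, (ContinuousLinearMap.proj (R := ℝ) (φ := fun _ : Fin 5 => ℝ) i).smulRight
    ((if i = 4 then (-1 : ℝ) else 1) •
      ContinuousLinearMap.proj (R := ℝ) (φ := fun _ : Fin 5 => ℝ) i)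

lemma minkB_apply (x y : R51) : minkB x y = mink x y := by
  simp [minkB, mink, Fin.sum_univ_five]
  ring

lemma mink_comm (x y : R51) : mink x y = mink y x := by simp only [mink]; ring

lemma mink_add_left (x y z : R51) : mink (x + y) z = mink x z + mink y z := by
  simp only [mink, Pi.add_apply]; ring

lemma mink_add_right (x y z : R51) : mink x (y + z) = mink x y + mink x z := by
  simp only [mink, Pi.add_apply]; ring

lemma mink_sub_left (x y z : R51) : mink (x - y) z = mink x z - mink y z := by
  simp only [mink, Pi.sub_apply]; ring

lemma mink_sub_right (x y z : R51) : mink x (y - z) = mink x y - mink x z := by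
  simp only [mink, Pi.sub_apply]; ring

lemma mink_neg_left (x z : R51) : mink (-x) z = -mink x z := by
  simp only [mink, Pi.neg_apply]; ring

lemma mink_smul_left (r : ℝ) (x z : R51) : mink (r • x) z = r * mink x z := by
  simp only [mink, Pi.smul_apply, smul_eq_mul]; ring

lemma mink_smul_right (r : ℝ) (x z : R51) : mink x (r • z) = r * mink x z := by
  simp only [mink, Pi.smul_apply, smul_eq_mul]; ring

lemma mink_zero_left (z : R51) : mink 0 z = 0 := by simp [mink]

lemma mink_zero_right (z : R51) : mink z 0 = 0 := by simp [mink]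

lemma mink_sum_left {ι : Type*} (s : Finset ι) (w : ι → R51) (z : R51) :
    mink (∑ i ∈ s, w i) z = ∑ i ∈ s, mink (w i) z := by
  simp only [← minkB_apply, map_sum, sum_apply]

/-- The orthogonal complement of a timelike vector is spacelike. Cauchy–Schwarz in the first four
coordinates gives `(w⁵y⁵)² ≤ S((y⁵)² - 1)`, where `S` is the spacelike part of `⟨w, w⟩`. Hence
`(y⁵)²(S - (w⁵)²) ≥ S`, and `S > 0` because otherwise `w = 0`. -/
lemma mink_self_pos_of_orthogonal {y w : R51} (hy : y ∈ H4) (h : mink w y = 0) (hw : w ≠ 0) :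
    0 < mink w w := by
  obtain ⟨h1, h2⟩ := hy
  simp only [mink] at *
  have hcs : (w 0 * y 0 + w 1 * y 1 + w 2 * y 2 + w 3 * y 3) ^ 2 ≤
      (w 0 ^ 2 + w 1 ^ 2 + w 2 ^ 2 + w 3 ^ 2) * (y 0 ^ 2 + y 1 ^ 2 + y 2 ^ 2 + y 3 ^ 2) := by
    nlinarith [sq_nonneg (w 0 * y 1 - w 1 * y 0), sq_nonneg (w 0 * y 2 - w 2 * y 0),
      sq_nonneg (w 0 * y 3 - w 3 * y 0), sq_nonneg (w 1 * y 2 - w 2 * y 1),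
      sq_nonneg (w 1 * y 3 - w 3 * y 1), sq_nonneg (w 2 * y 3 - w 3 * y 2)]
  have e1 : w 0 * y 0 + w 1 * y 1 + w 2 * y 2 + w 3 * y 3 = w 4 * y 4 := by linarith
  have e2 : y 0 ^ 2 + y 1 ^ 2 + y 2 ^ 2 + y 3 ^ 2 = y 4 ^ 2 - 1 := by linarith
  rw [e1, e2] at hcs
  set S := w 0 ^ 2 + w 1 ^ 2 + w 2 ^ 2 + w 3 ^ 2 with hS
  have hSpos : 0 < S := by
    by_contra hcon
    have h0 : w 0 ^ 2 = 0 := by nlinarith [sq_nonneg (w 0), sq_nonneg (w 1), sq_nonneg (w 2), sq_nonneg (w 3)]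
    have h1' : w 1 ^ 2 = 0 := by nlinarith [sq_nonneg (w 0), sq_nonneg (w 1), sq_nonneg (w 2), sq_nonneg (w 3)]
    have h2' : w 2 ^ 2 = 0 := by nlinarith [sq_nonneg (w 0), sq_nonneg (w 1), sq_nonneg (w 2), sq_nonneg (w 3)]
    have h3 : w 3 ^ 2 = 0 := by nlinarith [sq_nonneg (w 0), sq_nonneg (w 1), sq_nonneg (w 2), sq_nonneg (w 3)]
    have g0 := pow_eq_zero_iff (two_ne_zero) |>.1 h0
    have g1 := pow_eq_zero_iff (two_ne_zero) |>.1 h1'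
    have g2 := pow_eq_zero_iff (two_ne_zero) |>.1 h2'
    have g3 := pow_eq_zero_iff (two_ne_zero) |>.1 h3
    have g4 : w 4 = 0 := by
      rw [g0, g1, g2, g3] at e1
      have : w 4 * y 4 = 0 := by linarith
      rcases mul_eq_zero.1 this with h | h
      · exact h
      · linarith
    apply hw
    ext i
    fin_cases i <;> simp [g0, g1, g2, g3, g4]
  have hy4 : 0 < y 4 ^ 2 := by positivity
  have : y 4 ^ 2 * (S - w 4 ^ 2) > 0 := by nlinarith
  have := (mul_pos_iff_of_pos_left hy4).1 this
  nlinarith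

/-- Pseudo-orthonormal frames `y, e₁, e₂, e₃, e₄` of `ℝ⁵₁`, with `y` timelike. -/
structure IsFrame (y e₁ e₂ e₃ e₄ : R51) : Prop where
  h00 : mink y y = -1
  h11 : mink e₁ e₁ = 1
  h22 : mink e₂ e₂ = 1
  h33 : mink e₃ e₃ = 1
  h44 : mink e₄ e₄ = 1
  h01 : mink y e₁ = 0
  h02 : mink y e₂ = 0
  h03 : mink y e₃ = 0
  h04 : mink y e₄ = 0
  h12 : mink e₁ e₂ = 0
  h13 : mink e₁ e₃ = 0
  h14 : mink e₁ e₄ = 0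
  h23 : mink e₂ e₃ = 0
  h24 : mink e₂ e₄ = 0
  h34 : mink e₃ e₄ = 0

namespace IsFrame

variable {y e₁ e₂ e₃ e₄ : R51}

/-- With the frame as rows of `A`, orthonormality is `A η Aᵀ = η`. Thus `η Aᵀ η` is a right inverse
of `A`, hence a left inverse, and this is the expansion formula. -/
lemma expand (h : IsFrame y e₁ e₂ e₃ e₄) (w : R51) :
    w = -mink w y • y + mink w e₁ • e₁ + mink w e₂ • e₂ + mink w e₃ • e₃ + mink w e₄ • e₄ := by
  let row : Fin 5 → R51 := ![e₁, e₂, e₃, e₄, y]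
  let A : Matrix (Fin 5) (Fin 5) ℝ := Matrix.of row
  let η : Matrix (Fin 5) (Fin 5) ℝ := Matrix.diagonal ![1, 1, 1, 1, -1]
  have hAB : ∀ i j, (A * η * A.transpose) i j = mink (row i) (row j) := by
    intro i j
    simp [A, η, Matrix.mul_apply, Fin.sum_univ_five, mink]
    ring
  have h1 : A * η * A.transpose = η := by
    ext i j
    rw [hAB]
    fin_cases i <;> fin_cases j <;>
      simp [row, η, Matrix.diagonal, h.h00, h.h11, h.h22, h.h33, h.h44, h.h01, h.h02, h.h03, h.h04,
        h.h12, h.h13, h.h14, h.h23, h.h24, h.h34, mink_comm e₁ y, mink_comm e₂ y, mink_comm e₃ y,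
        mink_comm e₄ y, mink_comm e₂ e₁, mink_comm e₃ e₁, mink_comm e₄ e₁, mink_comm e₃ e₂,
        mink_comm e₄ e₂, mink_comm e₄ e₃]
  have hη : η * η = 1 := by
    rw [Matrix.diagonal_mul_diagonal, ← Matrix.diagonal_one]
    congr 1
    ext i
    fin_cases i <;> simp
  have h2 : A * (η * A.transpose * η) = 1 := by
    rw [← hη]; nth_rewrite 3 [← h1]; simp only [Matrix.mul_assoc]
  have h3 : (η * A.transpose * η) * A = 1 := mul_eq_one_comm.1 h2
  have h4 : Matrix.vecMul w ((η * A.transpose * η) * A) = w := by rw [h3, Matrix.vecMul_one]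
  conv_lhs => rw [← h4]
  ext l
  simp [A, row, η, Matrix.vecMul, dotProduct, Matrix.mul_apply, Fin.sum_univ_five, mink]
  ring

lemma coeff_eq_zero (h : IsFrame y e₁ e₂ e₃ e₄) {c₀ c₁ c₂ c₃ c₄ : ℝ}
    (hc : c₀ • y + c₁ • e₁ + c₂ • e₂ + c₃ • e₃ + c₄ • e₄ = 0) :
    c₀ = 0 ∧ c₁ = 0 ∧ c₂ = 0 ∧ c₃ = 0 ∧ c₄ = 0 := by
  have key : ∀ z, mink (c₀ • y + c₁ • e₁ + c₂ • e₂ + c₃ • e₃ + c₄ • e₄) z = 0 := fun z => by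
    rw [hc, mink_zero_left]
  have k0 := key y
  have k1 := key e₁
  have k2 := key e₂
  have k3 := key e₃
  have k4 := key e₄
  simp only [mink_add_left, mink_smul_left, h.h00, h.h11, h.h22, h.h33, h.h44, h.h01, h.h02, h.h03,
    h.h04, h.h12, h.h13, h.h14, h.h23, h.h24, h.h34, mink_comm e₁ y, mink_comm e₂ y, mink_comm e₃ y,
        mink_comm e₄ y, mink_comm e₂ e₁, mink_comm e₃ e₁, mink_comm e₄ e₁, mink_comm e₃ e₂,
        mink_comm e₄ e₂, mink_comm e₄ e₃] at k0 k1 k2 k3 k4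
  refine ⟨?_, ?_, ?_, ?_, ?_⟩ <;> linarith

end IsFrame

/-! ### Derivatives along vector fields of the plane -/

section dir

variable {F : Type*} [NormedAddCommGroup F] [NormedSpace ℝ F]

/-- The derivative of `V` along the vector field `X`. -/
def dir (X : Plane → Plane) (V : Plane → F) (q : Plane) : F := fderiv ℝ V q (X q)

variable {X Y : Plane → Plane} {V W : Plane → F} {g h : Plane → ℝ} {q : Plane} {U : Set Plane}

lemma dir_congr (hU : IsOpen U) (h : Set.EqOn V W U) (hq : q ∈ U) : dir X V q = dir X W q := by
  unfold dir
  rw [Filter.EventuallyEq.fderiv_eq (Filter.eventuallyEq_of_mem (hU.mem_nhds hq) h)]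

lemma dir_add (hV : DifferentiableAt ℝ V q) (hW : DifferentiableAt ℝ W q) :
    dir X (fun r => V r + W r) q = dir X V q + dir X W q := by
  unfold dir; rw [fderiv_fun_add hV hW]; rfl

lemma dir_sub (hV : DifferentiableAt ℝ V q) (hW : DifferentiableAt ℝ W q) :
    dir X (fun r => V r - W r) q = dir X V q - dir X W q := by
  unfold dir; rw [fderiv_fun_sub hV hW]; rfl

lemma dir_neg : dir X (fun r => - V r) q = - dir X V q := by
  unfold dir; rw [fderiv_fun_neg]; rfl

lemma dir_const (w : F) : dir X (fun _ => w) q = 0 := by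
  unfold dir; simp

lemma dir_smul (hg : DifferentiableAt ℝ g q) (hV : DifferentiableAt ℝ V q) :
    dir X (fun r => g r • V r) q = dir X g q • V q + g q • dir X V q := by
  unfold dir; rw [fderiv_fun_smul hg hV]; simp [add_comm]

lemma dir_mul (hg : DifferentiableAt ℝ g q) (hh : DifferentiableAt ℝ h q) :
    dir X (fun r => g r * h r) q = dir X g q * h q + g q * dir X h q := by
  unfold dir; rw [fderiv_fun_mul hg hh]; simp; ring

lemma dir_mink {V W : Plane → R51} (hV : DifferentiableAt ℝ V q) (hW : DifferentiableAt ℝ W q) :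
    dir X (fun r => mink (V r) (W r)) q = mink (dir X V q) (W q) + mink (V q) (dir X W q) := by
  unfold dir
  have := (minkB.hasFDerivAt_of_bilinear hV.hasFDerivAt hW.hasFDerivAt).fderiv
  simp only [minkB_apply] at this
  rw [this]
  simp [ContinuousLinearMap.precompR, ContinuousLinearMap.precompL, minkB_apply, add_comm]

lemma contDiffOn_dir (hU : IsOpen U) (hX : ContDiffOn ℝ ∞ X U) (hV : ContDiffOn ℝ ∞ V U) :
    ContDiffOn ℝ ∞ (dir X V) U :=
  (hV.fderiv_of_isOpen hU (by simp)).clm_apply hX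

lemma contDiffOn_mink {V W : Plane → R51} (hV : ContDiffOn ℝ ∞ V U) (hW : ContDiffOn ℝ ∞ W U) :
    ContDiffOn ℝ ∞ (fun q => mink (V q) (W q)) U := by
  simp only [← minkB_apply]
  exact (minkB.contDiff.comp_contDiffOn hV).clm_apply hW

lemma differentiableAt_of_contDiffOn (hU : IsOpen U) (hV : ContDiffOn ℝ ∞ V U) (hq : q ∈ U) :
    DifferentiableAt ℝ V q :=
  (hV.contDiffAt (hU.mem_nhds hq)).differentiableAt (by simp)

lemma dir_dir (hV : ContDiffAt ℝ ∞ V q) (hX : DifferentiableAt ℝ X q) :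
    dir Y (dir X V) q = fderiv ℝ (fderiv ℝ V) q (Y q) (X q) + fderiv ℝ V q (dir Y X q) := by
  have h1 : DifferentiableAt ℝ (fderiv ℝ V) q :=
    (hV.fderiv_right (m := ∞) (by simp)).differentiableAt (by simp)
  have := (h1.hasFDerivAt.clm_apply hX.hasFDerivAt).fderiv
  unfold dir
  rw [this]
  simp [add_comm]

/-- The second derivative of `V` is symmetric and cancels, so the commutator acts as the derivative
along the bracket of the two fields. -/
lemma dir_comm (hV : ContDiffAt ℝ ∞ V q) (hX : DifferentiableAt ℝ X q)
    (hY : DifferentiableAt ℝ Y q) :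
    dir X (dir Y V) q - dir Y (dir X V) q = fderiv ℝ V q (dir X Y q - dir Y X q) := by
  rw [dir_dir hV hX, dir_dir hV hY]
  have := (hV.isSymmSndFDerivAt (by simp only [minSmoothness_of_isRCLikeNormedField]; exact ENat.LEInfty.out)).eq (X q) (Y q)
  rw [this, map_sub]
  abel

end dir

/-! ### Traces with respect to the induced metric -/

section Trace

variable {x : Plane → R51} {q : Plane} {X₁ X₂ : Plane}
variable {F : Type*} [NormedAddCommGroup F] [NormedSpace ℝ F]

lemma plane_eq (v : Plane) :
    v = v 0 • EuclideanSpace.single (0 : Fin 2) (1 : ℝ) +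
      v 1 • EuclideanSpace.single (1 : Fin 2) (1 : ℝ) := by
  ext i
  fin_cases i <;> simp

lemma map_plane (A : Plane →L[ℝ] F) (v : Plane) :
    A v = v 0 • A (EuclideanSpace.single (0 : Fin 2) (1 : ℝ)) +
      v 1 • A (EuclideanSpace.single (1 : Fin 2) (1 : ℝ)) := by
  conv_lhs => rw [plane_eq v]
  simp only [map_add, map_smul]

lemma fderiv_eq_pd (V : Plane → F) (v : Plane) :
    fderiv ℝ V q v = v 0 • pd V 0 q + v 1 • pd V 1 q := map_plane _ v

/-- The vectors `X₁`, `X₂` form an orthonormal basis for the induced metric at `q`. -/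
structure IsOrthonormalAt (x : Plane → R51) (q X₁ X₂ : Plane) : Prop where
  h11 : mink (fderiv ℝ x q X₁) (fderiv ℝ x q X₁) = 1
  h12 : mink (fderiv ℝ x q X₁) (fderiv ℝ x q X₂) = 0
  h22 : mink (fderiv ℝ x q X₂) (fderiv ℝ x q X₂) = 1

namespace IsOrthonormalAt

/-- If `P` has columns `X₁`, `X₂`, orthonormality reads `Pᵀ g P = 1`, so `g⁻¹ = P Pᵀ`. This turns
every coordinate trace into a sum over an orthonormal basis. -/
lemma metric_inv (h : IsOrthonormalAt x q X₁ X₂) (i j : Fin 2) :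
    (metric x q)⁻¹ i j = X₁ i * X₁ j + X₂ i * X₂ j := by
  obtain ⟨h11, h12, h22⟩ := h
  let P : Matrix (Fin 2) (Fin 2) ℝ := !![X₁ 0, X₂ 0; X₁ 1, X₂ 1]
  have h1 : P.transpose * (metric x q * P) = 1 := by
    rw [fderiv_eq_pd, fderiv_eq_pd] at h12
    rw [fderiv_eq_pd] at h11 h22
    simp only [mink_add_left, mink_add_right, mink_smul_left, mink_smul_right] at h11 h12 h22
    have hc := mink_comm (pd x 1 q) (pd x 0 q)
    rw [hc] at h11 h12 h22
    ext i j
    fin_cases i <;> fin_cases j <;>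
      simp [P, Matrix.mul_apply, Fin.sum_univ_two, metric, hc] <;> linarith
  have h2 : metric x q * (P * P.transpose) = 1 := by
    rw [← Matrix.mul_assoc]; exact mul_eq_one_comm.1 h1
  rw [Matrix.inv_eq_right_inv h2]
  fin_cases i <;> fin_cases j <;> simp [P, Matrix.mul_apply, Fin.sum_univ_two]

lemma trace_eq (h : IsOrthonormalAt x q X₁ X₂) (T : Fin 2 → Fin 2 → F) :
    ∑ i, ∑ j, (metric x q)⁻¹ i j • T i j =
      (∑ i, ∑ j, (X₁ i * X₁ j) • T i j) + ∑ i, ∑ j, (X₂ i * X₂ j) • T i j := by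
  simp only [h.metric_inv, add_smul, Finset.sum_add_distrib]

lemma tangentPart_eq (h : IsOrthonormalAt x q X₁ X₂) (w : R51) :
    tangentPart x q w = mink w (fderiv ℝ x q X₁) • fderiv ℝ x q X₁ +
      mink w (fderiv ℝ x q X₂) • fderiv ℝ x q X₂ := by
  unfold tangentPart
  simp only [h.metric_inv, fderiv_eq_pd, Fin.sum_univ_two, mink_add_right, mink_smul_right]
  module

lemma gradMeanCurv_eq (h : IsOrthonormalAt x q X₁ X₂) :
    gradMeanCurv x q = fderiv ℝ (meanCurv x) q X₁ • fderiv ℝ x q X₁ +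
      fderiv ℝ (meanCurv x) q X₂ • fderiv ℝ x q X₂ := by
  unfold gradMeanCurv
  simp only [h.metric_inv, fderiv_eq_pd, Fin.sum_univ_two, smul_eq_mul]
  module

end IsOrthonormalAt

lemma normalPart_add (v w : R51) :
    normalPart x q (v + w) = normalPart x q v + normalPart x q w := by
  simp only [normalPart, projH, tangentPart, mink_add_left, mul_add, add_smul,
    Finset.sum_add_distrib]
  abel

lemma normalPart_smul (r : ℝ) (w : R51) :
    normalPart x q (r • w) = r • normalPart x q w := by
  simp only [normalPart, projH, tangentPart, mink_smul_left, smul_sub, smul_add,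
    Finset.smul_sum, smul_smul]
  congr 1
  refine Finset.sum_congr rfl fun i _ => Finset.sum_congr rfl fun j _ => ?_
  congr 1; ring

lemma differentiableAt_fderiv {V : Plane → F} (hV : ContDiffAt ℝ ∞ V q) :
    DifferentiableAt ℝ (fderiv ℝ V) q :=
  (hV.fderiv_right (m := ∞) (by simp)).differentiableAt (by simp)

lemma pd_pd {V : Plane → F} (hV : ContDiffAt ℝ ∞ V q) (i j : Fin 2) :
    pd (pd V j) i q = fderiv ℝ (fderiv ℝ V) q (EuclideanSpace.single i 1)
      (EuclideanSpace.single j 1) := by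
  have := ((differentiableAt_fderiv hV).hasFDerivAt.clm_apply
    (hasFDerivAt_const (EuclideanSpace.single j (1 : ℝ)) q)).fderiv
  unfold pd
  rw [this]
  simp

lemma sum_smul_pd_pd {V : Plane → F} (hV : ContDiffAt ℝ ∞ V q) (v w : Plane) :
    ∑ i, ∑ j, (v i * w j) • pd (pd V j) i q = fderiv ℝ (fderiv ℝ V) q v w := by
  simp only [pd_pd hV, Fin.sum_univ_two]
  rw [map_plane (fderiv ℝ (fderiv ℝ V) q) v]
  simp only [add_apply, smul_apply]
  rw [map_plane _ w, map_plane (fderiv ℝ (fderiv ℝ V) q (EuclideanSpace.single 1 1)) w]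
  module

lemma IsOrthonormalAt.meanCurvVec_eq (hx : ContDiffAt ℝ ∞ x q) (h : IsOrthonormalAt x q X₁ X₂) :
    meanCurvVec x q = (1 / 2 : ℝ) •
      (normalPart x q (fderiv ℝ (fderiv ℝ x) q X₁ X₁) +
        normalPart x q (fderiv ℝ (fderiv ℝ x) q X₂ X₂)) := by
  unfold meanCurvVec
  rw [h.trace_eq, ← sum_smul_pd_pd hx, ← sum_smul_pd_pd hx]
  simp only [Fin.sum_univ_two, normalPart_add, normalPart_smul, secondFF]

end Trace

/-! ### Spacelike immersions -/

section Immersion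

variable {x : Plane → R51} {q : Plane} {X₁ X₂ : Plane}

lemma mink_fderiv_self {U : Set Plane} (hU : IsOpen U) (hx : ContDiffOn ℝ ∞ x U)
    (hH : ∀ q ∈ U, x q ∈ H4) (hq : q ∈ U) (v : Plane) : mink (fderiv ℝ x q v) (x q) = 0 := by
  have hd := differentiableAt_of_contDiffOn hU hx hq
  have h1 : dir (fun _ => v) (fun r => mink (x r) (x r)) q = dir (fun _ => v) (fun _ => (-1 : ℝ)) q :=
    dir_congr hU (fun r hr => (hH r hr).1) hq
  rw [dir_const, dir_mink hd hd] at h1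
  unfold dir at h1
  rw [mink_comm (x q)] at h1
  linarith

/-- The rotation by a right angle in the tangent plane. -/
def rot (x : Plane → R51) (q X : Plane) : Plane :=
  (Real.sqrt (metric x q 0 0 * metric x q 1 1 - metric x q 0 1 ^ 2))⁻¹ •
    !₂[-(metric x q 0 1 * X 0 + metric x q 1 1 * X 1), metric x q 0 0 * X 0 + metric x q 0 1 * X 1]

/-- The differential at `q` is injective with spacelike image. -/
def IsSpacelikeAt (x : Plane → R51) (q : Plane) : Prop :=
  ∀ v : Plane, v ≠ 0 → 0 < mink (fderiv ℝ x q v) (fderiv ℝ x q v)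

lemma mink_fderiv_fderiv (v w : Plane) :
    mink (fderiv ℝ x q v) (fderiv ℝ x q w) = v 0 * w 0 * metric x q 0 0 +
      (v 0 * w 1 + v 1 * w 0) * metric x q 0 1 + v 1 * w 1 * metric x q 1 1 := by
  rw [fderiv_eq_pd, fderiv_eq_pd]
  simp only [mink_add_left, mink_add_right, mink_smul_left, mink_smul_right, metric, Matrix.of_apply]
  rw [mink_comm (pd x 1 q) (pd x 0 q)]
  ring

lemma IsSpacelikeAt.injective (h : IsSpacelikeAt x q) : Function.Injective (fderiv ℝ x q) := by
  rw [injective_iff_map_eq_zero]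
  intro v hv
  by_contra hne
  have := h v hne
  rw [hv, mink_zero_left] at this
  exact lt_irrefl _ this

lemma IsSpacelikeAt.metric_pos (h : IsSpacelikeAt x q) : 0 < metric x q 0 0 := by
  have := h (EuclideanSpace.single 0 1) (by simp)
  rw [mink_fderiv_fderiv] at this
  simpa using this

lemma IsSpacelikeAt.det_pos (h : IsSpacelikeAt x q) :
    0 < metric x q 0 0 * metric x q 1 1 - metric x q 0 1 ^ 2 := by
  have h0 := h.metric_pos
  have := h !₂[-metric x q 0 1, metric x q 0 0] (fun hz => by
    have := congrArg (fun v : Plane => v 1) hz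
    simp at this
    exact h0.ne' this)
  rw [mink_fderiv_fderiv] at this
  simp at this
  have h2 : 0 < metric x q 0 0 * (metric x q 0 0 * metric x q 1 1 - metric x q 0 1 ^ 2) := by
    nlinarith
  exact (mul_pos_iff_of_pos_left h0).1 h2

/-- Before normalization the rotated vector has squared length `det g · ⟨X₁, X₁⟩`, which explains
the factor in `rot`. The explicit formula also makes `E₂` depend smoothly on `E₁`. -/
lemma isOrthonormalAt_rot (h : IsSpacelikeAt x q)
    (h1 : mink (fderiv ℝ x q X₁) (fderiv ℝ x q X₁) = 1) :
    IsOrthonormalAt x q X₁ (rot x q X₁) := by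
  have hd := h.det_pos
  refine ⟨h1, ?_, ?_⟩
  · rw [mink_fderiv_fderiv]
    simp [rot]
    ring
  · rw [mink_fderiv_fderiv] at h1 ⊢
    have hs := Real.sq_sqrt hd.le
    have hs0 := (Real.sqrt_pos.2 hd).ne'
    simp [rot]
    set D := metric x q 0 0 * metric x q 1 1 - metric x q 0 1 ^ 2 with hD
    field_simp
    rw [hs]
    linear_combination D * h1

lemma IsSpacelikeAt.exists_isOrthonormalAt (h : IsSpacelikeAt x q) :
    ∃ X₁ X₂ : Plane, IsOrthonormalAt x q X₁ X₂ := by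
  have h0 := h.metric_pos
  refine ⟨_, _, isOrthonormalAt_rot h
    (X₁ := (Real.sqrt (metric x q 0 0))⁻¹ • EuclideanSpace.single 0 1) ?_⟩
  rw [mink_fderiv_fderiv]
  have hs := Real.sq_sqrt h0.le
  have hs0 := (Real.sqrt_pos.2 h0).ne'
  simp
  field_simp
  rw [hs]

lemma isSpacelikeAt_of_injective {U : Set Plane} (hU : IsOpen U) (hx : ContDiffOn ℝ ∞ x U)
    (hH : ∀ q ∈ U, x q ∈ H4) (hq : q ∈ U) (hinj : Function.Injective (fderiv ℝ x q)) :
    IsSpacelikeAt x q := fun v hv =>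
  mink_self_pos_of_orthogonal (hH q hq) (mink_fderiv_self hU hx hH hq v)
    (fun h => hv (hinj (by rw [h, map_zero])))

lemma tangentPart_fderiv (h : IsSpacelikeAt x q) (v : Plane) :
    tangentPart x q (fderiv ℝ x q v) = fderiv ℝ x q v := by
  obtain ⟨X₁, X₂, hX⟩ := h.exists_isOrthonormalAt
  have hdet : X₁ 0 * X₂ 1 - X₁ 1 * X₂ 0 ≠ 0 := by
    intro h0
    have hne : X₁ ≠ 0 := by
      rintro rfl
      have := hX.h11
      rw [map_zero, mink_zero_left] at this
      norm_num at this
    have h12 := hX.h12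
    have h22 := hX.h22
    have h11 := hX.h11
    have e0 : X₁ 0 • X₂ - X₂ 0 • X₁ = 0 := by
      ext i; fin_cases i
      · simp; ring
      · simp; linarith
    have e1 : X₁ 1 • X₂ - X₂ 1 • X₁ = 0 := by
      ext i; fin_cases i
      · simp; linarith
      · simp; ring
    have k0 := congrArg (fun v => mink (fderiv ℝ x q v) (fderiv ℝ x q X₂)) e0
    have k1 := congrArg (fun v => mink (fderiv ℝ x q v) (fderiv ℝ x q X₂)) e1
    simp [mink_sub_left, mink_smul_left, h12, h22, mink_zero_left] at k0 k1
    apply hne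
    ext i; fin_cases i <;> simp [k0, k1]
  obtain ⟨s, t, rfl⟩ : ∃ s t : ℝ, v = s • X₁ + t • X₂ := by
    obtain ⟨D, hD⟩ : ∃ D, D = X₁ 0 * X₂ 1 - X₁ 1 * X₂ 0 := ⟨_, rfl⟩
    rw [← hD] at hdet
    refine ⟨(v 0 * X₂ 1 - v 1 * X₂ 0) / D, (X₁ 0 * v 1 - X₁ 1 * v 0) / D, ?_⟩
    ext i; fin_cases i
    · simp; field_simp; linear_combination (v 0) * hD
    · simp; field_simp; linear_combination (v 1) * hD
  rw [hX.tangentPart_eq]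
  simp only [map_add, map_smul, mink_add_left, mink_smul_left, hX.h11, hX.h12, hX.h22,
    mink_comm (fderiv ℝ x q X₂) (fderiv ℝ x q X₁)]
  module

lemma normalPart_fderiv (h : IsSpacelikeAt x q) (hxq : ∀ v, mink (fderiv ℝ x q v) (x q) = 0)
    (v : Plane) : normalPart x q (fderiv ℝ x q v) = 0 := by
  rw [normalPart, tangentPart_fderiv h, projH, hxq]
  simp

end Immersion

/-! ### Moving frames -/

section Comb

variable {F : Type*} [NormedAddCommGroup F] [NormedSpace ℝ F]
variable {X : Plane → Plane} {V A B C : Plane → F} {c d : Plane → ℝ} {q : Plane} {U : Set Plane}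

lemma dir_of_eqOn_comb₂ (hU : IsOpen U) (hA : ContDiffOn ℝ ∞ A U) (hB : ContDiffOn ℝ ∞ B U)
    (hc : ContDiffOn ℝ ∞ c U) (hd : ContDiffOn ℝ ∞ d U)
    (hV : ∀ r ∈ U, V r = c r • A r + d r • B r) (hq : q ∈ U) :
    dir X V q = dir X c q • A q + c q • dir X A q + (dir X d q • B q + d q • dir X B q) := by
  have hA' := differentiableAt_of_contDiffOn hU hA hq
  have hB' := differentiableAt_of_contDiffOn hU hB hq
  have hc' := differentiableAt_of_contDiffOn hU hc hq
  have hd' := differentiableAt_of_contDiffOn hU hd hq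
  rw [dir_congr hU (W := fun r => c r • A r + d r • B r) hV hq,
    dir_add (hc'.fun_smul hA') (hd'.fun_smul hB'), dir_smul hc' hA', dir_smul hd' hB']

lemma dir_of_eqOn_add_comb₂ (hU : IsOpen U) (hA : ContDiffOn ℝ ∞ A U) (hB : ContDiffOn ℝ ∞ B U)
    (hC : ContDiffOn ℝ ∞ C U) (hc : ContDiffOn ℝ ∞ c U) (hd : ContDiffOn ℝ ∞ d U)
    (hV : ∀ r ∈ U, V r = C r + (c r • A r + d r • B r)) (hq : q ∈ U) :
    dir X V q = dir X C q +
      (dir X c q • A q + c q • dir X A q + (dir X d q • B q + d q • dir X B q)) := by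
  have hA' := differentiableAt_of_contDiffOn hU hA hq
  have hB' := differentiableAt_of_contDiffOn hU hB hq
  have hC' := differentiableAt_of_contDiffOn hU hC hq
  have hc' := differentiableAt_of_contDiffOn hU hc hq
  have hd' := differentiableAt_of_contDiffOn hU hd hq
  rw [dir_congr hU (W := fun r => C r + (c r • A r + d r • B r)) hV hq,
    dir_add hC' ((hc'.fun_smul hA').fun_add (hd'.fun_smul hB')),
    dir_add (hc'.fun_smul hA') (hd'.fun_smul hB'), dir_smul hc' hA', dir_smul hd' hB']

end Comb

/-- A smooth frame `x, E₁, E₂, E₃, E₄` along the surface `x`, with `E₁`, `E₂` tangent. -/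
structure IsMovingFrame (x : Plane → R51) (U : Set Plane) (X₁ X₂ : Plane → Plane)
    (E₁ E₂ E₃ E₄ : Plane → R51) : Prop where
  isOpen : IsOpen U
  smooth_x : ContDiffOn ℝ ∞ x U
  smooth_X₁ : ContDiffOn ℝ ∞ X₁ U
  smooth_X₂ : ContDiffOn ℝ ∞ X₂ U
  smooth_E₁ : ContDiffOn ℝ ∞ E₁ U
  smooth_E₂ : ContDiffOn ℝ ∞ E₂ U
  smooth_E₃ : ContDiffOn ℝ ∞ E₃ U
  smooth_E₄ : ContDiffOn ℝ ∞ E₄ U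
  spacelike : ∀ q ∈ U, IsSpacelikeAt x q
  dir₁ : ∀ q ∈ U, dir X₁ x q = E₁ q
  dir₂ : ∀ q ∈ U, dir X₂ x q = E₂ q
  isFrame : ∀ q ∈ U, IsFrame (x q) (E₁ q) (E₂ q) (E₃ q) (E₄ q)

/-- The structure equations of a moving frame whose normal part is parallel. -/
structure StructureEquations (x : Plane → R51) (U : Set Plane) (X₁ X₂ : Plane → Plane)
    (E₁ E₂ E₃ E₄ : Plane → R51) (α β p h r k m s : Plane → ℝ) : Prop
    extends IsMovingFrame x U X₁ X₂ E₁ E₂ E₃ E₄ where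
  smooth_α : ContDiffOn ℝ ∞ α U
  smooth_β : ContDiffOn ℝ ∞ β U
  smooth_p : ContDiffOn ℝ ∞ p U
  smooth_h : ContDiffOn ℝ ∞ h U
  smooth_r : ContDiffOn ℝ ∞ r U
  smooth_k : ContDiffOn ℝ ∞ k U
  smooth_m : ContDiffOn ℝ ∞ m U
  smooth_s : ContDiffOn ℝ ∞ s U
  d11 : ∀ q ∈ U, dir X₁ E₁ q = x q + α q • E₂ q + p q • E₃ q + k q • E₄ q
  d21 : ∀ q ∈ U, dir X₂ E₁ q = -β q • E₂ q + h q • E₃ q + m q • E₄ q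
  d12 : ∀ q ∈ U, dir X₁ E₂ q = -α q • E₁ q + h q • E₃ q + m q • E₄ q
  d22 : ∀ q ∈ U, dir X₂ E₂ q = x q + β q • E₁ q + r q • E₃ q + s q • E₄ q
  d13 : ∀ q ∈ U, dir X₁ E₃ q = -p q • E₁ q + -h q • E₂ q
  d23 : ∀ q ∈ U, dir X₂ E₃ q = -h q • E₁ q + -r q • E₂ q
  d14 : ∀ q ∈ U, dir X₁ E₄ q = -k q • E₁ q + -m q • E₂ q
  d24 : ∀ q ∈ U, dir X₂ E₄ q = -m q • E₁ q + -s q • E₂ q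

section Frame

variable {x : Plane → R51} {U : Set Plane} {X₁ X₂ : Plane → Plane} {E₁ E₂ E₃ E₄ : Plane → R51}
  {α β p h r k m s : Plane → ℝ} {q : Plane}

lemma mink_dir_eq_neg {V W : Plane → R51} {X : Plane → Plane} {c : ℝ} (hU : IsOpen U)
    (hV : ContDiffOn ℝ ∞ V U) (hW : ContDiffOn ℝ ∞ W U) (h : ∀ q ∈ U, mink (V q) (W q) = c)
    (hq : q ∈ U) : mink (dir X V q) (W q) = -mink (dir X W q) (V q) := by
  have h1 : dir X (fun r => mink (V r) (W r)) q = dir X (fun _ => c) q := dir_congr hU h hq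
  rw [dir_const, dir_mink (differentiableAt_of_contDiffOn hU hV hq)
    (differentiableAt_of_contDiffOn hU hW hq), mink_comm (V q)] at h1
  linarith

namespace IsMovingFrame

lemma isOrthonormalAt (H : IsMovingFrame x U X₁ X₂ E₁ E₂ E₃ E₄) (hq : q ∈ U) :
    IsOrthonormalAt x q (X₁ q) (X₂ q) := by
  have f := H.isFrame q hq
  have d1 := H.dir₁ q hq
  have d2 := H.dir₂ q hq
  unfold dir at d1 d2
  refine ⟨?_, ?_, ?_⟩
  · rw [d1, f.h11]
  · rw [d1, d2, f.h12]
  · rw [d2, f.h22]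

lemma tangentPart_eq (H : IsMovingFrame x U X₁ X₂ E₁ E₂ E₃ E₄) (hq : q ∈ U) (w : R51) :
    tangentPart x q w = mink w (E₁ q) • E₁ q + mink w (E₂ q) • E₂ q := by
  have := (H.isOrthonormalAt hq).tangentPart_eq w
  have d1 := H.dir₁ q hq
  have d2 := H.dir₂ q hq
  unfold dir at d1 d2
  rwa [d1, d2] at this

lemma normalPart_eq (H : IsMovingFrame x U X₁ X₂ E₁ E₂ E₃ E₄) (hq : q ∈ U) (w : R51) :
    normalPart x q w = mink w (E₃ q) • E₃ q + mink w (E₄ q) • E₄ q := by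
  rw [normalPart, H.tangentPart_eq hq, projH]
  nth_rewrite 1 [(H.isFrame q hq).expand w]
  module

lemma fderiv_eq (H : IsMovingFrame x U X₁ X₂ E₁ E₂ E₃ E₄) (hq : q ∈ U) (v : Plane) :
    fderiv ℝ x q v = mink (fderiv ℝ x q v) (E₁ q) • E₁ q + mink (fderiv ℝ x q v) (E₂ q) • E₂ q := by
  rw [← H.tangentPart_eq hq, tangentPart_fderiv (H.spacelike q hq)]

/-- Torsion-freeness: the bracket of `X₁` and `X₂` is carried by the differential of `x` to the
commutator of the derivatives, so this difference is tangent to the surface. -/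
lemma dir_sub_dir (H : IsMovingFrame x U X₁ X₂ E₁ E₂ E₃ E₄) (hq : q ∈ U) :
    dir X₁ E₂ q - dir X₂ E₁ q = fderiv ℝ x q (dir X₁ X₂ q - dir X₂ X₁ q) := by
  rw [← dir_comm (H.smooth_x.contDiffAt (H.isOpen.mem_nhds hq))
    (differentiableAt_of_contDiffOn H.isOpen H.smooth_X₁ hq)
    (differentiableAt_of_contDiffOn H.isOpen H.smooth_X₂ hq),
    dir_congr H.isOpen (V := dir X₂ x) H.dir₂ hq, dir_congr H.isOpen (V := dir X₁ x) H.dir₁ hq]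

/-- The coefficients of the derivatives in the frame are skew because the frame is orthonormal. The
hypotheses `h1`, `h2` remove the normal connection form. -/
lemma exists_structureEquations (H : IsMovingFrame x U X₁ X₂ E₁ E₂ E₃ E₄)
    (h1 : ∀ q ∈ U, mink (dir X₁ E₃ q) (E₄ q) = 0) (h2 : ∀ q ∈ U, mink (dir X₂ E₃ q) (E₄ q) = 0) :
    StructureEquations x U X₁ X₂ E₁ E₂ E₃ E₄
      (fun q => mink (dir X₁ E₁ q) (E₂ q)) (fun q => mink (dir X₂ E₂ q) (E₁ q))
      (fun q => mink (dir X₁ E₁ q) (E₃ q)) (fun q => mink (dir X₁ E₂ q) (E₃ q))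
      (fun q => mink (dir X₂ E₂ q) (E₃ q)) (fun q => mink (dir X₁ E₁ q) (E₄ q))
      (fun q => mink (dir X₁ E₂ q) (E₄ q)) (fun q => mink (dir X₂ E₂ q) (E₄ q)) := by
  have hU := H.isOpen
  have sD : ∀ {X : Plane → Plane} {E : Plane → R51}, ContDiffOn ℝ ∞ X U → ContDiffOn ℝ ∞ E U →
    ContDiffOn ℝ ∞ (dir X E) U := fun hX hE => contDiffOn_dir hU hX hE
  have sx := H.smooth_x
  have s1 := H.smooth_E₁
  have s2 := H.smooth_E₂
  have s3 := H.smooth_E₃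
  have s4 := H.smooth_E₄
  have z : ∀ (X : Plane → Plane) {V W : Plane → R51} (c : ℝ), ContDiffOn ℝ ∞ V U →
      ContDiffOn ℝ ∞ W U → (∀ q ∈ U, mink (V q) (W q) = c) → ∀ q ∈ U,
      mink (dir X V q) (W q) = -mink (dir X W q) (V q) :=
    fun X V W c hV hW h q hq => mink_dir_eq_neg hU hV hW h hq
  -- Symmetry of the second fundamental form: the two mixed derivatives differ by a tangent vector.
  have sym : ∀ q ∈ U, ∀ w, mink (E₁ q) w = 0 → mink (E₂ q) w = 0 →
      mink (dir X₂ E₁ q) w = mink (dir X₁ E₂ q) w := by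
    intro q hq w e1 e2
    have := congrArg (fun v => mink v w) (H.dir_sub_dir hq)
    simp only [mink_sub_left] at this
    rw [H.fderiv_eq hq, mink_add_left, mink_smul_left, mink_smul_left, e1, e2] at this
    linarith
  have fr := H.isFrame
  have key : ∀ X : Plane → Plane, ∀ q ∈ U,
      mink (dir X E₁ q) (E₁ q) = 0 ∧ mink (dir X E₂ q) (E₂ q) = 0 ∧ mink (dir X E₃ q) (E₃ q) = 0 ∧
      mink (dir X E₄ q) (E₄ q) = 0 ∧ mink (dir X E₁ q) (x q) = -mink (dir X x q) (E₁ q) ∧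
      mink (dir X E₂ q) (x q) = -mink (dir X x q) (E₂ q) ∧
      mink (dir X E₃ q) (x q) = -mink (dir X x q) (E₃ q) ∧
      mink (dir X E₄ q) (x q) = -mink (dir X x q) (E₄ q) ∧
      mink (dir X E₂ q) (E₁ q) = -mink (dir X E₁ q) (E₂ q) ∧
      mink (dir X E₃ q) (E₁ q) = -mink (dir X E₁ q) (E₃ q) ∧
      mink (dir X E₄ q) (E₁ q) = -mink (dir X E₁ q) (E₄ q) ∧
      mink (dir X E₃ q) (E₂ q) = -mink (dir X E₂ q) (E₃ q) ∧
      mink (dir X E₄ q) (E₂ q) = -mink (dir X E₂ q) (E₄ q) ∧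
      mink (dir X E₄ q) (E₃ q) = -mink (dir X E₃ q) (E₄ q) := by
    intro X q hq
    have z11 := z X 1 s1 s1 (fun q hq => (fr q hq).h11) q hq
    have z22 := z X 1 s2 s2 (fun q hq => (fr q hq).h22) q hq
    have z33 := z X 1 s3 s3 (fun q hq => (fr q hq).h33) q hq
    have z44 := z X 1 s4 s4 (fun q hq => (fr q hq).h44) q hq
    refine ⟨by linarith, by linarith, by linarith, by linarith,
      z X 0 s1 sx (fun q hq => by rw [mink_comm]; exact (fr q hq).h01) q hq,
      z X 0 s2 sx (fun q hq => by rw [mink_comm]; exact (fr q hq).h02) q hq,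
      z X 0 s3 sx (fun q hq => by rw [mink_comm]; exact (fr q hq).h03) q hq,
      z X 0 s4 sx (fun q hq => by rw [mink_comm]; exact (fr q hq).h04) q hq,
      z X 0 s2 s1 (fun q hq => by rw [mink_comm]; exact (fr q hq).h12) q hq,
      z X 0 s3 s1 (fun q hq => by rw [mink_comm]; exact (fr q hq).h13) q hq,
      z X 0 s4 s1 (fun q hq => by rw [mink_comm]; exact (fr q hq).h14) q hq,
      z X 0 s3 s2 (fun q hq => by rw [mink_comm]; exact (fr q hq).h23) q hq,
      z X 0 s4 s2 (fun q hq => by rw [mink_comm]; exact (fr q hq).h24) q hq,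
      z X 0 s4 s3 (fun q hq => by rw [mink_comm]; exact (fr q hq).h34) q hq⟩
  refine
    { toIsMovingFrame := H
      smooth_α := contDiffOn_mink (sD H.smooth_X₁ s1) s2
      smooth_β := contDiffOn_mink (sD H.smooth_X₂ s2) s1
      smooth_p := contDiffOn_mink (sD H.smooth_X₁ s1) s3
      smooth_h := contDiffOn_mink (sD H.smooth_X₁ s2) s3
      smooth_r := contDiffOn_mink (sD H.smooth_X₂ s2) s3
      smooth_k := contDiffOn_mink (sD H.smooth_X₁ s1) s4
      smooth_m := contDiffOn_mink (sD H.smooth_X₁ s2) s4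
      smooth_s := contDiffOn_mink (sD H.smooth_X₂ s2) s4
      d11 := ?_, d21 := ?_, d12 := ?_, d22 := ?_, d13 := ?_, d23 := ?_, d14 := ?_, d24 := ?_ }
  all_goals
    intro q hq
    have f := fr q hq
    have y3 := sym q hq (E₃ q) f.h13 f.h23
    have y4 := sym q hq (E₄ q) f.h14 f.h24
    obtain ⟨a1, a2, a3, a4, a5, a6, a7, a8, a9, a10, a11, a12, a13, a14⟩ := key X₁ q hq
    obtain ⟨b1, b2, b3, b4, b5, b6, b7, b8, b9, b10, b11, b12, b13, b14⟩ := key X₂ q hq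
    have u1 := h1 q hq
    have u2 := h2 q hq
    rw [H.dir₁ q hq] at a5 a6 a7 a8
    rw [H.dir₂ q hq] at b5 b6 b7 b8
    rw [f.h11] at a5
    rw [f.h12] at a6
    rw [f.h13] at a7
    rw [f.h14] at a8
    rw [mink_comm (E₂ q), f.h12] at b5
    rw [f.h22] at b6
    rw [f.h23] at b7
    rw [f.h24] at b8
  · refine (f.expand _).trans ?_
    rw [a5, a1]
    module
  · refine (f.expand _).trans ?_
    rw [b5, b1, y3, y4, b9]
    module
  · refine (f.expand _).trans ?_
    rw [a6, a2, a9]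
    module
  · refine (f.expand _).trans ?_
    rw [b6, b2]
    module
  · refine (f.expand _).trans ?_
    rw [a7, a3, a10, a12, u1]
    module
  · refine (f.expand _).trans ?_
    rw [b7, b3, b10, b12, u2, y3]
    module
  · refine (f.expand _).trans ?_
    rw [a8, a4, a11, a13, a14, u1]
    module
  · refine (f.expand _).trans ?_
    rw [b8, b4, b11, b13, b14, u2, y4]
    module

end IsMovingFrame

namespace StructureEquations

variable {F : Type*} [NormedAddCommGroup F] [NormedSpace ℝ F]

/-- The differential of `x` is injective, so the bracket may be read off from its image, given by
the structure equations for `E₁` and `E₂`. -/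
lemma dir_comm_vec (H : StructureEquations x U X₁ X₂ E₁ E₂ E₃ E₄ α β p h r k m s) (hq : q ∈ U) :
    dir X₁ X₂ q - dir X₂ X₁ q = -α q • X₁ q + β q • X₂ q := by
  apply (H.spacelike q hq).injective
  rw [← H.dir_sub_dir hq, H.d12 q hq, H.d21 q hq, map_add, map_smul, map_smul]
  have d1 := H.dir₁ q hq
  have d2 := H.dir₂ q hq
  unfold dir at d1 d2
  rw [d1, d2]
  module

lemma dir_comm (H : StructureEquations x U X₁ X₂ E₁ E₂ E₃ E₄ α β p h r k m s) {V : Plane → F}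
    (hV : ContDiffOn ℝ ∞ V U) (hq : q ∈ U) :
    dir X₁ (dir X₂ V) q - dir X₂ (dir X₁ V) q = -α q • dir X₁ V q + β q • dir X₂ V q := by
  rw [BiconservativeH4.dir_comm (hV.contDiffAt (H.isOpen.mem_nhds hq))
    (differentiableAt_of_contDiffOn H.isOpen H.smooth_X₁ hq)
    (differentiableAt_of_contDiffOn H.isOpen H.smooth_X₂ hq), H.dir_comm_vec hq]
  simp [dir]

/-- The Codazzi equations for `E₃`, and the Ricci equation. -/
lemma codazzi₃ (H : StructureEquations x U X₁ X₂ E₁ E₂ E₃ E₄ α β p h r k m s) (hq : q ∈ U) :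
    dir X₂ p q - dir X₁ h q + α q * (r q - p q) + 2 * β q * h q = 0 ∧
    dir X₂ h q - dir X₁ r q - 2 * α q * h q + β q * (r q - p q) = 0 ∧
    h q * (s q - k q) + m q * (p q - r q) = 0 := by
  -- Integrability of the system for `E₃`: once the commutator is expanded in the frame, the `E₁`
  -- and `E₂` coefficients are the Codazzi equations and the `E₄` coefficient is the Ricci equation.
  have hc := H.dir_comm H.smooth_E₃ hq
  rw [dir_of_eqOn_comb₂ H.isOpen H.smooth_E₁ H.smooth_E₂ H.smooth_h.neg H.smooth_r.neg H.d23 hq,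
    dir_of_eqOn_comb₂ H.isOpen H.smooth_E₁ H.smooth_E₂ H.smooth_p.neg H.smooth_h.neg H.d13 hq,
    H.d13 q hq, H.d23 q hq, H.d11 q hq, H.d12 q hq, H.d21 q hq, H.d22 q hq] at hc
  simp only [dir_neg] at hc
  rw [← sub_eq_zero] at hc
  have := (H.isFrame q hq).coeff_eq_zero
    (c₀ := 0) (c₁ := dir X₂ p q - dir X₁ h q + α q * (r q - p q) + 2 * β q * h q)
    (c₂ := dir X₂ h q - dir X₁ r q - 2 * α q * h q + β q * (r q - p q))
    (c₃ := 0) (c₄ := h q * (s q - k q) + m q * (p q - r q))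
    (by rw [← hc]; module)
  exact ⟨this.2.1, this.2.2.1, this.2.2.2.2⟩

end StructureEquations

end Frame

/-! ### The curvature tensor of `ℍ⁴` -/

section Curvature

lemma hasFDerivAt_mink {V W : R51 → R51} {V' W' : R51 →L[ℝ] R51} {z : R51}
    (hV : HasFDerivAt V V' z) (hW : HasFDerivAt W W' z) (h : R51) :
    DifferentiableAt ℝ (fun y => mink (V y) (W y)) z ∧
    fderiv ℝ (fun y => mink (V y) (W y)) z h = mink (V' h) (W z) + mink (V z) (W' h) := by
  have := minkB.hasFDerivAt_of_bilinear hV hW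
  simp only [minkB_apply] at this
  refine ⟨this.differentiableAt, ?_⟩
  rw [this.fderiv]
  simp [ContinuousLinearMap.precompR, ContinuousLinearMap.precompL, minkB_apply, add_comm]

lemma fderiv_projH {V : R51 → R51} {z : R51} (hV : DifferentiableAt ℝ V z) (h : R51) :
    DifferentiableAt ℝ (fun y => projH y (V y)) z ∧
    fderiv ℝ (fun y => projH y (V y)) z h = fderiv ℝ V z h +
      ((mink (fderiv ℝ V z h) z + mink (V z) h) • z + mink (V z) z • h) := by
  obtain ⟨d, e⟩ := hasFDerivAt_mink hV.hasFDerivAt (hasFDerivAt_id z) h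
  simp only [id] at d e
  refine ⟨hV.add (d.smul differentiableAt_id), ?_⟩
  unfold projH
  rw [fderiv_fun_add hV (d.fun_smul differentiableAt_fun_id), fderiv_fun_smul d differentiableAt_fun_id]
  simp [e, add_comm]

lemma fderiv_extendH (w z h : R51) :
    DifferentiableAt ℝ (extendH w) z ∧
    fderiv ℝ (extendH w) z h = mink w h • z + mink w z • h := by
  obtain ⟨d, e⟩ := fderiv_projH (differentiableAt_const (c := w) (x := z)) h
  refine ⟨d, ?_⟩
  unfold extendH
  rw [e]
  simp [mink_zero_left]

lemma connH_extendH (b d z : R51) :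
    connH (extendH b) (extendH d) z =
      projH z (mink d (extendH b z) • z + mink d z • extendH b z) := by
  unfold connH
  rw [(fderiv_extendH d z _).2]

lemma connH_connH {y a b d : R51} (hy : y ∈ H4) (ha : mink a y = 0) (hb : mink b y = 0)
    (hd : mink d y = 0) :
    connH (extendH a) (connH (extendH b) (extendH d)) y = mink d a • b := by
  have hya : extendH a y = a := by simp [extendH, projH, ha]
  have hyb : extendH b y = b := by simp [extendH, projH, hb]
  have hy1 : mink y y = -1 := hy.1
  obtain ⟨db, eb⟩ := fderiv_extendH b y a
  obtain ⟨d1, e1⟩ := hasFDerivAt_mink (hasFDerivAt_const d y) db.hasFDerivAt a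
  obtain ⟨d2, e2⟩ := hasFDerivAt_mink (hasFDerivAt_const d y) (hasFDerivAt_id y) a
  simp only [id] at d2 e2
  have hfun : connH (extendH b) (extendH d) = fun z =>
      projH z (mink d (extendH b z) • z + mink d z • extendH b z) := by
    ext1 z; exact connH_extendH b d z
  have dV : DifferentiableAt ℝ (fun z => mink d (extendH b z) • z + mink d z • extendH b z) y :=
    (d1.fun_smul differentiableAt_fun_id).fun_add (d2.fun_smul db)
  have eV : fderiv ℝ (fun z => mink d (extendH b z) • z + mink d z • extendH b z) y a =
      mink d b • a + mink d a • b := by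
    rw [fderiv_fun_add (d1.fun_smul differentiableAt_fun_id) (d2.fun_smul db),
      fderiv_fun_smul d1 differentiableAt_fun_id, fderiv_fun_smul d2 db]
    simp only [add_apply, smul_apply, ContinuousLinearMap.smulRight_apply, e1, e2, eb, hyb, hb, hd,
      fderiv_fun_id, ContinuousLinearMap.id_apply, zero_apply, mink_zero_left, mink_add_right,
      mink_smul_right]
    module
  have hya' : mink y a = 0 := by rw [mink_comm, ha]
  rw [hfun]
  unfold connH
  rw [hya, (fderiv_projH dV a).2, eV]
  simp only [projH, mink_add_left, mink_smul_left, ha, hb, hd, hyb, hy1, hya']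
  module

/-- Constant curvature `-1`. The extensions by projection have vanishing bracket at `y`, because
each derivative there is a multiple of `y` with the same coefficient `⟨a, b⟩`; only the two iterated
derivatives contribute. -/
lemma curvH_eq {y a b d : R51} (hy : y ∈ H4) (ha : mink a y = 0) (hb : mink b y = 0)
    (hd : mink d y = 0) : curvH y a b d = mink d a • b - mink d b • a := by
  have hya : extendH a y = a := by simp [extendH, projH, ha]
  have hyb : extendH b y = b := by simp [extendH, projH, hb]
  have hl : VectorField.lieBracket ℝ (extendH a) (extendH b) y = 0 := by
    unfold VectorField.lieBracket
    rw [(fderiv_extendH b y _).2, (fderiv_extendH a y _).2, hya, hyb, ha, hb, mink_comm a b]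
    module
  unfold curvH
  rw [connH_connH hy ha hb hd, connH_connH hy hb ha hd]
  unfold connH
  rw [hl, map_zero]
  simp [projH, mink_zero_left]

end Curvature

/-! ### The rough Laplacian in a moving frame -/

section Laplacian

variable {x : Plane → R51} {q : Plane} {F : Type*} [NormedAddCommGroup F] [NormedSpace ℝ F]

lemma tangentPart_add (v w : R51) :
    tangentPart x q (v + w) = tangentPart x q v + tangentPart x q w := by
  simp only [tangentPart, mink_add_left, mul_add, add_smul, Finset.sum_add_distrib]

lemma tangentPart_smul (r : ℝ) (w : R51) :
    tangentPart x q (r • w) = r • tangentPart x q w := by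
  simp only [tangentPart, mink_smul_left, Finset.smul_sum, smul_smul]
  refine Finset.sum_congr rfl fun i _ => Finset.sum_congr rfl fun j _ => ?_
  congr 1; ring

lemma pd_eq_dir (V : Plane → F) (i : Fin 2) :
    pd V i = dir (fun _ => EuclideanSpace.single i 1) V := rfl

lemma pd_metric (hx : ContDiffAt ℝ ∞ x q) (i j l : Fin 2) :
    pd (fun r => metric x r j l) i q =
      mink (pd (pd x j) i q) (pd x l q) + mink (pd x j q) (pd (pd x l) i q) := by
  have hd : ∀ j, DifferentiableAt ℝ (pd x j) q := fun j =>
    (differentiableAt_fderiv hx).clm_apply (differentiableAt_const _)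
  simp only [pd_eq_dir _ i, metric, Matrix.of_apply]
  rw [dir_mink (hd j) (hd l)]

lemma pd_pd_comm (hx : ContDiffAt ℝ ∞ x q) (i j : Fin 2) :
    pd (pd x j) i q = pd (pd x i) j q := by
  rw [pd_pd hx, pd_pd hx]
  exact (hx.isSymmSndFDerivAt
    (by simp only [minSmoothness_of_isRCLikeNormedField]; exact ENat.LEInfty.out)).eq _ _

/-- Expanding the derivatives of the metric leaves only `⟨∂ᵢ∂ⱼx, ∂ₗx⟩`, so the Christoffel symbols
are the coordinates of the tangential part of `∂ᵢ∂ⱼx`. -/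
lemma sum_christoffel_smul (hx : ContDiffAt ℝ ∞ x q) (hs : IsSpacelikeAt x q) (i j : Fin 2) :
    ∑ k, christoffel x k i j q • pd x k q = tangentPart x q (pd (pd x j) i q) := by
  obtain ⟨X₁, X₂, hX⟩ := hs.exists_isOrthonormalAt
  have hg : ∀ k, christoffel x k i j q =
      ∑ l, (metric x q)⁻¹ k l * mink (pd (pd x j) i q) (pd x l q) := by
    intro k
    unfold christoffel
    rw [Finset.mul_sum]
    refine Finset.sum_congr rfl fun l _ => ?_
    rw [pd_metric hx, pd_metric hx, pd_metric hx, pd_pd_comm hx l j, pd_pd_comm hx l i,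
      pd_pd_comm hx j i, mink_comm (pd x i q)]
    rw [mink_comm (pd x j q)]
    ring
  unfold tangentPart
  simp only [hg, Fin.sum_univ_two, hX.metric_inv]
  module

/-- The vector `∇_X X` of the Levi-Civita connection of the induced metric. -/
def covDerivSelf (x : Plane → R51) (X : Plane → Plane) (q : Plane) : Plane :=
  dir X X q + ∑ k, (∑ i, ∑ j, (X q i * X q j) * christoffel x k i j q) •
    EuclideanSpace.single k (1 : ℝ)

/-- The intrinsic derivative `∇_X X` is the tangential projection of the flat one, which identifies
it in a moving frame without computing Christoffel symbols. -/
lemma fderiv_covDerivSelf (hx : ContDiffAt ℝ ∞ x q) (hs : IsSpacelikeAt x q)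
    {X : Plane → Plane} (hX : DifferentiableAt ℝ X q) :
    fderiv ℝ x q (covDerivSelf x X q) = tangentPart x q (dir X (dir X x) q) := by
  have h1 : fderiv ℝ x q (covDerivSelf x X q) = fderiv ℝ x q (dir X X q) +
      ∑ i, ∑ j, (X q i * X q j) • ∑ k, christoffel x k i j q • pd x k q := by
    unfold covDerivSelf
    simp only [map_add, map_smul, Fin.sum_univ_two, pd]
    module
  rw [h1, dir_dir hx hX, tangentPart_add, tangentPart_fderiv hs, ← sum_smul_pd_pd hx]
  simp only [sum_christoffel_smul hx hs, Fin.sum_univ_two, tangentPart_add, tangentPart_smul]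
  abel

/-- The frame form `XXV - (∇_X X)V` of the Hessian: the derivative of the coefficients of `X`
cancels between the two terms. -/
lemma sum_hessian {V : Plane → F} (hV : ContDiffAt ℝ ∞ V q)
    {X : Plane → Plane} (hX : DifferentiableAt ℝ X q) :
    ∑ i, ∑ j, (X q i * X q j) • (pd (pd V j) i q - ∑ k, christoffel x k i j q • pd V k q) =
      dir X (dir X V) q - fderiv ℝ V q (covDerivSelf x X q) := by
  rw [dir_dir hV hX, ← sum_smul_pd_pd hV]
  unfold covDerivSelf
  simp only [map_add, map_smul, Fin.sum_univ_two, pd]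
  module

variable {U : Set Plane} {X₁ X₂ : Plane → Plane} {E₁ E₂ E₃ E₄ : Plane → R51}

/-- For a field `V` normal to the surface, `⟨dV, x⟩ = -⟨V, dx⟩ = 0`, so the first covariant
derivative is the flat one. The projection in the second is a multiple of `x` and is invisible to
`w`. The vectors `Z₁`, `Z₂` stand for `∇_{X₁}X₁`, `∇_{X₂}X₂`. -/
lemma IsMovingFrame.mink_roughLaplacian (H : IsMovingFrame x U X₁ X₂ E₁ E₂ E₃ E₄)
    {V : Plane → R51} (hV : ContDiffOn ℝ ∞ V U) (h0 : ∀ r ∈ U, mink (V r) (x r) = 0)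
    (h1 : ∀ r ∈ U, ∀ v, mink (fderiv ℝ x r v) (V r) = 0) (hq : q ∈ U) {w : R51}
    (hw : mink w (x q) = 0) {Z₁ Z₂ : Plane}
    (hZ₁ : fderiv ℝ x q Z₁ = tangentPart x q (dir X₁ E₁ q))
    (hZ₂ : fderiv ℝ x q Z₂ = tangentPart x q (dir X₂ E₂ q)) :
    mink (roughLaplacian x V q) w =
      -(mink (dir X₁ (dir X₁ V) q) w + mink (dir X₂ (dir X₂ V) q) w
        - mink (fderiv ℝ V q Z₁) w - mink (fderiv ℝ V q Z₂) w) := by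
  have hU := H.isOpen
  have hxq := H.smooth_x.contDiffAt (hU.mem_nhds hq)
  have hVq := hV.contDiffAt (hU.mem_nhds hq)
  have d1 := differentiableAt_of_contDiffOn hU H.smooth_X₁ hq
  have d2 := differentiableAt_of_contDiffOn hU H.smooth_X₂ hq
  have hp : ∀ j, ∀ r ∈ U, pullbackConn x V j r = pd V j r := by
    intro j r hr
    have := mink_dir_eq_neg (X := fun _ => EuclideanSpace.single j 1) hU hV H.smooth_x h0 hr
    unfold dir at this
    rw [h1 r hr] at this
    simp [pullbackConn, projH, pd, this]
  have e1 : covDerivSelf x X₁ q = Z₁ := by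
    apply (H.spacelike q hq).injective
    rw [fderiv_covDerivSelf hxq (H.spacelike q hq) d1, hZ₁, dir_congr hU H.dir₁ hq]
  have e2 : covDerivSelf x X₂ q = Z₂ := by
    apply (H.spacelike q hq).injective
    rw [fderiv_covDerivSelf hxq (H.spacelike q hq) d2, hZ₂, dir_congr hU H.dir₂ hq]
  have hpp : ∀ i j, mink (pullbackConn x (pullbackConn x V j) i q) w = mink (pd (pd V j) i q) w := by
    intro i j
    have : pd (pullbackConn x V j) i q = pd (pd V j) i q :=
      dir_congr (X := fun _ => EuclideanSpace.single i 1) hU (hp j) hq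
    simp [pullbackConn, projH] at this ⊢
    rw [this, mink_add_left, mink_smul_left, mink_comm (x q), hw]
    ring
  have s1 := congrArg (fun v => mink v w) (sum_hessian (x := x) hVq d1)
  have s2 := congrArg (fun v => mink v w) (sum_hessian (x := x) hVq d2)
  simp only [e1, e2, mink_sub_left, mink_sum_left, mink_smul_left] at s1 s2
  unfold roughLaplacian
  rw [(H.isOrthonormalAt hq).trace_eq, mink_neg_left, mink_add_left]
  simp only [mink_sub_left, mink_sum_left, mink_smul_left, hpp, hp _ q hq]
  rw [s1, s2]
  ring

end Laplacian

/-! ### Biconservative surfaces with parallel normalized mean curvature vector field -/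

section Bicons

variable {x : Plane → R51} {q : Plane} {U : Set Plane} {X₁ X₂ : Plane → Plane}
  {E₁ E₂ E₃ E₄ : Plane → R51} {α β p h r k m s : Plane → ℝ}

lemma StructureEquations.meanCurvVec_eq
    (H : StructureEquations x U X₁ X₂ E₁ E₂ E₃ E₄ α β p h r k m s) (hq : q ∈ U)
    (hH : ∀ q ∈ U, x q ∈ H4) :
    meanCurvVec x q = ((p q + r q) / 2) • E₃ q + ((k q + s q) / 2) • E₄ q := by
  have hU := H.isOpen
  have hxq := H.smooth_x.contDiffAt (hU.mem_nhds hq)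
  have f := H.isFrame q hq
  have hn : ∀ {X : Plane → Plane} {E : Plane → R51}, ContDiffOn ℝ ∞ X U → (∀ r ∈ U, dir X x r = E r) →
      normalPart x q (fderiv ℝ (fderiv ℝ x) q (X q) (X q)) = normalPart x q (dir X E q) := by
    intro X E hX hE
    rw [← dir_congr hU hE hq, dir_dir hxq (differentiableAt_of_contDiffOn hU hX hq),
      normalPart_add, normalPart_fderiv (H.spacelike q hq)
        (fun v => mink_fderiv_self hU H.smooth_x hH hq v), add_zero]
  rw [(H.isOrthonormalAt hq).meanCurvVec_eq hxq, hn H.smooth_X₁ H.dir₁, hn H.smooth_X₂ H.dir₂,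
    H.normalPart_eq hq, H.normalPart_eq hq, H.d11 q hq, H.d22 q hq]
  simp only [mink_add_left, mink_smul_left, f.h03, f.h04, f.h13, f.h14, f.h23, f.h24, f.h33, f.h34,
    f.h44, mink_comm (E₄ q) (E₃ q)]
  module

/-- The tangential bitension contains derivatives of `p`, `h`, `r` and of `f`. The trace identity `p
+ r = 2f` and the Codazzi equations eliminate the former, leaving `E₁f · (p + f) = 0` and `E₁f · h =
0`. -/
lemma StructureEquations.principal_curvatures
    (H : StructureEquations x U X₁ X₂ E₁ E₂ E₃ E₄ α β p h r k m s) (hq : q ∈ U)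
    (hH : ∀ q ∈ U, x q ∈ H4) {f : Plane → ℝ} (hf : ContDiffOn ℝ ∞ f U)
    (hfE : ∀ q ∈ U, meanCurvVec x q = f q • E₃ q)
    (hf1 : dir X₁ f q ≠ 0) (hf2 : ∀ q ∈ U, dir X₂ f q = 0)
    (hb : tangentPart x q (bitension x q) = 0) :
    p q = -f q ∧ h q = 0 ∧ r q = 3 * f q := by
  have hU := H.isOpen
  have fr := H.isFrame
  have frq := fr q hq
  have hpr : ∀ q ∈ U, p q + r q = 2 * f q := by
    intro q hq
    have h1 := hfE q hq
    rw [H.meanCurvVec_eq hq hH] at h1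
    have := congrArg (fun v => mink v (E₃ q)) h1
    simp only [mink_add_left, mink_smul_left, (fr q hq).h33, mink_comm (E₄ q) (E₃ q),
      (fr q hq).h34] at this
    linarith
  have dpr : ∀ X : Plane → Plane, dir X p q + dir X r q = 2 * dir X f q := by
    intro X
    have h1 := dir_congr (X := X) hU (V := fun q => p q + r q) (W := fun q => 2 * f q) hpr hq
    rw [dir_add (differentiableAt_of_contDiffOn hU H.smooth_p hq)
      (differentiableAt_of_contDiffOn hU H.smooth_r hq),
      dir_mul (differentiableAt_const _) (differentiableAt_of_contDiffOn hU hf hq), dir_const] at h1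
    linarith
  -- the tension field and its derivatives
  have hV : ∀ q ∈ U, tension x q = (2 * f q) • E₃ q := by
    intro q hq; rw [tension, hfE q hq, smul_smul]
  have sV' : ContDiffOn ℝ ∞ (fun q => (2 * f q) • E₃ q) U :=
    (contDiffOn_const.mul hf).smul H.smooth_E₃
  have sV : ContDiffOn ℝ ∞ (tension x) U := sV'.congr hV
  have s2f : ContDiffOn ℝ ∞ (fun q => 2 * f q) U := contDiffOn_const.mul hf
  have d2f : ∀ X : Plane → Plane, ∀ q ∈ U, dir X (fun q => 2 * f q) q = 2 * dir X f q := by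
    intro X q hq
    rw [dir_mul (differentiableAt_const _) (differentiableAt_of_contDiffOn hU hf hq), dir_const]
    ring
  have dV : ∀ X : Plane → Plane, ∀ q ∈ U,
      dir X (tension x) q = (2 * dir X f q) • E₃ q + (2 * f q) • dir X E₃ q := by
    intro X q hq
    rw [dir_congr hU hV hq, dir_smul (differentiableAt_of_contDiffOn hU s2f hq)
      (differentiableAt_of_contDiffOn hU H.smooth_E₃ hq), d2f X q hq]
  have sw : ContDiffOn ℝ ∞ (fun q => 2 * dir X₁ f q) U :=
    contDiffOn_const.mul (contDiffOn_dir hU H.smooth_X₁ hf)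
  have sc : ∀ {g : Plane → ℝ}, ContDiffOn ℝ ∞ g U → ContDiffOn ℝ ∞ (fun q => -(2 * f q * g q)) U :=
    fun hg => (s2f.mul hg).neg
  have dc : ∀ (X : Plane → Plane) {g : Plane → ℝ}, ContDiffOn ℝ ∞ g U →
      dir X (fun q => -(2 * f q * g q)) q = -(2 * dir X f q * g q + 2 * f q * dir X g q) := by
    intro X g hg
    rw [dir_neg, dir_mul (differentiableAt_of_contDiffOn hU s2f hq)
      (differentiableAt_of_contDiffOn hU hg hq), d2f X q hq]
  have dV1 : ∀ q ∈ U, dir X₁ (tension x) q = (2 * dir X₁ f q) • E₃ q +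
      ((-(2 * f q * p q)) • E₁ q + (-(2 * f q * h q)) • E₂ q) := by
    intro q hq
    rw [dV X₁ q hq, H.d13 q hq]
    module
  have dV2 : ∀ q ∈ U, dir X₂ (tension x) q =
      (-(2 * f q * h q)) • E₁ q + (-(2 * f q * r q)) • E₂ q := by
    intro q hq
    rw [dV X₂ q hq, H.d23 q hq, hf2 q hq]
    module
  have dV11 := dir_of_eqOn_add_comb₂ (X := X₁) hU H.smooth_E₁ H.smooth_E₂ (sw.smul H.smooth_E₃)
    (sc H.smooth_p) (sc H.smooth_h) dV1 hq
  have dV22 := dir_of_eqOn_comb₂ (X := X₂) hU H.smooth_E₁ H.smooth_E₂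
    (sc H.smooth_h) (sc H.smooth_r) dV2 hq
  rw [show ((fun q => 2 * dir X₁ f q) • E₃) = fun q => (2 * dir X₁ f q) • E₃ q from rfl,
    dir_smul (differentiableAt_of_contDiffOn hU sw hq)
    (differentiableAt_of_contDiffOn hU H.smooth_E₃ hq), dc X₁ H.smooth_p, dc X₁ H.smooth_h,
    H.d13 q hq, H.d11 q hq, H.d12 q hq] at dV11
  rw [dc X₂ H.smooth_h, dc X₂ H.smooth_r, hf2 q hq, H.d21 q hq, H.d22 q hq] at dV22
  have hVx : ∀ r ∈ U, mink (tension x r) (x r) = 0 := by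
    intro r hr
    rw [hV r hr, mink_smul_left, mink_comm, (fr r hr).h03, mul_zero]
  have hVd : ∀ r ∈ U, ∀ v, mink (fderiv ℝ x r v) (tension x r) = 0 := by
    intro r hr v
    rw [H.toIsMovingFrame.fderiv_eq hr, hV r hr, mink_smul_right, mink_add_left, mink_smul_left,
      mink_smul_left, (fr r hr).h13, (fr r hr).h23]
    ring
  have dx1 := H.dir₁ q hq
  have dx2 := H.dir₂ q hq
  unfold dir at dx1 dx2
  have hZ1 : fderiv ℝ x q (α q • X₂ q) = tangentPart x q (dir X₁ E₁ q) := by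
    rw [H.toIsMovingFrame.tangentPart_eq hq, H.d11 q hq, map_smul, dx2]
    simp only [mink_add_left, mink_smul_left, frq.h01, frq.h02, frq.h12, frq.h22,
      mink_comm (E₃ q) (E₁ q), mink_comm (E₄ q) (E₁ q), mink_comm (E₃ q) (E₂ q),
      mink_comm (E₄ q) (E₂ q), mink_comm (E₂ q) (E₁ q), frq.h13, frq.h14, frq.h23, frq.h24]
    module
  have hZ2 : fderiv ℝ x q (β q • X₁ q) = tangentPart x q (dir X₂ E₂ q) := by
    rw [H.toIsMovingFrame.tangentPart_eq hq, H.d22 q hq, map_smul, dx1]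
    simp only [mink_add_left, mink_smul_left, frq.h01, frq.h02, frq.h12, frq.h11,
      mink_comm (E₃ q) (E₁ q), mink_comm (E₄ q) (E₁ q), mink_comm (E₃ q) (E₂ q),
      mink_comm (E₄ q) (E₂ q), frq.h13, frq.h14, frq.h23, frq.h24]
    module
  have hFZ1 : fderiv ℝ (tension x) q (α q • X₂ q) = α q • dir X₂ (tension x) q := map_smul _ _ _
  have hFZ2 : fderiv ℝ (tension x) q (β q • X₁ q) = β q • dir X₁ (tension x) q := map_smul _ _ _
  -- The curvature term is a combination of `⟨∂ⱼ, ∂ᵢ⟩τ` and `⟨∂ⱼ, τ⟩∂ᵢ`. The second vanishes and the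
  -- first is normal, so neither is seen by a tangent `w`.
  have hR : ∀ w, mink w (x q) = 0 → mink (E₃ q) w = 0 →
      mink (bitension x q) w = -mink (roughLaplacian x (tension x) q) w := by
    intro w hw hw3
    have hpx : ∀ i, mink (pd x i q) (x q) = 0 := fun i => mink_fderiv_self hU H.smooth_x hH hq _
    have hc : ∀ i j, mink (curvH (x q) (pd x i q) (tension x q) (pd x j q)) w = 0 := by
      intro i j
      rw [curvH_eq (hH q hq) (hpx i) (hVx q hq) (hpx j), mink_sub_left, mink_smul_left,
        mink_smul_left, show mink (pd x j q) (tension x q) = 0 from hVd q hq _, hV q hq,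
        mink_smul_left, hw3]
      ring
    rw [bitension, mink_sub_left, mink_neg_left]
    simp only [mink_sum_left, mink_smul_left, hc, mul_zero, Finset.sum_const_zero, sub_zero]
  rw [H.toIsMovingFrame.tangentPart_eq hq] at hb
  obtain ⟨-, b1, b2, -, -⟩ := frq.coeff_eq_zero (c₀ := 0) (c₁ := mink (bitension x q) (E₁ q))
    (c₂ := mink (bitension x q) (E₂ q)) (c₃ := 0) (c₄ := 0) (by rw [← hb]; module)
  have h31 : mink (E₃ q) (E₁ q) = 0 := by rw [mink_comm, frq.h13]
  have h32 : mink (E₃ q) (E₂ q) = 0 := by rw [mink_comm, frq.h23]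
  have h10 : mink (E₁ q) (x q) = 0 := by rw [mink_comm, frq.h01]
  have h20 : mink (E₂ q) (x q) = 0 := by rw [mink_comm, frq.h02]
  have h21 : mink (E₂ q) (E₁ q) = 0 := by rw [mink_comm, frq.h12]
  have h41 : mink (E₄ q) (E₁ q) = 0 := by rw [mink_comm, frq.h14]
  have h42 : mink (E₄ q) (E₂ q) = 0 := by rw [mink_comm, frq.h24]
  rw [hR _ h10 h31, H.toIsMovingFrame.mink_roughLaplacian sV hVx hVd hq h10 hZ1 hZ2, hFZ1, hFZ2,
    dV11, dV22, dV1 q hq, dV2 q hq] at b1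
  rw [hR _ h20 h32, H.toIsMovingFrame.mink_roughLaplacian sV hVx hVd hq h20 hZ1 hZ2, hFZ1, hFZ2,
    dV11, dV22, dV1 q hq, dV2 q hq] at b2
  simp only [mink_add_left, mink_smul_left, h31, h32, h21, h41, h42, frq.h01, frq.h02, frq.h11,
    frq.h12, frq.h22] at b1 b2
  obtain ⟨c1, c2, -⟩ := H.codazzi₃ hq
  have t1 := dpr X₁
  have t2 := dpr X₂
  rw [hf2 q hq] at t2
  have hs := hpr q hq
  have hp : dir X₁ f q * (p q + f q) = 0 := by
    linear_combination (-1 / 4) * b1 - f q * c2 / 2 - f q * t1 / 2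
  have hh : dir X₁ f q * h q = 0 := by
    linear_combination (-1 / 4) * b2 + f q * c1 / 2 - f q * t2 / 2
  have hp' := (mul_eq_zero.1 hp).resolve_left hf1
  refine ⟨by linarith, (mul_eq_zero.1 hh).resolve_left hf1, by linarith⟩

end Bicons

/-! ### The frame of a biconservative surface -/

/-- The structure equations of a PNMC biconservative surface, in the frame given by
`E₁ = grad f / |grad f|` and `E₃ = H / |H|`. -/
structure IsBiconsFrame (x : Plane → R51) (U : Set Plane) (X₁ X₂ : Plane → Plane)
    (E₁ E₂ E₃ E₄ : Plane → R51) (f k β : Plane → ℝ) : Prop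
    extends IsMovingFrame x U X₁ X₂ E₁ E₂ E₃ E₄ where
  smooth_f : ContDiffOn ℝ ∞ f U
  smooth_k : ContDiffOn ℝ ∞ k U
  smooth_β : ContDiffOn ℝ ∞ β U
  f_pos : ∀ q ∈ U, 0 < f q
  β_pos : ∀ q ∈ U, 0 < β q
  d11 : ∀ q ∈ U, dir X₁ E₁ q = x q + ((-f q) • E₃ q + k q • E₄ q)
  d21 : ∀ q ∈ U, dir X₂ E₁ q = (-β q) • E₂ q
  d12 : ∀ q ∈ U, dir X₁ E₂ q = 0
  d22 : ∀ q ∈ U, dir X₂ E₂ q = x q + β q • E₁ q + (3 * f q) • E₃ q - k q • E₄ q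
  d13 : ∀ q ∈ U, dir X₁ E₃ q = f q • E₁ q
  d23 : ∀ q ∈ U, dir X₂ E₃ q = (-(3 * f q)) • E₂ q
  d14 : ∀ q ∈ U, dir X₁ E₄ q = (-k q) • E₁ q
  d24 : ∀ q ∈ U, dir X₂ E₄ q = k q • E₂ q
  f1 : ∀ q ∈ U, dir X₁ f q = 4 / 3 * f q * β q
  f2 : ∀ q ∈ U, dir X₂ f q = 0
  k1 : ∀ q ∈ U, dir X₁ k q = 2 * β q * k q
  k2 : ∀ q ∈ U, dir X₂ k q = 0
  β1 : ∀ q ∈ U, dir X₁ β q = β q ^ 2 - 1 - 3 * f q ^ 2 - k q ^ 2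
  β2 : ∀ q ∈ U, dir X₂ β q = 0

section Reduction

variable {x : Plane → R51} {q : Plane} {U : Set Plane} {X₁ X₂ : Plane → Plane}
  {E₁ E₂ E₃ E₄ : Plane → R51} {α β p h r k m s : Plane → ℝ}

lemma dir_eq_zero_of_eqOn {F : Type*} [NormedAddCommGroup F] [NormedSpace ℝ F]
    {X : Plane → Plane} {V : Plane → F} (hU : IsOpen U) (hV : ∀ q ∈ U, V q = 0) (hq : q ∈ U) :
    dir X V q = 0 := by
  rw [dir_congr hU (W := fun _ => (0 : F)) hV hq, dir_const]

/-- With the shape operator of `E₃` known, the Codazzi equations give `4αf = 0` and `E₁f = (4/3)fβ`,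
and the Ricci equation gives `mf = 0`. Minimality in the direction `E₄` gives `s = -k`. The other
equations are integrability conditions, obtained by applying the commutator to `E₄`, `E₁` and `f`.
-/
lemma StructureEquations.isBiconsFrame
    (H : StructureEquations x U X₁ X₂ E₁ E₂ E₃ E₄ α β p h r k m s)
    (hH : ∀ q ∈ U, x q ∈ H4) {f : Plane → ℝ} (hf : ContDiffOn ℝ ∞ f U)
    (hf0 : ∀ q ∈ U, 0 < f q)
    (hfE : ∀ q ∈ U, meanCurvVec x q = f q • E₃ q)
    (hf1 : ∀ q ∈ U, 0 < dir X₁ f q) (hf2 : ∀ q ∈ U, dir X₂ f q = 0)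
    (hb : ∀ q ∈ U, tangentPart x q (bitension x q) = 0) :
    IsBiconsFrame x U X₁ X₂ E₁ E₂ E₃ E₄ f k β := by
  have hU := H.isOpen
  have hpr := fun q hq => H.principal_curvatures (q := q) hq hH hf hfE (hf1 q hq).ne' hf2 (hb q hq)
  have hdf := fun q (hq : q ∈ U) => differentiableAt_of_contDiffOn hU hf hq
  have hs : ∀ q ∈ U, s q = -k q := by
    intro q hq
    have h1 := hfE q hq
    rw [H.meanCurvVec_eq hq hH] at h1
    have := congrArg (fun v => mink v (E₄ q)) h1
    simp only [mink_add_left, mink_smul_left, (H.isFrame q hq).h44, (H.isFrame q hq).h34] at this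
    linarith
  have dp : ∀ (X : Plane → Plane), ∀ q ∈ U, dir X p q = - dir X f q := by
    intro X q hq
    rw [dir_congr hU (W := fun q => - f q) (fun r hr => (hpr r hr).1) hq, dir_neg]
  have dr : ∀ (X : Plane → Plane), ∀ q ∈ U, dir X r q = 3 * dir X f q := by
    intro X q hq
    rw [dir_congr hU (W := fun q => 3 * f q) (fun r hr => (hpr r hr).2.2) hq,
      dir_mul (differentiableAt_const _) (hdf q hq), dir_const]
    ring
  have dh : ∀ (X : Plane → Plane), ∀ q ∈ U, dir X h q = 0 := fun X q hq =>
    dir_eq_zero_of_eqOn hU (fun r hr => (hpr r hr).2.1) hq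
  have hα : ∀ q ∈ U, α q = 0 := by
    intro q hq
    have c := (H.codazzi₃ hq).1
    obtain ⟨e1, e2, e3⟩ := hpr q hq
    rw [dp X₂ q hq, hf2 q hq, dh X₁ q hq, e1, e2, e3] at c
    have : α q * f q = 0 := by linarith
    exact (mul_eq_zero.1 this).resolve_right (hf0 q hq).ne'
  have hm : ∀ q ∈ U, m q = 0 := by
    intro q hq
    have c := (H.codazzi₃ hq).2.2
    obtain ⟨e1, e2, e3⟩ := hpr q hq
    rw [e1, e2, e3] at c
    have : m q * f q = 0 := by linarith
    exact (mul_eq_zero.1 this).resolve_right (hf0 q hq).ne'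
  have hf1' : ∀ q ∈ U, dir X₁ f q = 4 / 3 * f q * β q := by
    intro q hq
    have c := (H.codazzi₃ hq).2.1
    obtain ⟨e1, e2, e3⟩ := hpr q hq
    rw [dr X₁ q hq, dh X₂ q hq, e1, e2, e3] at c
    linarith
  have d11 : ∀ q ∈ U, dir X₁ E₁ q = x q + ((-f q) • E₃ q + k q • E₄ q) := by
    intro q hq
    rw [H.d11 q hq, (hpr q hq).1, hα q hq]; module
  have d21 : ∀ q ∈ U, dir X₂ E₁ q = (-β q) • E₂ q := by
    intro q hq
    rw [H.d21 q hq, (hpr q hq).2.1, hm q hq]; module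
  have d12 : ∀ q ∈ U, dir X₁ E₂ q = 0 := by
    intro q hq
    rw [H.d12 q hq, (hpr q hq).2.1, hm q hq, hα q hq]; module
  have d22 : ∀ q ∈ U, dir X₂ E₂ q = x q + β q • E₁ q + (3 * f q) • E₃ q - k q • E₄ q := by
    intro q hq
    rw [H.d22 q hq, (hpr q hq).2.2, hs q hq]; module
  have d13 : ∀ q ∈ U, dir X₁ E₃ q = f q • E₁ q := by
    intro q hq
    rw [H.d13 q hq, (hpr q hq).1, (hpr q hq).2.1]; module
  have d23 : ∀ q ∈ U, dir X₂ E₃ q = (-(3 * f q)) • E₂ q := by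
    intro q hq
    rw [H.d23 q hq, (hpr q hq).2.2, (hpr q hq).2.1]; module
  have d14 : ∀ q ∈ U, dir X₁ E₄ q = (-k q) • E₁ q := by
    intro q hq
    rw [H.d14 q hq, hm q hq]; module
  have d24 : ∀ q ∈ U, dir X₂ E₄ q = k q • E₂ q := by
    intro q hq
    rw [H.d24 q hq, hm q hq, hs q hq]; module
  have dsm : ∀ {X : Plane → Plane} {g : Plane → ℝ} {E : Plane → R51}, ContDiffOn ℝ ∞ g U →
      ContDiffOn ℝ ∞ E U → ∀ q ∈ U,
      dir X (fun q => g q • E q) q = dir X g q • E q + g q • dir X E q :=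
    fun hg hE q hq => dir_smul (differentiableAt_of_contDiffOn hU hg hq)
      (differentiableAt_of_contDiffOn hU hE hq)
  -- The Codazzi equations for `E₄`.
  have hk : ∀ q ∈ U, dir X₁ k q = 2 * β q * k q ∧ dir X₂ k q = 0 := by
    intro q hq
    have hc := H.dir_comm H.smooth_E₄ hq
    rw [dir_congr hU d24 hq, dir_congr hU d14 hq, dsm H.smooth_k H.smooth_E₂ q hq,
      dsm H.smooth_k.neg H.smooth_E₁ q hq, d12 q hq, d21 q hq, d14 q hq, d24 q hq, dir_neg,
      hα q hq, ← sub_eq_zero] at hc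
    obtain ⟨-, c1, c2, -⟩ := (H.isFrame q hq).coeff_eq_zero (c₀ := 0) (c₁ := dir X₂ k q)
      (c₂ := dir X₁ k q - 2 * β q * k q) (c₃ := 0) (c₄ := 0) (by rw [← hc]; module)
    exact ⟨by linarith, c1⟩
  -- The `E₂` component of the commutator on `E₁` is the Gauss equation.
  have hβ1 : ∀ q ∈ U, dir X₁ β q = β q ^ 2 - 1 - 3 * f q ^ 2 - k q ^ 2 := by
    intro q hq
    have hc := H.dir_comm H.smooth_E₁ hq
    rw [dir_congr hU d21 hq, dsm H.smooth_β.neg H.smooth_E₂ q hq,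
      dir_of_eqOn_add_comb₂ hU H.smooth_E₃ H.smooth_E₄ H.smooth_x hf.neg H.smooth_k d11 hq,
      dir_neg, dir_neg, H.dir₂ q hq, d23 q hq, d24 q hq, hf2 q hq, (hk q hq).2, d12 q hq,
      d21 q hq, hα q hq, ← sub_eq_zero] at hc
    obtain ⟨-, -, c2, -⟩ := (H.isFrame q hq).coeff_eq_zero (c₀ := 0) (c₁ := 0)
      (c₂ := - dir X₁ β q + (β q ^ 2 - 1 - 3 * f q ^ 2 - k q ^ 2)) (c₃ := 0) (c₄ := 0)
      (by rw [← hc]; module)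
    linarith
  have hβ2 : ∀ q ∈ U, dir X₂ β q = 0 := by
    intro q hq
    have hc := H.dir_comm hf hq
    rw [dir_eq_zero_of_eqOn hU hf2 hq, hf2 q hq, hα q hq] at hc
    have h1 : ∀ q ∈ U, dir X₁ f q = (4 / 3 * f q) * β q := fun q hq => by rw [hf1' q hq]
    have hdf' := (hdf q hq)
    rw [dir_congr hU h1 hq, dir_mul ((differentiableAt_const _).fun_mul hdf')
      (differentiableAt_of_contDiffOn hU H.smooth_β hq),
      dir_mul (differentiableAt_const _) hdf', hf2 q hq, dir_const] at hc
    simp only [smul_eq_mul] at hc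
    have : f q * dir X₂ β q = 0 := by linarith
    exact (mul_eq_zero.1 this).resolve_left (hf0 q hq).ne'
  have hβ : ∀ q ∈ U, 0 < β q := by
    intro q hq
    have := hf1 q hq
    rw [hf1' q hq] at this
    have h2 := hf0 q hq
    exact (mul_pos_iff_of_pos_left (by positivity)).1 this
  exact
    { toIsMovingFrame := H.toIsMovingFrame
      smooth_f := hf, smooth_k := H.smooth_k, smooth_β := H.smooth_β, f_pos := hf0, β_pos := hβ
      d11 := d11, d21 := d21, d12 := d12, d22 := d22, d13 := d13, d23 := d23, d14 := d14
      d24 := d24, f1 := hf1', f2 := hf2, k1 := fun q hq => (hk q hq).1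
      k2 := fun q hq => (hk q hq).2, β1 := hβ1, β2 := hβ2 }

end Reduction

/-! ### Existence of the frame -/

/-- A parametrized PNMC biconservative surface. -/
structure IsPNMCBiconsOn (x : Plane → R51) (U : Set Plane) : Prop where
  isOpen : IsOpen U
  smooth : ContDiffOn ℝ ∞ x U
  mem : ∀ q ∈ U, x q ∈ H4
  injective : ∀ q ∈ U, Function.Injective (fderiv ℝ x q)
  pos : ∀ q ∈ U, 0 < meanCurv x q
  grad_ne_zero : ∀ q ∈ U, gradMeanCurv x q ≠ 0
  parallel : ∀ q ∈ U, ∀ i, normalConn x (unitMeanCurvVec x) i q = 0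
  biconservative : ∀ q ∈ U, tangentPart x q (bitension x q) = 0

section Existence

variable {x : Plane → R51} {U : Set Plane} {q : Plane}

lemma contDiffOn_pd {F : Type*} [NormedAddCommGroup F] [NormedSpace ℝ F] {V : Plane → F}
    (hU : IsOpen U) (hV : ContDiffOn ℝ ∞ V U) (i : Fin 2) : ContDiffOn ℝ ∞ (pd V i) U :=
  contDiffOn_dir hU contDiffOn_const hV

lemma contDiffOn_metric (hU : IsOpen U) (hx : ContDiffOn ℝ ∞ x U) (i j : Fin 2) :
    ContDiffOn ℝ ∞ (fun q => metric x q i j) U :=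
  contDiffOn_mink (contDiffOn_pd hU hx i) (contDiffOn_pd hU hx j)

lemma metric_symm (i j : Fin 2) : metric x q i j = metric x q j i := mink_comm _ _

lemma contDiffOn_metric_inv (hU : IsOpen U) (hx : ContDiffOn ℝ ∞ x U)
    (hs : ∀ q ∈ U, IsSpacelikeAt x q) (i j : Fin 2) :
    ContDiffOn ℝ ∞ (fun q => (metric x q)⁻¹ i j) U := by
  have hm := contDiffOn_metric hU hx
  have hdet : ContDiffOn ℝ ∞ (fun q => (metric x q).det) U := by
    simp only [Matrix.det_fin_two]
    exact ((hm 0 0).mul (hm 1 1)).sub ((hm 0 1).mul (hm 1 0))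
  have hd0 : ∀ q ∈ U, (metric x q).det ≠ 0 := by
    intro q hq
    rw [Matrix.det_fin_two, metric_symm 1 0, ← pow_two]
    exact (hs q hq).det_pos.ne'
  have hadj : ContDiffOn ℝ ∞ (fun q => (metric x q).adjugate i j) U := by
    simp only [Matrix.adjugate_fin_two]
    fin_cases i <;> fin_cases j <;> simp
    · exact hm 1 1
    · exact (hm 0 1).neg
    · exact (hm 1 0).neg
    · exact hm 0 0
  refine ((hdet.inv hd0).mul hadj).congr fun q hq => ?_
  simp [Matrix.inv_def]

lemma contDiffOn_projH {V : Plane → R51} (hx : ContDiffOn ℝ ∞ x U) (hV : ContDiffOn ℝ ∞ V U) :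
    ContDiffOn ℝ ∞ (fun q => projH (x q) (V q)) U :=
  hV.add ((contDiffOn_mink hV hx).smul hx)

lemma contDiffOn_meanCurvVec (hU : IsOpen U) (hx : ContDiffOn ℝ ∞ x U)
    (hs : ∀ q ∈ U, IsSpacelikeAt x q) : ContDiffOn ℝ ∞ (meanCurvVec x) U := by
  have hg := contDiffOn_metric_inv hU hx hs
  have hp := contDiffOn_pd hU hx
  have hpp : ∀ i j, ContDiffOn ℝ ∞ (pd (pd x j) i) U := fun i j => contDiffOn_pd hU (hp j) i
  unfold meanCurvVec secondFF normalPart tangentPart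
  refine ContDiffOn.const_smul _ (ContDiffOn.sum fun i _ => ContDiffOn.sum fun j _ =>
    (hg i j).smul ((contDiffOn_projH hx (hpp i j)).sub (ContDiffOn.sum fun a _ =>
      ContDiffOn.sum fun b _ => ((hg a b).mul (contDiffOn_mink (hpp i j) (hp a))).smul (hp b))))

lemma len_pos_iff {w : R51} : 0 < len w ↔ 0 < mink w w := Real.sqrt_pos

lemma len_sq {w : R51} (h : 0 ≤ mink w w) : len w ^ 2 = mink w w := Real.sq_sqrt h

lemma mink_normalPart_fderiv (hs : IsSpacelikeAt x q) (hx : ∀ v, mink (fderiv ℝ x q v) (x q) = 0)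
    (w : R51) (v : Plane) : mink (normalPart x q w) (fderiv ℝ x q v) = 0 := by
  obtain ⟨X₁, X₂, hX⟩ := hs.exists_isOrthonormalAt
  rw [← tangentPart_fderiv hs, hX.tangentPart_eq, normalPart, projH, hX.tangentPart_eq]
  simp only [mink_add_right, mink_sub_left, mink_add_left, mink_smul_left, mink_smul_right, hX.h11,
    hX.h12, hX.h22, mink_comm (x q), hx, mink_comm (fderiv ℝ x q X₂) (fderiv ℝ x q X₁)]
  ring

lemma mink_normalPart_self (hs : IsSpacelikeAt x q) (hx : ∀ v, mink (fderiv ℝ x q v) (x q) = 0)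
    (hH : x q ∈ H4) (w : R51) : mink (normalPart x q w) (x q) = 0 := by
  obtain ⟨X₁, X₂, hX⟩ := hs.exists_isOrthonormalAt
  rw [normalPart, projH, hX.tangentPart_eq]
  simp only [mink_sub_left, mink_add_left, mink_smul_left, hx, show mink (x q) (x q) = -1 from hH.1]
  ring

lemma mink_meanCurvVec (hs : IsSpacelikeAt x q) (hx : ∀ v, mink (fderiv ℝ x q v) (x q) = 0)
    (hH : x q ∈ H4) : mink (meanCurvVec x q) (x q) = 0 ∧
      ∀ v, mink (meanCurvVec x q) (fderiv ℝ x q v) = 0 := by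
  unfold meanCurvVec secondFF
  simp only [mink_smul_left, mink_sum_left, mink_normalPart_self hs hx hH,
    mink_normalPart_fderiv hs hx, mul_zero, Finset.sum_const_zero, implies_true, and_self]

/-- Supplies the initial vector for the Gram–Schmidt construction of `E₄`. -/
lemma exists_not_mem_span (e : Fin 4 → R51) : ∃ w : R51, w ∉ Submodule.span ℝ (Set.range e) := by
  by_contra! hcon
  have htop : Submodule.span ℝ (Set.range e) = ⊤ := by
    rw [eq_top_iff]; intro w _; exact hcon w
  have h1 := finrank_range_le_card (R := ℝ) e
  rw [Set.finrank, htop, finrank_top] at h1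
  simp at h1

namespace IsPNMCBiconsOn

lemma isSpacelikeAt (H : IsPNMCBiconsOn x U) (hq : q ∈ U) : IsSpacelikeAt x q :=
  isSpacelikeAt_of_injective H.isOpen H.smooth H.mem hq (H.injective q hq)

lemma mink_fderiv (H : IsPNMCBiconsOn x U) (hq : q ∈ U) (v : Plane) : mink (fderiv ℝ x q v) (x q) = 0 :=
  mink_fderiv_self H.isOpen H.smooth H.mem hq v

lemma mink_meanCurvVec_pos (H : IsPNMCBiconsOn x U) (hq : q ∈ U) : 0 < mink (meanCurvVec x q) (meanCurvVec x q) :=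
  len_pos_iff.1 (H.pos q hq)

lemma contDiffOn_meanCurv (H : IsPNMCBiconsOn x U) : ContDiffOn ℝ ∞ (meanCurv x) U := by
  have hv := contDiffOn_meanCurvVec H.isOpen H.smooth fun q hq => H.isSpacelikeAt hq
  exact (contDiffOn_mink hv hv).sqrt fun q hq => (H.mink_meanCurvVec_pos hq).ne'

lemma contDiffOn_unitMeanCurvVec (H : IsPNMCBiconsOn x U) : ContDiffOn ℝ ∞ (unitMeanCurvVec x) U := by
  have hv := contDiffOn_meanCurvVec H.isOpen H.smooth fun q hq => H.isSpacelikeAt hq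
  exact (H.contDiffOn_meanCurv.inv fun q hq => (H.pos q hq).ne').smul hv

lemma meanCurvVec_eq_smul (H : IsPNMCBiconsOn x U) (hq : q ∈ U) :
    meanCurvVec x q = meanCurv x q • unitMeanCurvVec x q := by
  rw [unitMeanCurvVec, smul_smul, mul_inv_cancel₀ (H.pos q hq).ne', one_smul]

lemma mink_unitMeanCurvVec (H : IsPNMCBiconsOn x U) (hq : q ∈ U) :
    mink (unitMeanCurvVec x q) (unitMeanCurvVec x q) = 1 := by
  have h0 := (H.pos q hq).ne'
  have h1 : meanCurv x q ^ 2 = mink (meanCurvVec x q) (meanCurvVec x q) :=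
    len_sq (H.mink_meanCurvVec_pos hq).le
  rw [unitMeanCurvVec, mink_smul_left, mink_smul_right, ← h1]
  field_simp

lemma mink_unitMeanCurvVec_fderiv (H : IsPNMCBiconsOn x U) (hq : q ∈ U) (v : Plane) :
    mink (unitMeanCurvVec x q) (fderiv ℝ x q v) = 0 := by
  rw [unitMeanCurvVec, mink_smul_left,
    (mink_meanCurvVec (H.isSpacelikeAt hq) (H.mink_fderiv hq) (H.mem q hq)).2, mul_zero]

lemma mink_unitMeanCurvVec_self (H : IsPNMCBiconsOn x U) (hq : q ∈ U) : mink (unitMeanCurvVec x q) (x q) = 0 := by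
  rw [unitMeanCurvVec, mink_smul_left,
    (mink_meanCurvVec (H.isSpacelikeAt hq) (H.mink_fderiv hq) (H.mem q hq)).1, mul_zero]

end IsPNMCBiconsOn

/-- The coordinates of the gradient of the mean curvature function. -/
def gradCoord (x : Plane → R51) (q : Plane) : Plane :=
  ∑ i, ∑ j, ((metric x q)⁻¹ i j * pd (meanCurv x) i q) • EuclideanSpace.single j (1 : ℝ)

lemma fderiv_gradCoord : fderiv ℝ x q (gradCoord x q) = gradMeanCurv x q := by
  unfold gradCoord gradMeanCurv pd
  simp only [map_sum, map_smul]

lemma contDiffOn_rot {X : Plane → Plane} (hU : IsOpen U) (hx : ContDiffOn ℝ ∞ x U)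
    (hs : ∀ q ∈ U, IsSpacelikeAt x q) (hX : ContDiffOn ℝ ∞ X U) :
    ContDiffOn ℝ ∞ (fun q => rot x q (X q)) U := by
  have hm := contDiffOn_metric hU hx
  have hc : ∀ i, ContDiffOn ℝ ∞ (fun q => X q i) U := fun i =>
    (EuclideanSpace.proj (𝕜 := ℝ) i).contDiff.comp_contDiffOn hX
  have hd := ((hm 0 0).mul (hm 1 1)).sub ((hm 0 1).pow 2)
  refine ((hd.sqrt fun q hq => (hs q hq).det_pos.ne').inv
    fun q hq => (Real.sqrt_pos.2 (hs q hq).det_pos).ne').smul ?_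
  rw [contDiffOn_piLp]
  intro i
  fin_cases i
  · exact (((hm 0 1).mul (hc 0)).add ((hm 1 1).mul (hc 1))).neg
  · exact ((hm 0 0).mul (hc 0)).add ((hm 0 1).mul (hc 1))

/-- The frame consists of the normalized gradient, its rotation, the normalized mean curvature
vector, and a Gram–Schmidt vector. Since `E₁` points along the gradient, `E₁f = |grad f|` and `E₂f =
0`. -/
theorem IsPNMCBiconsOn.exists_isBiconsFrame {q₀ : Plane} (H : IsPNMCBiconsOn x U) (hq₀ : q₀ ∈ U) :
    ∃ ε > 0, Metric.ball q₀ ε ⊆ U ∧ ∃ X₁ X₂ E₁ E₂ E₃ E₄ k β,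
      IsBiconsFrame x (Metric.ball q₀ ε) X₁ X₂ E₁ E₂ E₃ E₄ (meanCurv x) k β ∧
      ∀ q ∈ Metric.ball q₀ ε, len (gradMeanCurv x q) = 4 / 3 * meanCurv x q * β q := by
  have hU := H.isOpen
  have hs := fun q (hq : q ∈ U) => H.isSpacelikeAt hq
  have sf := H.contDiffOn_meanCurv
  have sE₃ := H.contDiffOn_unitMeanCurvVec
  have sG : ContDiffOn ℝ ∞ (gradCoord x) U := by
    unfold gradCoord
    exact ContDiffOn.sum fun i _ => ContDiffOn.sum fun j _ =>
      ((contDiffOn_metric_inv hU H.smooth hs i j).mul (contDiffOn_pd hU sf i)).smul contDiffOn_const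
  have hG0 : ∀ q ∈ U, 0 < mink (gradMeanCurv x q) (gradMeanCurv x q) := by
    intro q hq
    rw [← fderiv_gradCoord]
    refine hs q hq _ fun h0 => H.grad_ne_zero q hq ?_
    rw [← fderiv_gradCoord, h0, map_zero]
  have slen : ContDiffOn ℝ ∞ (fun q => len (gradMeanCurv x q)) U := by
    have : ContDiffOn ℝ ∞ (gradMeanCurv x) U := by
      refine (contDiffOn_dir hU sG H.smooth).congr fun q _ => ?_
      rw [← fderiv_gradCoord]; rfl
    exact (contDiffOn_mink this this).sqrt fun q hq => (hG0 q hq).ne'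
  have hlen : ∀ q ∈ U, 0 < len (gradMeanCurv x q) := fun q hq => len_pos_iff.2 (hG0 q hq)
  set X₁ : Plane → Plane := fun q => (len (gradMeanCurv x q))⁻¹ • gradCoord x q with hX₁
  have sX₁ : ContDiffOn ℝ ∞ X₁ U := (slen.inv fun q hq => (hlen q hq).ne').smul sG
  set X₂ : Plane → Plane := fun q => rot x q (X₁ q) with hX₂
  have sX₂ : ContDiffOn ℝ ∞ X₂ U := contDiffOn_rot hU H.smooth hs sX₁
  set E₁ := dir X₁ x with hE₁
  set E₂ := dir X₂ x with hE₂
  have sE₁ : ContDiffOn ℝ ∞ E₁ U := contDiffOn_dir hU sX₁ H.smooth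
  have sE₂ : ContDiffOn ℝ ∞ E₂ U := contDiffOn_dir hU sX₂ H.smooth
  set E₃ := unitMeanCurvVec x with hE₃
  have hE₁g : ∀ q, E₁ q = (len (gradMeanCurv x q))⁻¹ • gradMeanCurv x q := by
    intro q
    rw [← fderiv_gradCoord, hE₁, dir, hX₁, map_smul, fderiv_gradCoord]
  have hon : ∀ q ∈ U, IsOrthonormalAt x q (X₁ q) (X₂ q) := by
    intro q hq
    refine isOrthonormalAt_rot (hs q hq) ?_
    change mink (E₁ q) (E₁ q) = 1
    rw [hE₁g, mink_smul_left, mink_smul_right, ← len_sq (hG0 q hq).le]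
    have := (hlen q hq).ne'
    field_simp
  have hgrad : ∀ q ∈ U, dir X₁ (meanCurv x) q = len (gradMeanCurv x q) ∧
      dir X₂ (meanCurv x) q = 0 := by
    intro q hq
    have h1 := (hon q hq).gradMeanCurv_eq
    have h2 : gradMeanCurv x q = len (gradMeanCurv x q) • fderiv ℝ x q (X₁ q) := by
      have : fderiv ℝ x q (X₁ q) = E₁ q := rfl
      rw [this, hE₁g, smul_smul, mul_inv_cancel₀ (hlen q hq).ne', one_smul]
    rw [h2] at h1
    have k1 := congrArg (fun v => mink v (fderiv ℝ x q (X₁ q))) h1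
    have k2 := congrArg (fun v => mink v (fderiv ℝ x q (X₂ q))) h1
    simp only [mink_add_left, mink_smul_left, (hon q hq).h11, (hon q hq).h12, (hon q hq).h22,
      mink_comm (fderiv ℝ x q (X₂ q)) (fderiv ℝ x q (X₁ q))] at k1 k2
    unfold dir
    constructor <;> linarith
  -- the fourth vector of the frame
  obtain ⟨w, hw⟩ := exists_not_mem_span ![x q₀, E₁ q₀, E₂ q₀, E₃ q₀]
  set P : Plane → R51 := fun q => w + mink w (x q) • x q - mink w (E₁ q) • E₁ q
    - mink w (E₂ q) • E₂ q - mink w (E₃ q) • E₃ q with hP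
  have sP : ContDiffOn ℝ ∞ P U :=
    (((contDiffOn_const.add ((contDiffOn_mink contDiffOn_const H.smooth).smul H.smooth)).sub
      ((contDiffOn_mink contDiffOn_const sE₁).smul sE₁)).sub
      ((contDiffOn_mink contDiffOn_const sE₂).smul sE₂)).sub
      ((contDiffOn_mink contDiffOn_const sE₃).smul sE₃)
  have hP0 : P q₀ ≠ 0 := by
    intro h0
    apply hw
    have hmem : ∀ i, (![x q₀, E₁ q₀, E₂ q₀, E₃ q₀] : Fin 4 → R51) i ∈
        Submodule.span ℝ (Set.range ![x q₀, E₁ q₀, E₂ q₀, E₃ q₀]) :=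
      fun i => Submodule.subset_span ⟨i, rfl⟩
    have hwe : w = (-mink w (x q₀)) • x q₀ + mink w (E₁ q₀) • E₁ q₀ + mink w (E₂ q₀) • E₂ q₀ +
        mink w (E₃ q₀) • E₃ q₀ := by
      rw [← sub_eq_zero, ← h0, hP]; module
    rw [hwe]
    exact Submodule.add_mem _ (Submodule.add_mem _ (Submodule.add_mem _
      (Submodule.smul_mem _ _ (hmem 0)) (Submodule.smul_mem _ _ (hmem 1)))
      (Submodule.smul_mem _ _ (hmem 2))) (Submodule.smul_mem _ _ (hmem 3))
  -- The projection `P` of the fixed vector `w` is nonzero only near `q₀`. This is why the frame is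
  -- built on a small ball, whose convexity is used later to integrate.
  have hnhds : U ∩ P ⁻¹' {0}ᶜ ∈ nhds q₀ :=
    (sP.continuousOn.isOpen_inter_preimage hU isOpen_compl_singleton).mem_nhds ⟨hq₀, hP0⟩
  obtain ⟨ε, hε, hball⟩ := Metric.mem_nhds_iff.1 hnhds
  have hBU : Metric.ball q₀ ε ⊆ U := fun q hq => (hball hq).1
  refine ⟨ε, hε, hBU, ?_⟩
  have hd : ∀ q ∈ U, mink (x q) (x q) = -1 ∧ mink (E₁ q) (E₁ q) = 1 ∧ mink (E₂ q) (E₂ q) = 1 ∧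
      mink (E₃ q) (E₃ q) = 1 ∧ mink (x q) (E₁ q) = 0 ∧ mink (x q) (E₂ q) = 0 ∧
      mink (x q) (E₃ q) = 0 ∧ mink (E₁ q) (E₂ q) = 0 ∧ mink (E₁ q) (E₃ q) = 0 ∧
      mink (E₂ q) (E₃ q) = 0 := fun q hq =>
    ⟨(H.mem q hq).1, (hon q hq).h11, (hon q hq).h22, H.mink_unitMeanCurvVec hq,
      by rw [mink_comm]; exact H.mink_fderiv hq _, by rw [mink_comm]; exact H.mink_fderiv hq _,
      by rw [mink_comm]; exact H.mink_unitMeanCurvVec_self hq, (hon q hq).h12,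
      by rw [mink_comm]; exact H.mink_unitMeanCurvVec_fderiv hq _,
      by rw [mink_comm]; exact H.mink_unitMeanCurvVec_fderiv hq _⟩
  have hPo : ∀ q ∈ U, mink (x q) (P q) = 0 ∧ mink (E₁ q) (P q) = 0 ∧ mink (E₂ q) (P q) = 0 ∧
      mink (E₃ q) (P q) = 0 := by
    intro q hq
    obtain ⟨a1, a2, a3, a4, a5, a6, a7, a8, a9, a10⟩ := hd q hq
    simp only [hP, mink_add_right, mink_sub_right, mink_smul_right, a1, a2, a3, a4, a5, a6, a7, a8,
      a9, a10, mink_comm _ w, mink_comm (E₁ q) (x q), mink_comm (E₂ q) (x q),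
      mink_comm (E₃ q) (x q), mink_comm (E₂ q) (E₁ q), mink_comm (E₃ q) (E₁ q),
      mink_comm (E₃ q) (E₂ q)]
    refine ⟨by ring, by ring, by ring, by ring⟩
  have hPpos : ∀ q ∈ Metric.ball q₀ ε, 0 < mink (P q) (P q) := fun q hq =>
    mink_self_pos_of_orthogonal (H.mem q (hBU hq))
      (by rw [mink_comm]; exact (hPo q (hBU hq)).1) (hball hq).2
  have sPlen : ContDiffOn ℝ ∞ (fun q => len (P q)) (Metric.ball q₀ ε) :=
    (contDiffOn_mink (sP.mono hBU) (sP.mono hBU)).sqrt fun q hq => (hPpos q hq).ne'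
  have hPlen : ∀ q ∈ Metric.ball q₀ ε, len (P q) ≠ 0 := fun q hq =>
    (len_pos_iff.2 (hPpos q hq)).ne'
  set E₄ : Plane → R51 := fun q => (len (P q))⁻¹ • P q with hE₄
  have sE₄ : ContDiffOn ℝ ∞ E₄ (Metric.ball q₀ ε) := (sPlen.inv hPlen).smul (sP.mono hBU)
  have hframe : IsMovingFrame x (Metric.ball q₀ ε) X₁ X₂ E₁ E₂ E₃ E₄ :=
    { isOpen := Metric.isOpen_ball
      smooth_x := H.smooth.mono hBU
      smooth_X₁ := sX₁.mono hBU
      smooth_X₂ := sX₂.mono hBU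
      smooth_E₁ := sE₁.mono hBU
      smooth_E₂ := sE₂.mono hBU
      smooth_E₃ := sE₃.mono hBU
      smooth_E₄ := sE₄
      spacelike := fun q hq => hs q (hBU hq)
      dir₁ := fun q _ => rfl
      dir₂ := fun q _ => rfl
      isFrame := by
        intro q hq
        obtain ⟨a1, a2, a3, a4, a5, a6, a7, a8, a9, a10⟩ := hd q (hBU hq)
        obtain ⟨b1, b2, b3, b4⟩ := hPo q (hBU hq)
        have h44 : mink (E₄ q) (E₄ q) = 1 := by
          simp only [hE₄, mink_smul_left, mink_smul_right]
          rw [← len_sq (hPpos q hq).le]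
          have := hPlen q hq
          field_simp
        exact ⟨a1, a2, a3, a4, h44, a5, a6, a7, by simp only [hE₄, mink_smul_right, b1, mul_zero],
          a8, a9, by simp only [hE₄, mink_smul_right, b2, mul_zero], a10,
          by simp only [hE₄, mink_smul_right, b3, mul_zero],
          by simp only [hE₄, mink_smul_right, b4, mul_zero]⟩ }
  have hpar : ∀ X : Plane → Plane, ∀ q ∈ Metric.ball q₀ ε, mink (dir X E₃ q) (E₄ q) = 0 := by
    intro X q hq
    have f := hframe.isFrame q hq
    have h1 : ∀ i, mink (pd E₃ i q) (E₄ q) = 0 := by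
      intro i
      have := H.parallel q (hBU hq) i
      rw [normalConn, hframe.normalPart_eq hq] at this
      exact (f.coeff_eq_zero (c₀ := 0) (c₁ := 0) (c₂ := 0) (c₃ := mink (pd E₃ i q) (E₃ q))
        (c₄ := mink (pd E₃ i q) (E₄ q)) (by rw [← this]; module)).2.2.2.2
    unfold dir
    rw [fderiv_eq_pd, mink_add_left, mink_smul_left, mink_smul_left, h1, h1]
    ring
  have hse := hframe.exists_structureEquations (hpar X₁) (hpar X₂)
  have hbf := hse.isBiconsFrame (fun q hq => H.mem q (hBU hq)) (sf.mono hBU)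
    (fun q hq => H.pos q (hBU hq)) (fun q hq => H.meanCurvVec_eq_smul (hBU hq))
    (fun q hq => by rw [(hgrad q (hBU hq)).1]; exact hlen q (hBU hq))
    (fun q hq => (hgrad q (hBU hq)).2) (fun q hq => H.biconservative q (hBU hq))
  refine ⟨X₁, X₂, E₁, E₂, E₃, E₄, _, _, hbf, fun q hq => ?_⟩
  rw [← (hgrad q (hBU hq)).1, hbf.f1 q hq]

end Existence

/-! ### First integrals -/

section Integrals

variable {x : Plane → R51} {q q₀ : Plane} {U : Set Plane} {X X₁ X₂ : Plane → Plane}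
  {E₁ E₂ E₃ E₄ : Plane → R51} {f k β : Plane → ℝ}
  {F : Type*} [NormedAddCommGroup F] [NormedSpace ℝ F]

lemma dir_rpow (hf : DifferentiableAt ℝ f q) (h0 : f q ≠ 0) (a : ℝ) :
    dir X (fun r => f r ^ a) q = a * f q ^ (a - 1) * dir X f q := by
  unfold dir
  rw [(hf.hasFDerivAt.rpow_const (p := a) (Or.inl h0)).fderiv]
  simp

lemma IsMovingFrame.exists_comb (H : IsMovingFrame x U X₁ X₂ E₁ E₂ E₃ E₄) (hq : q ∈ U) (v : Plane) :
    ∃ s t : ℝ, v = s • X₁ q + t • X₂ q := by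
  refine ⟨mink (fderiv ℝ x q v) (E₁ q), mink (fderiv ℝ x q v) (E₂ q), ?_⟩
  apply (H.spacelike q hq).injective
  have d1 := H.dir₁ q hq
  have d2 := H.dir₂ q hq
  unfold dir at d1 d2
  rw [map_add, map_smul, map_smul, d1, d2, ← H.fderiv_eq hq]

lemma IsMovingFrame.eq_of_dir_eq_zero (H : IsMovingFrame x U X₁ X₂ E₁ E₂ E₃ E₄)
    (hU : Convex ℝ U) {V : Plane → F} (hV : ContDiffOn ℝ ∞ V U)
    (h1 : ∀ q ∈ U, dir X₁ V q = 0) (h2 : ∀ q ∈ U, dir X₂ V q = 0) (hq : q ∈ U) (hq₀ : q₀ ∈ U) :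
    V q = V q₀ := by
  refine H.isOpen.is_const_of_fderiv_eq_zero (𝕜 := ℝ) hU.isPreconnected
    (hV.differentiableOn (by simp)) (fun r hr => ?_) hq hq₀
  ext v
  obtain ⟨s, t, rfl⟩ := H.exists_comb hr v
  have e1 := h1 r hr
  have e2 := h2 r hr
  unfold dir at e1 e2
  simp [e1, e2]

namespace IsBiconsFrame

/-- The function `f ^ (-3/4)`. -/
def wt (f : Plane → ℝ) (q : Plane) : ℝ := f q ^ (-(3 / 4) : ℝ)

lemma smooth_wt (H : IsBiconsFrame x U X₁ X₂ E₁ E₂ E₃ E₄ f k β) : ContDiffOn ℝ ∞ (wt f) U :=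
  H.smooth_f.rpow_const_of_ne fun q hq => (H.f_pos q hq).ne'

lemma wt_pos (H : IsBiconsFrame x U X₁ X₂ E₁ E₂ E₃ E₄ f k β) (hq : q ∈ U) : 0 < wt f q :=
  Real.rpow_pos_of_pos (H.f_pos q hq) _

/-- The exponent `-3/4` cancels the factor `4/3` in `E₁f`. This makes `wt f` an integrating factor
for every quantity that scales with `β` along `E₁`. -/
lemma wt1 (H : IsBiconsFrame x U X₁ X₂ E₁ E₂ E₃ E₄ f k β) (hq : q ∈ U) :
    dir X₁ (wt f) q = -β q * wt f q := by
  have hf := H.f_pos q hq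
  unfold wt
  rw [dir_rpow (differentiableAt_of_contDiffOn H.isOpen H.smooth_f hq) hf.ne', H.f1 q hq,
    Real.rpow_sub_one hf.ne']
  field_simp

lemma wt2 (H : IsBiconsFrame x U X₁ X₂ E₁ E₂ E₃ E₄ f k β) (hq : q ∈ U) :
    dir X₂ (wt f) q = 0 := by
  have hf := H.f_pos q hq
  unfold wt
  rw [dir_rpow (differentiableAt_of_contDiffOn H.isOpen H.smooth_f hq) hf.ne', H.f2 q hq, mul_zero]

lemma wt_pow_four (H : IsBiconsFrame x U X₁ X₂ E₁ E₂ E₃ E₄ f k β) (hq : q ∈ U) :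
    wt f q ^ 4 * f q ^ 3 = 1 := by
  have hf := H.f_pos q hq
  unfold wt
  rw [← Real.rpow_natCast, ← Real.rpow_natCast, ← Real.rpow_mul hf.le, ← Real.rpow_add hf]
  norm_num

lemma wt_sq_mul (H : IsBiconsFrame x U X₁ X₂ E₁ E₂ E₃ E₄ f k β) (hq : q ∈ U) :
    wt f q ^ 2 * f q ^ (3 / 2 : ℝ) = 1 := by
  have hf := H.f_pos q hq
  unfold wt
  rw [← Real.rpow_natCast, ← Real.rpow_mul hf.le, ← Real.rpow_add hf]
  norm_num

/-- Along `E₁`, both `k` and `β² - 1 + 9f² + k²` are multiplied at the rate `2β`, while `wt f ^ 2`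
has rate `-2β`. The products are therefore first integrals; the powers `f³` and `f^(3/2)` arise as
`wt f ^ (-4)` and `wt f ^ (-2)`. -/
lemma exists_constants (H : IsBiconsFrame x U X₁ X₂ E₁ E₂ E₃ E₄ f k β) (hU : Convex ℝ U)
    (hq₀ : q₀ ∈ U) : ∃ c C : ℝ,
      (∀ q ∈ U, k q ^ 2 = c ^ 2 * f q ^ 3) ∧
      (∀ q ∈ U, β q ^ 2 = 1 + 9 * C * f q ^ (3 / 2 : ℝ) - 9 * f q ^ 2 - c ^ 2 * f q ^ 3) ∧
      (c = 0 → ∀ q ∈ U, mink (x q) (E₄ q₀) = 0) := by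
  have df := fun q hq => differentiableAt_of_contDiffOn H.isOpen H.smooth_f (q := q) hq
  have dk := fun q hq => differentiableAt_of_contDiffOn H.isOpen H.smooth_k (q := q) hq
  have dβ := fun q hq => differentiableAt_of_contDiffOn H.isOpen H.smooth_β (q := q) hq
  have dw := fun q hq => differentiableAt_of_contDiffOn H.isOpen H.smooth_wt (q := q) hq
  have hk : ∀ q ∈ U, k q * (wt f q * wt f q) = k q₀ * (wt f q₀ * wt f q₀) := by
    intro q hq
    refine H.eq_of_dir_eq_zero hU (V := fun q => k q * (wt f q * wt f q))
      (H.smooth_k.mul (H.smooth_wt.mul H.smooth_wt)) ?_ ?_ hq hq₀ <;> intro q hq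
    · rw [dir_mul (dk q hq) ((dw q hq).fun_mul (dw q hq)), dir_mul (dw q hq) (dw q hq), H.k1 q hq,
        H.wt1 hq]
      ring
    · rw [dir_mul (dk q hq) ((dw q hq).fun_mul (dw q hq)), dir_mul (dw q hq) (dw q hq), H.k2 q hq,
        H.wt2 hq]
      ring
  have hC : ∀ q ∈ U, (β q * β q - 1 + 9 * (f q * f q) + k q * k q) * (wt f q * wt f q) =
      (β q₀ * β q₀ - 1 + 9 * (f q₀ * f q₀) + k q₀ * k q₀) * (wt f q₀ * wt f q₀) := by
    intro q hq
    have hd : ∀ (X : Plane → Plane), ∀ q ∈ U,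
        dir X (fun q => (β q * β q - 1 + 9 * (f q * f q) + k q * k q) * (wt f q * wt f q)) q =
        (2 * β q * dir X β q + 18 * f q * dir X f q + 2 * k q * dir X k q) * wt f q ^ 2 +
        (β q * β q - 1 + 9 * (f q * f q) + k q * k q) * (2 * wt f q * dir X (wt f) q) := by
      intro X q hq
      have d1 := (dβ q hq).fun_mul (dβ q hq)
      have d2 := (df q hq).fun_mul (df q hq)
      have d3 := (dk q hq).fun_mul (dk q hq)
      have d4 := (dw q hq).fun_mul (dw q hq)
      have d5 : DifferentiableAt ℝ (fun _ : Plane => (9 : ℝ)) q := differentiableAt_const _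
      have d6 : DifferentiableAt ℝ (fun _ : Plane => (1 : ℝ)) q := differentiableAt_const _
      rw [dir_mul (((d1.fun_sub d6).fun_add (d5.fun_mul d2)).fun_add d3) d4,
        dir_add ((d1.fun_sub d6).fun_add (d5.fun_mul d2)) d3, dir_add (d1.fun_sub d6) (d5.fun_mul d2),
        dir_sub d1 d6, dir_mul d5 d2, dir_mul (dβ q hq) (dβ q hq), dir_mul (df q hq) (df q hq),
        dir_mul (dk q hq) (dk q hq), dir_mul (dw q hq) (dw q hq), dir_const, dir_const]
      ring
    refine H.eq_of_dir_eq_zero hU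
      (V := fun q => (β q * β q - 1 + 9 * (f q * f q) + k q * k q) * (wt f q * wt f q))
      (((((H.smooth_β.mul H.smooth_β).sub contDiffOn_const).add
        (contDiffOn_const.mul (H.smooth_f.mul H.smooth_f))).add (H.smooth_k.mul H.smooth_k)).mul
        (H.smooth_wt.mul H.smooth_wt)) ?_ ?_ hq hq₀ <;> intro q hq
    · rw [hd X₁ q hq, H.wt1 hq, H.f1 q hq, H.k1 q hq, H.β1 q hq]
      ring
    · rw [hd X₂ q hq, H.wt2 hq, H.f2 q hq, H.k2 q hq, H.β2 q hq]
      ring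
  obtain ⟨c, hc⟩ : ∃ c, c = k q₀ * (wt f q₀ * wt f q₀) := ⟨_, rfl⟩
  obtain ⟨C, hC'⟩ : ∃ C, 9 * C =
      (β q₀ * β q₀ - 1 + 9 * (f q₀ * f q₀) + k q₀ * k q₀) * (wt f q₀ * wt f q₀) :=
    ⟨(β q₀ * β q₀ - 1 + 9 * (f q₀ * f q₀) + k q₀ * k q₀) * (wt f q₀ * wt f q₀) / 9, by ring⟩
  rw [← hc] at hk
  rw [← hC'] at hC
  have hk2 : ∀ q ∈ U, k q ^ 2 = c ^ 2 * f q ^ 3 := by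
    intro q hq
    have h4 := H.wt_pow_four hq
    rw [← hk q hq]
    linear_combination (-k q ^ 2) * h4
  refine ⟨c, C, hk2, ?_, ?_⟩
  · intro q hq
    have h2 := H.wt_sq_mul hq
    rw [← hC q hq]
    linear_combination (-(β q ^ 2 - 1 + 9 * f q ^ 2 + k q ^ 2)) * h2 - hk2 q hq
  -- For `c = 0` the function `k` vanishes, so `E₄` is a constant vector, everywhere orthogonal to
  -- `x`.
  · rintro rfl q hq
    have hk0 : ∀ q ∈ U, k q = 0 := by
      intro q hq
      have := hk2 q hq
      rw [zero_pow two_ne_zero, zero_mul] at this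
      exact pow_eq_zero_iff two_ne_zero |>.1 this
    have := H.eq_of_dir_eq_zero hU H.smooth_E₄ (fun q hq => by rw [H.d14 q hq, hk0 q hq]; simp)
      (fun q hq => by rw [H.d24 q hq, hk0 q hq]; simp) hq hq₀
    rw [← this, (H.isFrame q hq).h04]

/-- The lightlike normal of the integral curves of `E₂`, when `C = 0`. -/
def lightNormal (x E₁ E₃ E₄ : Plane → R51) (f k β : Plane → ℝ) (q : Plane) : R51 :=
  x q + β q • E₁ q + (3 * f q) • E₃ q - k q • E₄ q

/-- The local geometry in the case `C = 0`: the constant vectors `b₁`, `b₂`. -/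
lemma exists_constant_vectors (H : IsBiconsFrame x U X₁ X₂ E₁ E₂ E₃ E₄ f k β) (hU : Convex ℝ U)
    (hq₀ : q₀ ∈ U) (hC : ∀ q ∈ U, β q ^ 2 = 1 - 9 * f q ^ 2 - k q ^ 2) :
    ∃ b₁ b₂ : R51, mink b₁ b₁ = 1 ∧ b₂ ≠ 0 ∧ mink b₂ b₂ = 0 ∧ mink b₁ b₂ = 0 ∧
      mink (x q₀) b₁ = 0 ∧ ∀ q ∈ U, 2 * mink (x q) b₂ = -wt f q ∧
        E₂ q = b₁ + (2 * mink (x q) b₁ * (wt f q)⁻¹) • b₂ ∧ mink (E₂ q) b₁ = 1 ∧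
        mink (E₁ q) b₁ = -β q * mink (x q) b₁ := by
  set N := lightNormal x E₁ E₃ E₄ f k β with hN
  have sβE : ContDiffOn ℝ ∞ (fun q => β q • E₁ q) U := H.smooth_β.smul H.smooth_E₁
  have s3f : ContDiffOn ℝ ∞ (fun q => 3 * f q) U := contDiffOn_const.mul H.smooth_f
  have sfE : ContDiffOn ℝ ∞ (fun q => (3 * f q) • E₃ q) U := s3f.smul H.smooth_E₃
  have skE : ContDiffOn ℝ ∞ (fun q => k q • E₄ q) U := H.smooth_k.smul H.smooth_E₄
  have sN : ContDiffOn ℝ ∞ N U := ((H.smooth_x.add sβE).add sfE).sub skE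
  have dd : ∀ {F : Type} [NormedAddCommGroup F] [NormedSpace ℝ F] {V : Plane → F},
      ContDiffOn ℝ ∞ V U → ∀ q ∈ U, DifferentiableAt ℝ V q :=
    fun hV q hq => differentiableAt_of_contDiffOn H.isOpen hV hq
  have d3f : ∀ X : Plane → Plane, ∀ q ∈ U, dir X (fun q => 3 * f q) q = 3 * dir X f q := by
    intro X q hq
    rw [dir_mul (differentiableAt_const _) (dd H.smooth_f q hq), dir_const]; ring
  have dN : ∀ X : Plane → Plane, ∀ q ∈ U, dir X N q = dir X x q +
      (dir X β q • E₁ q + β q • dir X E₁ q) +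
      ((3 * dir X f q) • E₃ q + (3 * f q) • dir X E₃ q) -
      (dir X k q • E₄ q + k q • dir X E₄ q) := by
    intro X q hq
    have e1 := dd H.smooth_x q hq
    have e2 := dd sβE q hq
    have e3 := dd sfE q hq
    have e4 := dd skE q hq
    have : N = fun q => x q + β q • E₁ q + (3 * f q) • E₃ q - k q • E₄ q := rfl
    rw [this, dir_sub ((e1.fun_add e2).fun_add e3) e4, dir_add (e1.fun_add e2) e3, dir_add e1 e2,
      dir_smul (dd H.smooth_β q hq) (dd H.smooth_E₁ q hq),
      dir_smul (dd s3f q hq) (dd H.smooth_E₃ q hq),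
      dir_smul (dd H.smooth_k q hq) (dd H.smooth_E₄ q hq), d3f X q hq]
  have dN1 : ∀ q ∈ U, dir X₁ N q = β q • N q := by
    intro q hq
    rw [dN X₁ q hq, H.dir₁ q hq, H.β1 q hq, H.d11 q hq, H.f1 q hq, H.d13 q hq, H.k1 q hq,
      H.d14 q hq, hN, lightNormal]
    module
  have dN2 : ∀ q ∈ U, dir X₂ N q = 0 := by
    intro q hq
    rw [dN X₂ q hq, H.dir₂ q hq, H.β2 q hq, H.d21 q hq, H.f2 q hq, H.d23 q hq, H.k2 q hq,
      H.d24 q hq]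
    -- The coefficient is `-⟨N, N⟩`. This is where `C = 0` enters: it makes `N` lightlike and
    -- constant along `E₂`.
    have : (1 - β q ^ 2 - 9 * f q ^ 2 - k q ^ 2) • E₂ q = 0 := by
      rw [hC q hq]; module
    rw [← this]; module
  have swN : ContDiffOn ℝ ∞ (fun q => wt f q • N q) U := H.smooth_wt.smul sN
  have hconst : ∀ q ∈ U, wt f q • N q = wt f q₀ • N q₀ := by
    intro q hq
    refine H.eq_of_dir_eq_zero hU swN ?_ ?_ hq hq₀ <;> intro q hq
    · rw [dir_smul (dd H.smooth_wt q hq) (dd sN q hq), H.wt1 hq, dN1 q hq]; module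
    · rw [dir_smul (dd H.smooth_wt q hq) (dd sN q hq), H.wt2 hq, dN2 q hq]; module
  -- The factor `1/2` makes `E₂ = b₁ + 2v f^(3/4) b₂` integrate to `v² f^(3/4) b₂` with coefficient
  -- one.
  set b₂ : R51 := (1 / 2 * wt f q₀) • N q₀ with hb₂
  have hNb : ∀ q ∈ U, N q = (2 * (wt f q)⁻¹) • b₂ := by
    intro q hq
    have h0 := (H.wt_pos hq).ne'
    have : b₂ = (1 / 2 * wt f q) • N q := by
      rw [hb₂, mul_smul, ← hconst q hq, mul_smul]
    rw [this, smul_smul]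
    field_simp
    simp
  have hbN : ∀ q ∈ U, b₂ = (1 / 2 * wt f q) • N q := by
    intro q hq
    rw [hb₂, mul_smul, ← hconst q hq, mul_smul]
  have mN : ∀ q ∈ U, mink (N q) (x q) = -1 ∧ mink (N q) (E₁ q) = β q ∧ mink (N q) (E₂ q) = 0 ∧
      mink (N q) (E₃ q) = 3 * f q ∧ mink (N q) (E₄ q) = -k q ∧ mink (N q) (N q) = 0 := by
    intro q hq
    have F := H.isFrame q hq
    have c := hC q hq
    simp only [hN, lightNormal, mink_add_left, mink_sub_left, mink_smul_left, mink_add_right,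
      mink_sub_right, mink_smul_right, F.h00, F.h11, F.h33, F.h44, F.h01, F.h02, F.h03,
      F.h04, F.h12, F.h13, F.h14, F.h23, F.h24, F.h34, mink_comm (E₁ q) (x q),
      mink_comm (E₃ q) (x q), mink_comm (E₄ q) (x q), mink_comm (E₃ q) (E₁ q),
      mink_comm (E₄ q) (E₁ q), mink_comm (E₃ q) (E₂ q), mink_comm (E₄ q) (E₂ q),
      mink_comm (E₄ q) (E₃ q)]
    refine ⟨by ring, by ring, by ring, by ring, by ring, by linear_combination c⟩
  set b₁ : R51 := E₂ q₀ with hb₁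
  have F₀ := H.isFrame q₀ hq₀
  have hb12 : mink b₁ b₂ = 0 := by
    rw [hb₂, mink_smul_right, mink_comm, (mN q₀ hq₀).2.2.1, mul_zero]
  have h22 : ∀ q ∈ U, mink (E₂ q) b₁ = 1 := by
    intro q hq
    have := H.eq_of_dir_eq_zero (V := fun q => mink (E₂ q) b₁) hU
      (contDiffOn_mink H.smooth_E₂ contDiffOn_const) ?_ ?_ hq hq₀
    · rw [this]; exact F₀.h22
    · intro q hq
      rw [dir_mink (dd H.smooth_E₂ q hq) (differentiableAt_const _), dir_const, H.d12 q hq,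
        mink_zero_left, mink_zero_right, add_zero]
    · intro q hq
      rw [dir_mink (dd H.smooth_E₂ q hq) (differentiableAt_const _), dir_const, H.d22 q hq,
        show x q + β q • E₁ q + (3 * f q) • E₃ q - k q • E₄ q = N q from rfl, hNb q hq,
        mink_smul_left, mink_comm, hb12, mink_zero_right]
      ring
  have hNb1 : ∀ q ∈ U, mink (N q) b₁ = 0 := by
    intro q hq
    rw [hNb q hq, mink_smul_left, mink_comm, hb12, mul_zero]
  -- Since `⟨b₁, b₁⟩ = ⟨b₁, E₂⟩ = 1`, the difference `b₁ - E₂` is null, and it is orthogonal to the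
  -- null vector `N`, so it is a multiple of `N`. Concretely, the deviations from the coefficients
  -- of `-⟨x, b₁⟩N` have squares summing to zero.
  have hE : ∀ q ∈ U, mink (E₁ q) b₁ = -β q * mink (x q) b₁ ∧
      mink (E₃ q) b₁ = -(3 * f q) * mink (x q) b₁ ∧ mink (E₄ q) b₁ = k q * mink (x q) b₁ := by
    intro q hq
    have F := H.isFrame q hq
    have h1 := congrArg (fun v => mink v b₁) (F.expand b₁)
    have h2 := hNb1 q hq
    simp only [hN, lightNormal, mink_add_left, mink_sub_left, mink_smul_left] at h1 h2
    rw [show mink b₁ b₁ = 1 from F₀.h22, mink_comm b₁ (x q), mink_comm b₁ (E₁ q),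
      mink_comm b₁ (E₂ q), mink_comm b₁ (E₃ q), mink_comm b₁ (E₄ q), h22 q hq] at h1
    have c := hC q hq
    set v := mink (x q) b₁
    set a := mink (E₁ q) b₁
    set b := mink (E₃ q) b₁
    set d := mink (E₄ q) b₁
    have hsum : (a + β q * v) ^ 2 + (b + 3 * f q * v) ^ 2 + (d - k q * v) ^ 2 = 0 := by
      linear_combination (-1) * h1 + 2 * v * h2 + v ^ 2 * c
    have s1 : a + β q * v = 0 := by
      nlinarith [sq_nonneg (a + β q * v), sq_nonneg (b + 3 * f q * v), sq_nonneg (d - k q * v)]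
    have s2 : b + 3 * f q * v = 0 := by
      nlinarith [sq_nonneg (a + β q * v), sq_nonneg (b + 3 * f q * v), sq_nonneg (d - k q * v)]
    have s3 : d - k q * v = 0 := by
      nlinarith [sq_nonneg (a + β q * v), sq_nonneg (b + 3 * f q * v), sq_nonneg (d - k q * v)]
    exact ⟨by linarith, by linarith, by linarith⟩
  have hxb : ∀ q ∈ U, 2 * mink (x q) b₂ = -wt f q := by
    intro q hq
    rw [hbN q hq, mink_smul_right, mink_comm, (mN q hq).1]
    ring
  refine ⟨b₁, b₂, F₀.h22, ?_, ?_, hb12, F₀.h02, fun q hq => ⟨hxb q hq, ?_, h22 q hq, (hE q hq).1⟩⟩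
  · intro h0
    have h1 := hxb q₀ hq₀
    rw [h0, mink_zero_right] at h1
    have := H.wt_pos hq₀
    linarith
  · rw [hb₂, mink_smul_left, mink_smul_right, (mN q₀ hq₀).2.2.2.2.2]
    ring
  · have F := H.isFrame q hq
    have h1 := F.expand b₁
    rw [mink_comm b₁ (x q), mink_comm b₁ (E₁ q), mink_comm b₁ (E₂ q), mink_comm b₁ (E₃ q),
      mink_comm b₁ (E₄ q), h22 q hq, (hE q hq).1, (hE q hq).2.1, (hE q hq).2.2] at h1
    have h2 : (2 * mink (x q) b₁ * (wt f q)⁻¹) • b₂ = mink (x q) b₁ • N q := by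
      rw [hNb q hq]; module
    rw [h2]
    generalize mink (x q) b₁ = v at h1 ⊢
    rw [h1, hN, lightNormal]
    module

end IsBiconsFrame

end Integrals

/-! ### Adapted coordinates -/

section Coordinates

lemma rectangle_isOpen (ε δ : ℝ) : IsOpen {q : Plane | |q 0| < ε ∧ |q 1| < δ} := by
  have h : ∀ i : Fin 2, Continuous fun q : Plane => |q i| := fun i =>
    (EuclideanSpace.proj (𝕜 := ℝ) i).continuous.abs
  exact (isOpen_lt (h 0) continuous_const).inter (isOpen_lt (h 1) continuous_const)

lemma exists_rectangle_subset {S : Set Plane} (hS : S ∈ nhds (0 : Plane)) :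
    ∃ ε > 0, {q : Plane | |q 0| < ε ∧ |q 1| < ε} ⊆ S := by
  obtain ⟨r, hr, hb⟩ := Metric.mem_nhds_iff.1 hS
  refine ⟨r / 2, by positivity, fun q hq => hb ?_⟩
  obtain ⟨h0, h1⟩ := hq
  rw [mem_ball_zero_iff, EuclideanSpace.norm_eq, Real.sqrt_lt' hr, Fin.sum_univ_two]
  simp only [Real.norm_eq_abs]
  nlinarith [abs_nonneg (q 0), abs_nonneg (q 1)]

/-- The inverse function theorem applied to `(u, v)`, whose differential is unipotent in the basis
`X₁`, `X₂`. Inverting it gives `∂_v = X₂` and `∂_u = X₁ - (X₁v)X₂`. -/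
lemma exists_coordinates {U : Set Plane} (hU : IsOpen U) {q₀ : Plane} (hq₀ : q₀ ∈ U)
    {X₁ X₂ : Plane → Plane} (hX : ∀ q ∈ U, ∀ w, ∃ s t : ℝ, w = s • X₁ q + t • X₂ q)
    {u v : Plane → ℝ} (hu : ContDiffOn ℝ ∞ u U) (hv : ContDiffOn ℝ ∞ v U)
    (hu1 : ∀ q ∈ U, dir X₁ u q = 1) (hu2 : ∀ q ∈ U, dir X₂ u q = 0)
    (hv2 : ∀ q ∈ U, dir X₂ v q = 1) (hu0 : u q₀ = 0) (hv0 : v q₀ = 0) :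
    ∃ ε > 0, ∃ Θ : OpenPartialHomeomorph Plane Plane, Θ.source ⊆ U ∧ q₀ ∈ Θ.source ∧
      (∀ q, Θ q = !₂[u q, v q]) ∧
      Θ.target = {q : Plane | |q 0| < ε ∧ |q 1| < ε} ∧
      ContDiffOn ℝ ∞ Θ Θ.source ∧ ContDiffOn ℝ ∞ Θ.symm Θ.target ∧
      ∀ p ∈ Θ.target, ∃ L : Plane →L[ℝ] Plane, HasFDerivAt Θ.symm L p ∧
        L (EuclideanSpace.single 1 1) = X₂ (Θ.symm p) ∧
        L (EuclideanSpace.single 0 1) =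
          X₁ (Θ.symm p) - dir X₁ v (Θ.symm p) • X₂ (Θ.symm p) := by
  set T : Plane → Plane := fun q => !₂[u q, v q] with hT
  have sT : ContDiffOn ℝ ∞ T U := by
    rw [contDiffOn_piLp]
    intro i
    fin_cases i
    · exact hu
    · exact hv
  have dT : ∀ q ∈ U, ∀ w i, fderiv ℝ T q w i = fderiv ℝ (fun r => T r i) q w := by
    intro q hq w i
    have h1 := (differentiableAt_of_contDiffOn hU sT hq).hasFDerivAt
    have h2 := ((EuclideanSpace.proj i : Plane →L[ℝ] ℝ).hasFDerivAt.comp q h1).fderiv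
    have h3 : (EuclideanSpace.proj i : Plane →L[ℝ] ℝ) ∘ T = fun r => T r i := rfl
    rw [← h3, h2]
    rfl
  have dT1 : ∀ q ∈ U, fderiv ℝ T q (X₁ q) = EuclideanSpace.single 0 1 +
      dir X₁ v q • EuclideanSpace.single 1 1 := by
    intro q hq
    ext i
    rw [dT q hq]
    have h1 := hu1 q hq
    unfold dir at h1 ⊢
    fin_cases i
    · simpa [hT] using h1
    · simp [hT]
  have dT2 : ∀ q ∈ U, fderiv ℝ T q (X₂ q) = EuclideanSpace.single 1 1 := by
    intro q hq
    ext i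
    rw [dT q hq]
    have h1 := hu2 q hq
    have h2 := hv2 q hq
    unfold dir at h1 h2
    fin_cases i
    · simpa [hT] using h1
    · simpa [hT] using h2
  have hinj : ∀ q ∈ U, Function.Injective (fderiv ℝ T q) := by
    intro q hq
    rw [injective_iff_map_eq_zero]
    intro w hw
    obtain ⟨s, t, rfl⟩ := hX q hq w
    rw [map_add, map_smul, map_smul, dT1 q hq, dT2 q hq] at hw
    have h0 := congrArg (fun z : Plane => z 0) hw
    have h1 := congrArg (fun z : Plane => z 1) hw
    simp at h0 h1
    subst h0
    simp at h1
    subst h1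
    simp
  have hequiv : ∀ q ∈ U, ∃ A : Plane ≃L[ℝ] Plane, HasFDerivAt T (A : Plane →L[ℝ] Plane) q := by
    intro q hq
    set A := (LinearEquiv.ofInjectiveEndo (fderiv ℝ T q : Plane →ₗ[ℝ] Plane)
      (hinj q hq)).toContinuousLinearEquiv with hA
    have hAe : (A : Plane →L[ℝ] Plane) = fderiv ℝ T q := by
      refine ContinuousLinearMap.ext fun w => ?_
      rfl
    refine ⟨A, ?_⟩
    rw [hAe]
    exact (differentiableAt_of_contDiffOn hU sT hq).hasFDerivAt
  obtain ⟨A₀, hA₀⟩ := hequiv q₀ hq₀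
  have sT₀ := sT.contDiffAt (hU.mem_nhds hq₀)
  set h₀ := sT₀.toOpenPartialHomeomorph T hA₀ (by simp) with hh₀
  set h := h₀.restrOpen U hU with hh
  have hsrc : h.source = h₀.source ∩ U := OpenPartialHomeomorph.restrOpen_source _ _ _
  have hmem : q₀ ∈ h.source := by
    rw [hsrc]; exact ⟨sT₀.mem_toOpenPartialHomeomorph_source hA₀ (by simp), hq₀⟩
  have hcoe : ∀ q, h q = T q := fun q => rfl
  have hT0 : T q₀ = 0 := by
    ext i
    fin_cases i
    · simpa [hT] using hu0
    · simpa [hT] using hv0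
  have htgt : h.target ∈ nhds (0 : Plane) := by
    rw [← hT0, ← hcoe]
    exact h.open_target.mem_nhds (h.map_source hmem)
  obtain ⟨ε, hε, hsub⟩ := exists_rectangle_subset htgt
  set R := {q : Plane | |q 0| < ε ∧ |q 1| < ε} with hR
  have hRo : IsOpen R := rectangle_isOpen ε ε
  -- Restricting the inverse, rather than the map itself, makes the target exactly a square.
  set Θ := (h.symm.restrOpen R hRo).symm with hΘ
  have hΘt : Θ.target = R := by
    change (h.symm.restrOpen R hRo).source = R
    rw [OpenPartialHomeomorph.restrOpen_source]
    exact Set.inter_eq_right.2 hsub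
  have hΘs : Θ.source ⊆ h.source := by
    intro q hq
    have h1 := Θ.map_source hq
    rw [hΘt] at h1
    have h2 := h.map_target (hsub h1)
    have h3 : h.symm (Θ q) = q := Θ.left_inv hq
    rwa [h3] at h2
  have hΘU : Θ.source ⊆ U := fun q hq => by
    have := hΘs hq
    rw [hsrc] at this
    exact this.2
  have hΘq : ∀ q, Θ q = T q := fun q => rfl
  have hΘ0 : q₀ ∈ Θ.source := by
    have h0 : (0 : Plane) ∈ Θ.target := by
      rw [hΘt]; simp [hR, hε]
    have h1 := Θ.map_target h0
    have h2 : Θ.symm 0 = q₀ := by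
      rw [← hT0, ← hcoe]; exact h.left_inv hmem
    rwa [h2] at h1
  have hd : ∀ p ∈ Θ.target, ∃ A : Plane ≃L[ℝ] Plane,
      HasFDerivAt Θ (A : Plane →L[ℝ] Plane) (Θ.symm p) := fun p hp =>
    hequiv _ (hΘU (Θ.map_target hp))
  refine ⟨ε, hε, Θ, hΘU, hΘ0, hΘq, hΘt, sT.mono hΘU, fun p hp => ?_, fun p hp => ?_⟩
  · obtain ⟨A, hA⟩ := hd p hp
    exact (Θ.contDiffAt_symm hp hA
      (sT.contDiffAt (hU.mem_nhds (hΘU (Θ.map_target hp))))).contDiffWithinAt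
  · obtain ⟨A, hA⟩ := hd p hp
    have hq := hΘU (Θ.map_target hp)
    have hAe : ∀ w, A w = fderiv ℝ T (Θ.symm p) w := by
      intro w
      have : fderiv ℝ T (Θ.symm p) = A := HasFDerivAt.fderiv hA
      rw [this]; rfl
    refine ⟨A.symm, Θ.hasFDerivAt_symm hp hA, ?_, ?_⟩
    · change A.symm _ = _
      rw [ContinuousLinearEquiv.symm_apply_eq, hAe, dT2 _ hq]
    · change A.symm _ = _
      rw [ContinuousLinearEquiv.symm_apply_eq, hAe, map_sub, map_smul, dT1 _ hq, dT2 _ hq]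
      simp

end Coordinates

/-! ### The directrix -/

section Directrix

variable {x : Plane → R51} {U : Set Plane} {X₁ X₂ : Plane → Plane}
  {E₁ E₂ E₃ E₄ : Plane → R51} {f k β : Plane → ℝ} {w : ℝ → Plane} {ε u : ℝ}

lemma hasDerivAt_comp_curve {F : Type*} [NormedAddCommGroup F] [NormedSpace ℝ F]
    {V : Plane → F} (hU : IsOpen U) (hV : ContDiffOn ℝ ∞ V U)
    (hw : HasDerivAt w (X₁ (w u)) u) (hwU : w u ∈ U) :
    HasDerivAt (fun t => V (w t)) (dir X₁ V (w u)) u :=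
  (differentiableAt_of_contDiffOn hU hV hwU).hasFDerivAt.comp_hasDerivAt u hw

namespace IsBiconsFrame

/-- An integral curve of `E₁` has acceleration `-fE₃ + kE₄` in `ℍ⁴`, hence `κ² = f² + k² = f²(1 +
c²f)`. Differentiating the unit normal leaves, besides `-κE₁`, a vector in the span of `E₃`, `E₄`,
whose length is the torsion. -/
lemma curve_geometry (H : IsBiconsFrame x U X₁ X₂ E₁ E₂ E₃ E₄ f k β)
    (hw : ∀ u, |u| < ε → w u ∈ U ∧ HasDerivAt w (X₁ (w u)) u) (hu : |u| < ε) {c : ℝ}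
    (hk : k (w u) ^ 2 = c ^ 2 * f (w u) ^ 3) :
    deriv (fun t => x (w t)) u = E₁ (w u) ∧
    curveCurvature (fun t => x (w t)) u = f (w u) * Real.sqrt (1 + c ^ 2 * f (w u)) ∧
    curveTorsion (fun t => x (w t)) u =
      2 * |c| * Real.sqrt (f (w u)) / (3 * (1 + c ^ 2 * f (w u))) * β (w u) := by
  have hU := H.isOpen
  have hS : {t : ℝ | |t| < ε} ∈ nhds u := (isOpen_lt continuous_abs continuous_const).mem_nhds hu
  have hS' : ∀ t, |t| < ε → {t : ℝ | |t| < ε} ∈ nhds t := fun t ht =>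
    (isOpen_lt continuous_abs continuous_const).mem_nhds ht
  set γ : ℝ → R51 := fun t => x (w t) with hγ
  have hd1 : ∀ t, |t| < ε → deriv γ t = E₁ (w t) := by
    intro t ht
    rw [(hasDerivAt_comp_curve hU H.smooth_x (hw t ht).2 (hw t ht).1).deriv, H.dir₁ _ (hw t ht).1]
  have hd2 : ∀ t, |t| < ε → deriv (deriv γ) t = dir X₁ E₁ (w t) := by
    intro t ht
    rw [Filter.EventuallyEq.deriv_eq (f := fun t => E₁ (w t))
      (Filter.eventuallyEq_of_mem (hS' t ht) hd1)]
    exact (hasDerivAt_comp_curve hU H.smooth_E₁ (hw t ht).2 (hw t ht).1).deriv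
  have hf0 := fun q hq => H.f_pos q hq
  have hK0 : ∀ q ∈ U, 0 < f q ^ 2 + k q ^ 2 := fun q hq => by
    have := hf0 q hq
    positivity
  have hcc : ∀ t, |t| < ε → curveConn γ (deriv γ) t = (-f (w t)) • E₃ (w t) + k (w t) • E₄ (w t) := by
    intro t ht
    have F := H.isFrame _ (hw t ht).1
    rw [curveConn, hd2 t ht, H.d11 _ (hw t ht).1, projH]
    simp only [hγ, mink_add_left, mink_smul_left, F.h00, mink_comm (E₃ (w t)) (x (w t)),
      mink_comm (E₄ (w t)) (x (w t)), F.h03, F.h04]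
    module
  set K : Plane → ℝ := fun q => Real.sqrt (f q ^ 2 + k q ^ 2) with hK
  have hKpos : ∀ q ∈ U, 0 < K q := fun q hq => Real.sqrt_pos.2 (hK0 q hq)
  have hKsq : ∀ q ∈ U, K q ^ 2 = f q ^ 2 + k q ^ 2 := fun q hq => Real.sq_sqrt (hK0 q hq).le
  have hcurv : ∀ t, |t| < ε → curveCurvature γ t = K (w t) := by
    intro t ht
    have F := H.isFrame _ (hw t ht).1
    rw [curveCurvature, hcc t ht, len, hK]
    simp only [mink_add_left, mink_smul_left, mink_add_right, mink_smul_right, F.h33, F.h34, F.h44,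
      mink_comm (E₄ (w t)) (E₃ (w t))]
    congr 1; ring
  have sK : ContDiffOn ℝ ∞ K U :=
    ((H.smooth_f.pow 2).add (H.smooth_k.pow 2)).sqrt fun q hq => (hK0 q hq).ne'
  have sKi : ContDiffOn ℝ ∞ (fun q => (K q)⁻¹) U := sK.inv fun q hq => (hKpos q hq).ne'
  have sfi : ContDiffOn ℝ ∞ (fun q => -((K q)⁻¹ * f q)) U := (sKi.mul H.smooth_f).neg
  have ski : ContDiffOn ℝ ∞ (fun q => (K q)⁻¹ * k q) U := sKi.mul H.smooth_k
  set Tn : Plane → R51 := fun q => (-((K q)⁻¹ * f q)) • E₃ q + ((K q)⁻¹ * k q) • E₄ q with hTn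
  have sTn : ContDiffOn ℝ ∞ Tn U := (sfi.smul H.smooth_E₃).add (ski.smul H.smooth_E₄)
  have hpn : ∀ t, |t| < ε → principalNormal γ t = Tn (w t) := by
    intro t ht
    rw [principalNormal, hcurv t ht, hcc t ht, hTn]
    module
  have hwu := (hw u hu).1
  have F := H.isFrame _ hwu
  have hdpn : deriv (principalNormal γ) u = dir X₁ Tn (w u) := by
    rw [Filter.EventuallyEq.deriv_eq (f := fun t => Tn (w t)) (Filter.eventuallyEq_of_mem hS hpn)]
    exact (hasDerivAt_comp_curve hU sTn (hw u hu).2 hwu).deriv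
  set q := w u with hqdef
  -- Differentiating the identity `K⁻²(f² + k²) = 1` replaces the derivative of a square root.
  have dK : K q * dir X₁ (fun q => (K q)⁻¹) q * K q ^ 2 =
      -(β q * (4 / 3 * f q ^ 2 + 2 * k q ^ 2)) := by
    have df := differentiableAt_of_contDiffOn hU H.smooth_f hwu
    have dk := differentiableAt_of_contDiffOn hU H.smooth_k hwu
    have dKi := differentiableAt_of_contDiffOn hU sKi hwu
    have e : Set.EqOn (fun q => ((K q)⁻¹ * (K q)⁻¹) * (f q * f q + k q * k q)) (fun _ => (1 : ℝ)) U := by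
      intro r hr
      have := (hKpos r hr).ne'
      have h2 := hKsq r hr
      simp only
      field_simp
      linarith
    have h1 := dir_congr (X := X₁) hU e hwu
    rw [dir_const, dir_mul (dKi.fun_mul dKi) ((df.fun_mul df).fun_add (dk.fun_mul dk)),
      dir_mul dKi dKi, dir_add (df.fun_mul df) (dk.fun_mul dk), dir_mul df df, dir_mul dk dk,
      H.f1 _ hwu, H.k1 _ hwu] at h1
    have h0 := (hKpos q hwu).ne'
    have h2 := hKsq q hwu
    generalize dir X₁ (fun q => (K q)⁻¹) q = D at h1 ⊢
    field_simp at h1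
    have h3 : 2 * K q * (K q * D * K q ^ 2 + (β q * (4 / 3 * f q ^ 2 + 2 * k q ^ 2))) = 0 := by
      linear_combination (K q / 3) * h1 + 2 * K q ^ 2 * D * h2
    have := (mul_eq_zero.1 h3).resolve_left (by positivity)
    linarith
  have hTd : curveConn γ (principalNormal γ) u + curveCurvature γ u • deriv γ u =
      (2 / 3 * f q * β q * k q ^ 2 / K q ^ 3) • E₃ q + (2 / 3 * f q ^ 2 * β q * k q / K q ^ 3) • E₄ q := by
    have h0 := (hKpos q hwu).ne'
    have h2 := hKsq q hwu
    have dKi := differentiableAt_of_contDiffOn hU sKi hwu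
    have df := differentiableAt_of_contDiffOn hU H.smooth_f hwu
    have dk := differentiableAt_of_contDiffOn hU H.smooth_k hwu
    have hdir := dir_of_eqOn_comb₂ (X := X₁) hU H.smooth_E₃ H.smooth_E₄ sfi ski (V := Tn)
      (fun _ _ => rfl) hwu
    rw [dir_neg, dir_mul dKi df, dir_mul dKi dk, H.f1 _ hwu, H.k1 _ hwu, H.d13 _ hwu,
      H.d14 _ hwu] at hdir
    have hdK : dir X₁ (fun q => (K q)⁻¹) q = -(β q * (4 / 3 * f q ^ 2 + 2 * k q ^ 2)) / K q ^ 3 := by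
      rw [← dK]; field_simp
    rw [hdK] at hdir
    have hx3 : mink (dir X₁ Tn q) (x q) = 0 := by
      rw [hdir]
      simp only [mink_add_left, mink_smul_left, mink_comm (E₃ q) (x q), mink_comm (E₄ q) (x q),
        mink_comm (E₁ q) (x q), F.h01, F.h03, F.h04]
      ring
    rw [curveConn, hdpn, projH, show γ u = x q from rfl, hx3, hcurv u hu, hd1 u hu, hdir]
    have hcoef : ∀ {a₁ a₃ a₄ b₃ b₄ : ℝ}, a₁ = 0 → a₃ = b₃ → a₄ = b₄ →
        a₁ • E₁ q + a₃ • E₃ q + a₄ • E₄ q = b₃ • E₃ q + b₄ • E₄ q := by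
      rintro a₁ a₃ a₄ b₃ b₄ rfl rfl rfl; simp
    rw [← hcoef (a₁ := -((K q)⁻¹ * f q) * f q + (K q)⁻¹ * k q * (-k q) + K q)
      (a₃ := -(-(β q * (4 / 3 * f q ^ 2 + 2 * k q ^ 2)) / K q ^ 3 * f q +
        (K q)⁻¹ * (4 / 3 * f q * β q)))
      (a₄ := -(β q * (4 / 3 * f q ^ 2 + 2 * k q ^ 2)) / K q ^ 3 * k q +
        (K q)⁻¹ * (2 * β q * k q))]
    · module
    · field_simp
      rw [h2]; ring
    · field_simp
      rw [h2]; ring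
    · field_simp
      rw [h2]; ring
  have hfq := hf0 q hwu
  have hK2 : K q ^ 2 = f q ^ 2 * (1 + c ^ 2 * f q) := by rw [hKsq q hwu, hk]; ring
  have hpos1 : 0 < 1 + c ^ 2 * f q := by positivity
  refine ⟨hd1 u hu, ?_, ?_⟩
  · rw [hcurv u hu, ← Real.sqrt_sq (hKpos q hwu).le, hK2, Real.sqrt_mul (by positivity),
      Real.sqrt_sq hfq.le]
  · have hβ := H.β_pos q hwu
    have h0 := hKpos q hwu
    have hs := Real.sq_sqrt hfq.le
    have hl : 2 / 3 * f q * β q * k q ^ 2 / K q ^ 3 * (2 / 3 * f q * β q * k q ^ 2 / K q ^ 3) +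
        2 / 3 * f q ^ 2 * β q * k q / K q ^ 3 * (2 / 3 * f q ^ 2 * β q * k q / K q ^ 3) =
        4 * c ^ 2 * f q * β q ^ 2 / (9 * (1 + c ^ 2 * f q) ^ 2) := by
      have e : 2 / 3 * f q * β q * k q ^ 2 / K q ^ 3 * (2 / 3 * f q * β q * k q ^ 2 / K q ^ 3) +
          2 / 3 * f q ^ 2 * β q * k q / K q ^ 3 * (2 / 3 * f q ^ 2 * β q * k q / K q ^ 3) =
          (4 / 9 * f q ^ 2 * β q ^ 2 * (k q ^ 2) ^ 2 + 4 / 9 * f q ^ 4 * β q ^ 2 * k q ^ 2) /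
            (K q ^ 2) ^ 3 := by
        field_simp
        ring
      rw [e, hk, hK2]
      field_simp
      ring
    have hr : (2 * |c| * Real.sqrt (f q) / (3 * (1 + c ^ 2 * f q)) * β q) ^ 2 =
        4 * c ^ 2 * f q * β q ^ 2 / (9 * (1 + c ^ 2 * f q) ^ 2) := by
      rw [mul_pow, div_pow, mul_pow, mul_pow, sq_abs, hs]
      ring
    rw [curveTorsion, hTd, len, ← Real.sqrt_sq
      (show 0 ≤ 2 * |c| * Real.sqrt (f q) / (3 * (1 + c ^ 2 * f q)) * β q by positivity)]
    congr 1
    simp only [mink_add_left, mink_smul_left, mink_add_right, mink_smul_right, F.h33, F.h34, F.h44,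
      mink_comm (E₄ q) (E₃ q)]
    linear_combination hl - hr

end IsBiconsFrame

end Directrix

/-! ### The integration constants -/

section Constants

/-- In `s = t^(3/2)` the difference of the two expressions is `s(9(C - D) - (c - d)s)`. A nonzero
affine function of `s` cannot vanish at two points. Here `c` and `d` play the role of the squared
constants. -/
lemma constants_unique {a b : ℝ} (ha : 0 < a) (hb : 0 < b) (hab : a ≠ b) {c C d D : ℝ}
    (h1 : 1 + 9 * C * a ^ (3 / 2 : ℝ) - 9 * a ^ 2 - c * a ^ 3 =
      1 + 9 * D * a ^ (3 / 2 : ℝ) - 9 * a ^ 2 - d * a ^ 3)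
    (h2 : 1 + 9 * C * b ^ (3 / 2 : ℝ) - 9 * b ^ 2 - c * b ^ 3 =
      1 + 9 * D * b ^ (3 / 2 : ℝ) - 9 * b ^ 2 - d * b ^ 3) : c = d ∧ C = D := by
  have hsq : ∀ t : ℝ, 0 < t → t ^ 3 = t ^ (3 / 2 : ℝ) * t ^ (3 / 2 : ℝ) := by
    intro t ht
    rw [← Real.rpow_add ht, ← Real.rpow_natCast]
    norm_num
  have hne : a ^ (3 / 2 : ℝ) ≠ b ^ (3 / 2 : ℝ) := fun h =>
    hab ((Real.rpow_left_inj ha.le hb.le (by norm_num)).1 h)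
  have hap := Real.rpow_pos_of_pos ha (3 / 2 : ℝ)
  have hbp := Real.rpow_pos_of_pos hb (3 / 2 : ℝ)
  rw [hsq a ha] at h1
  rw [hsq b hb] at h2
  generalize a ^ (3 / 2 : ℝ) = s at *
  generalize b ^ (3 / 2 : ℝ) = t at *
  have e1 : 9 * (C - D) - (c - d) * s = 0 := by
    have : s * (9 * (C - D) - (c - d) * s) = 0 := by linear_combination h1
    exact (mul_eq_zero.1 this).resolve_left hap.ne'
  have e2 : 9 * (C - D) - (c - d) * t = 0 := by
    have : t * (9 * (C - D) - (c - d) * t) = 0 := by linear_combination h2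
    exact (mul_eq_zero.1 this).resolve_left hbp.ne'
  have e3 : (c - d) * (t - s) = 0 := by linear_combination e1 - e2
  have e4 := (mul_eq_zero.1 e3).resolve_right (sub_ne_zero.2 hne.symm)
  rw [e4] at e1
  constructor <;> linarith

/-- The function whose square root occurs in the first-order equation. -/
def radicand (c C t : ℝ) : ℝ := 1 + 9 * C * t ^ (3 / 2 : ℝ) - 9 * t ^ 2 - c ^ 2 * t ^ 3

variable {x : Plane → R51} {U : Set Plane} {X₁ X₂ : Plane → Plane}
  {E₁ E₂ E₃ E₄ : Plane → R51} {f k β : Plane → ℝ} {q₀ : Plane}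

lemma IsBiconsFrame.exists_ne (H : IsBiconsFrame x U X₁ X₂ E₁ E₂ E₃ E₄ f k β) (hq₀ : q₀ ∈ U) :
    ∃ q ∈ U, f q ≠ f q₀ := by
  by_contra! hcon
  have h1 := dir_congr (X := X₁) H.isOpen (W := fun _ => f q₀) hcon hq₀
  rw [dir_const, H.f1 _ hq₀] at h1
  have := H.f_pos _ hq₀
  have := H.β_pos _ hq₀
  have : 0 < 4 / 3 * f q₀ * β q₀ := by positivity
  linarith

lemma radicand_eq_of_relation {t b c C : ℝ} (ht : 0 < t) (hb : 0 < b)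
    (h : 4 / 3 * t * b = 4 / 3 * t * Real.sqrt (radicand c C t)) : b ^ 2 = radicand c C t := by
  have e : b = Real.sqrt (radicand c C t) := mul_left_cancel₀ (by positivity) h
  have hpos : 0 < radicand c C t := by
    rw [e] at hb; exact Real.sqrt_pos.1 hb
  rw [e, Real.sq_sqrt hpos.le]

/-- The relation between the mean curvature function and the length of its gradient. -/
def HasConstantsOn (x : Plane → R51) (U : Set Plane) (c C : ℝ) : Prop :=
  ∀ q ∈ U, len (gradMeanCurv x q) = 4 / 3 * meanCurv x q * Real.sqrt (radicand c C (meanCurv x q))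

/-- The constant `c` is nonzero because otherwise the ball is mapped into the hypersurface
orthogonal to `E₄ q₀`, against fullness. -/
lemma IsPNMCBiconsOn.exists_constants (H : IsPNMCBiconsOn x U) (hq₀ : q₀ ∈ U)
    (hfull : ∀ V ⊆ U, IsOpen V → V.Nonempty → ∀ n : R51, 0 < mink n n →
      ¬ ∀ q ∈ V, x q ∈ hypersurfaceH3 n) :
    ∃ ε > 0, Metric.ball q₀ ε ⊆ U ∧ ∃ c C : ℝ, c ≠ 0 ∧ HasConstantsOn x (Metric.ball q₀ ε) c C := by
  obtain ⟨ε, hε, hB, X₁, X₂, E₁, E₂, E₃, E₄, k, β, hF, hg⟩ := H.exists_isBiconsFrame hq₀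
  have hmem := Metric.mem_ball_self (x := q₀) hε
  obtain ⟨c, C, -, h2, h3⟩ := hF.exists_constants (convex_ball _ _) hmem
  refine ⟨ε, hε, hB, c, C, fun hc => ?_, fun q hq => ?_⟩
  · have hfr := hF.isFrame q₀ hmem
    exact hfull _ hB Metric.isOpen_ball ⟨q₀, hmem⟩ (E₄ q₀) (by rw [hfr.h44]; norm_num)
      fun q hq => ⟨H.mem q (hB hq), h3 hc q hq⟩
  · rw [hg q hq, radicand, ← h2 q hq, Real.sqrt_sq (hF.β_pos q hq).le]

end Constants

/-! ### The normal form -/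

section NormalForm

lemma exists_primitive {g : ℝ → ℝ} {t₀ δ : ℝ} (hδ : 0 < δ)
    (hg : ContDiffOn ℝ ∞ g (Metric.ball t₀ δ)) : ∃ G : ℝ → ℝ, G t₀ = 0 ∧
      ContDiffOn ℝ ∞ G (Metric.ball t₀ δ) ∧ ∀ t ∈ Metric.ball t₀ δ, HasDerivAt G (g t) t := by
  have hd : ∀ t ∈ Metric.ball t₀ δ, HasDerivAt (fun s => ∫ r in t₀..s, g r) (g t) t := by
    intro t ht
    have hsub : Set.uIcc t₀ t ⊆ Metric.ball t₀ δ :=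
      (convex_ball t₀ δ).ordConnected.uIcc_subset (Metric.mem_ball_self hδ) ht
    exact intervalIntegral.integral_hasDerivAt_right
      (hg.continuousOn.mono hsub).intervalIntegrable
      (hg.continuousOn.stronglyMeasurableAtFilter Metric.isOpen_ball t ht)
      (hg.continuousOn.continuousAt (Metric.isOpen_ball.mem_nhds ht))
  refine ⟨fun s => ∫ r in t₀..s, g r, by simp, ?_, hd⟩
  rw [contDiffOn_infty_iff_deriv_of_isOpen Metric.isOpen_ball]
  exact ⟨fun t ht => (hd t ht).differentiableAt.differentiableWithinAt,
    hg.congr fun t ht => (hd t ht).deriv⟩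

lemma point_eq (u v : ℝ) : (!₂[u, v] : Plane) =
    u • EuclideanSpace.single (0 : Fin 2) (1 : ℝ) + v • EuclideanSpace.single (1 : Fin 2) (1 : ℝ) := by
  ext i; fin_cases i <;> simp

lemma hasDerivAt_point_fst (u v : ℝ) :
    HasDerivAt (fun u : ℝ => (!₂[u, v] : Plane)) (EuclideanSpace.single 0 1) u := by
  simp only [point_eq]
  simpa using ((hasDerivAt_id u).smul_const (EuclideanSpace.single (0 : Fin 2) (1 : ℝ))).add_const
    (v • EuclideanSpace.single (1 : Fin 2) (1 : ℝ))

lemma hasDerivAt_point_snd (u v : ℝ) :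
    HasDerivAt (fun v : ℝ => (!₂[u, v] : Plane)) (EuclideanSpace.single 1 1) v := by
  simp only [point_eq]
  simpa using ((hasDerivAt_id v).smul_const (EuclideanSpace.single (1 : Fin 2) (1 : ℝ))).const_add
    (u • EuclideanSpace.single (0 : Fin 2) (1 : ℝ))

variable {x : Plane → R51} {U : Set Plane} {q₀ : Plane}

/-- The coordinates are `u = G(f)` and `v = ⟨x, b₁⟩`, both zero at `q₀`. Every quantity annihilated
by `E₂ = ∂_v` depends on `u` only; this applies to `f` and to `x - v b₁ - v² f^(3/4) b₂`. -/
theorem IsPNMCBiconsOn.exists_normal_form (H : IsPNMCBiconsOn x U) (hq₀ : q₀ ∈ U) {c : ℝ}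
    (hc : HasConstantsOn x U c 0) :
    ∃ (ε : ℝ) (Θ : OpenPartialHomeomorph Plane Plane) (f : ℝ → ℝ) (σ : ℝ → R51) (b₁ b₂ : R51),
      0 < ε ∧ Θ.source ⊆ U ∧ q₀ ∈ Θ.source ∧ Θ q₀ = !₂[0, 0] ∧
      Θ.target = {q : Plane | |q 0| < ε ∧ |q 1| < ε} ∧
      ContDiffOn ℝ ∞ Θ Θ.source ∧ ContDiffOn ℝ ∞ Θ.symm Θ.target ∧
      (∀ u v : ℝ, |u| < ε → |v| < ε →
        x (Θ.symm !₂[u, v]) = σ u + v • b₁ + (v ^ 2 * f u ^ (3 / 4 : ℝ)) • b₂) ∧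
      (∀ u v : ℝ, |u| < ε → |v| < ε → meanCurv x (Θ.symm !₂[u, v]) = f u) ∧
      (∀ u : ℝ, |u| < ε → 0 < f u ∧
        HasDerivAt f (4 / 3 * f u * Real.sqrt (1 - 9 * f u ^ 2 - c ^ 2 * f u ^ 3)) u ∧
        0 < 4 / 3 * f u * Real.sqrt (1 - 9 * f u ^ 2 - c ^ 2 * f u ^ 3)) ∧
      mink b₁ b₁ = 1 ∧ b₂ ≠ 0 ∧ mink b₂ b₂ = 0 ∧ mink b₁ b₂ = 0 ∧
      ContDiffOn ℝ ∞ σ (Set.Ioo (-ε) ε) ∧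
      (∀ u : ℝ, |u| < ε →
        σ u ∈ hypersurfaceH3 b₁ ∧
        mink (deriv σ u) (deriv σ u) = 1 ∧
        curveCurvature σ u = f u * Real.sqrt (1 + c ^ 2 * f u) ∧
        curveTorsion σ u = 2 * |c| * Real.sqrt (f u) / (3 * (1 + c ^ 2 * f u)) *
          Real.sqrt (1 - 9 * f u ^ 2 - c ^ 2 * f u ^ 3) ∧
        mink (σ u) b₂ = -1 / (2 * f u ^ (3 / 4 : ℝ))) := by
  obtain ⟨ε₀, hε₀, hB, X₁, X₂, E₁, E₂, E₃, E₄, k, β, hF, hg⟩ := H.exists_isBiconsFrame hq₀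
  have hm₀ := Metric.mem_ball_self (x := q₀) hε₀
  set B := Metric.ball q₀ ε₀ with hBdef
  set f₀ := meanCurv x with hf₀
  obtain ⟨c', C', hk', hβ', -⟩ := hF.exists_constants (convex_ball _ _) hm₀
  have hrad : ∀ q ∈ B, β q ^ 2 = radicand c 0 (f₀ q) := fun q hq =>
    radicand_eq_of_relation (hF.f_pos q hq) (hF.β_pos q hq) (by rw [← hg q hq, hc q (hB hq)])
  -- The frame yields its own constants. They are matched with the given ones at two points where
  -- `f` differs; `c` itself is determined only up to sign.
  have hcc : c ^ 2 = c' ^ 2 := by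
    obtain ⟨q, hq, hne⟩ := hF.exists_ne hm₀
    refine (constants_unique (hF.f_pos q hq) (hF.f_pos q₀ hm₀) hne (C := 0) (D := C') ?_ ?_).1
    · rw [← hβ' q hq, hrad q hq, radicand]
    · rw [← hβ' q₀ hm₀, hrad q₀ hm₀, radicand]
  have hk : ∀ q ∈ B, k q ^ 2 = c ^ 2 * f₀ q ^ 3 := fun q hq => by rw [hcc, hk' q hq]
  have hβ2 : ∀ q ∈ B, β q ^ 2 = 1 - 9 * f₀ q ^ 2 - c ^ 2 * f₀ q ^ 3 := fun q hq => by
    rw [hrad q hq, radicand]; ring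
  have hβs : ∀ q ∈ B, β q = Real.sqrt (1 - 9 * f₀ q ^ 2 - c ^ 2 * f₀ q ^ 3) := fun q hq => by
    rw [← hβ2 q hq, Real.sqrt_sq (hF.β_pos q hq).le]
  obtain ⟨b₁, b₂, hb11, hb2, hb22, hb12, hxb0, hb⟩ := hF.exists_constant_vectors (convex_ball _ _) hm₀
    (fun q hq => by rw [hβ2 q hq, hk q hq])
  -- the primitive `G`
  set S : Set ℝ := {t | 0 < t ∧ 0 < 1 - 9 * t ^ 2 - c ^ 2 * t ^ 3} with hS
  have hSo : IsOpen S := (isOpen_lt continuous_const continuous_id).inter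
    (isOpen_lt (f := fun _ : ℝ => (0 : ℝ)) (g := fun t : ℝ => 1 - 9 * t ^ 2 - c ^ 2 * t ^ 3)
      continuous_const (by fun_prop))
  have hfS : ∀ q ∈ B, f₀ q ∈ S := fun q hq => ⟨hF.f_pos q hq, by
    rw [← hβ2 q hq]; have := hF.β_pos q hq; positivity⟩
  obtain ⟨δ, hδ, hJ⟩ := Metric.isOpen_iff.1 hSo (f₀ q₀) (hfS q₀ hm₀)
  have sg : ContDiffOn ℝ ∞ (fun t : ℝ => (4 / 3 * t * Real.sqrt (1 - 9 * t ^ 2 - c ^ 2 * t ^ 3))⁻¹)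
      (Metric.ball (f₀ q₀) δ) := by
    refine ContDiffOn.inv ((contDiffOn_const.mul contDiffOn_id).mul (ContDiffOn.sqrt
      (by fun_prop) fun t ht => (hJ ht).2.ne')) fun t ht => ?_
    obtain ⟨h1, h2⟩ := hJ ht
    have := Real.sqrt_pos.2 h2
    positivity
  obtain ⟨G, hG0, sG, hGd⟩ := exists_primitive hδ sg
  -- the domain of the coordinates
  set W := B ∩ f₀ ⁻¹' Metric.ball (f₀ q₀) δ with hW
  have hWo : IsOpen W := hF.smooth_f.continuousOn.isOpen_inter_preimage hF.isOpen Metric.isOpen_ball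
  have hWB : W ⊆ B := Set.inter_subset_left
  have hm : q₀ ∈ W := ⟨hm₀, Metric.mem_ball_self hδ⟩
  have su : ContDiffOn ℝ ∞ (fun q => G (f₀ q)) W :=
    sG.comp (hF.smooth_f.mono hWB) fun q hq => hq.2
  have sv : ContDiffOn ℝ ∞ (fun q => mink (x q) b₁) W :=
    contDiffOn_mink (hF.smooth_x.mono hWB) contDiffOn_const
  have df := fun q hq => differentiableAt_of_contDiffOn hF.isOpen hF.smooth_f (q := q) hq
  have dx := fun q hq => differentiableAt_of_contDiffOn hF.isOpen hF.smooth_x (q := q) hq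
  have du : ∀ X : Plane → Plane, ∀ q ∈ W, dir X (fun q => G (f₀ q)) q =
      (4 / 3 * f₀ q * β q)⁻¹ * dir X f₀ q := by
    intro X q hq
    have := ((hGd _ hq.2).comp_hasFDerivAt q (df q (hWB hq)).hasFDerivAt).fderiv
    unfold dir
    rw [show (fun q => G (f₀ q)) = G ∘ f₀ from rfl, this, hβs q (hWB hq)]
    simp
  have dv : ∀ X : Plane → Plane, ∀ q ∈ W, dir X (fun q => mink (x q) b₁) q = mink (dir X x q) b₁ := by
    intro X q hq
    rw [dir_mink (dx q (hWB hq)) (differentiableAt_const _), dir_const, mink_zero_right, add_zero]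
  have dv1 : ∀ q ∈ W, dir X₁ (fun q => mink (x q) b₁) q = -β q * mink (x q) b₁ := fun q hq => by
    rw [dv X₁ q hq, hF.dir₁ q (hWB hq), (hb q (hWB hq)).2.2.2]
  have dv2 : ∀ q ∈ W, dir X₂ (fun q => mink (x q) b₁) q = 1 := fun q hq => by
    rw [dv X₂ q hq, hF.dir₂ q (hWB hq), (hb q (hWB hq)).2.2.1]
  obtain ⟨ε, hε, Θ, hΘW, hΘ0, hΘ, hΘt, sΘ, sΘi, hΘd⟩ := exists_coordinates hWo hm
    (fun q hq => hF.exists_comb (hWB hq)) su sv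
    (fun q hq => by
      have h1 := hF.f_pos q (hWB hq)
      have h2 := hF.β_pos q (hWB hq)
      rw [du X₁ q hq, hF.f1 q (hWB hq)]
      field_simp)
    (fun q hq => by rw [du X₂ q hq, hF.f2 q (hWB hq), mul_zero])
    dv2 (by rw [hG0]) hxb0
  have htm : ∀ u v : ℝ, |u| < ε → |v| < ε → (!₂[u, v] : Plane) ∈ Θ.target := by
    intro u v hu hv
    rw [hΘt]; exact ⟨by simpa using hu, by simpa using hv⟩
  have hsm : ∀ u v : ℝ, |u| < ε → |v| < ε → Θ.symm !₂[u, v] ∈ W := fun u v hu hv =>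
    hΘW (Θ.map_target (htm u v hu hv))
  have hv : ∀ u v : ℝ, |u| < ε → |v| < ε → mink (x (Θ.symm !₂[u, v])) b₁ = v := by
    intro u v hu hv
    have h1 := Θ.right_inv (htm u v hu hv)
    rw [hΘ] at h1
    simpa using congrArg (fun z : Plane => z 1) h1
  have h0ε : |(0 : ℝ)| < ε := by simpa using hε
  -- On `v = 0` the correction `(X₁v)X₂ = -βv X₂` vanishes, so this coordinate line is an integral
  -- curve of `X₁`.
  have hwd : ∀ u, |u| < ε → Θ.symm !₂[u, 0] ∈ B ∧
      HasDerivAt (fun u => Θ.symm !₂[u, 0]) (X₁ (Θ.symm !₂[u, 0])) u := by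
    intro u hu
    refine ⟨hWB (hsm u 0 hu h0ε), ?_⟩
    obtain ⟨L, hL, -, hL0⟩ := hΘd _ (htm u 0 hu h0ε)
    have h1 := hL.comp_hasDerivAt u (hasDerivAt_point_fst u 0)
    rw [hL0, dv1 _ (hsm u 0 hu h0ε), hv u 0 hu h0ε, mul_zero, zero_smul, sub_zero] at h1
    exact h1
  have hconst : ∀ {F : Type} [NormedAddCommGroup F] [NormedSpace ℝ F] {V : Plane → F},
      ContDiffOn ℝ ∞ V W → (∀ q ∈ W, dir X₂ V q = 0) → ∀ u v : ℝ, |u| < ε → |v| < ε →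
      V (Θ.symm !₂[u, v]) = V (Θ.symm !₂[u, 0]) := by
    intro F _ _ V sV hV u v hu hvε
    have hder : ∀ t ∈ Set.Ioo (-ε) ε, HasDerivAt (fun t => V (Θ.symm !₂[u, t])) 0 t := by
      intro t ht
      have ht' := abs_lt.2 ht
      obtain ⟨L, hL, hL1, -⟩ := hΘd _ (htm u t hu ht')
      have h1 := hL.comp_hasDerivAt t (hasDerivAt_point_snd u t)
      rw [hL1] at h1
      have h2 := (differentiableAt_of_contDiffOn hWo sV (hsm u t hu ht')).hasFDerivAt.comp_hasDerivAt
        t h1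
      have h3 := hV _ (hsm u t hu ht')
      unfold dir at h3
      rw [h3] at h2
      exact h2
    exact isOpen_Ioo.is_const_of_deriv_eq_zero isPreconnected_Ioo
      (fun t ht => (hder t ht).differentiableAt.differentiableWithinAt)
      (fun t ht => (hder t ht).deriv) (abs_lt.1 hvε) (abs_lt.1 h0ε)
  have sf34 : ContDiffOn ℝ ∞ (fun q => f₀ q ^ (3 / 4 : ℝ)) W :=
    (hF.smooth_f.mono hWB).rpow_const_of_ne fun q hq => (hF.f_pos q (hWB hq)).ne'
  have hwt : ∀ q ∈ B, (IsBiconsFrame.wt f₀ q)⁻¹ = f₀ q ^ (3 / 4 : ℝ) := fun q hq => by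
    rw [IsBiconsFrame.wt, Real.rpow_neg (hF.f_pos q hq).le, inv_inv]
  have svv : ContDiffOn ℝ ∞ (fun q => mink (x q) b₁ * mink (x q) b₁ * f₀ q ^ (3 / 4 : ℝ)) W :=
    (sv.mul sv).mul sf34
  -- Subtracting the antiderivative in `v` of `E₂ = b₁ + 2v f^(3/4) b₂` leaves a field constant
  -- along `X₂`, equal to `x` on `v = 0`.
  set σ' : Plane → R51 := fun q => x q - mink (x q) b₁ • b₁ -
    (mink (x q) b₁ * mink (x q) b₁ * f₀ q ^ (3 / 4 : ℝ)) • b₂ with hσ'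
  have sσ' : ContDiffOn ℝ ∞ σ' W := ((hF.smooth_x.mono hWB).sub (sv.smul contDiffOn_const)).sub
    (svv.smul contDiffOn_const)
  have dσ' : ∀ q ∈ W, dir X₂ σ' q = 0 := by
    intro q hq
    have e1 := dx q (hWB hq)
    have e2 := differentiableAt_of_contDiffOn hWo sv hq
    have e3 := differentiableAt_of_contDiffOn hWo sf34 hq
    have e4 : DifferentiableAt ℝ (fun _ : Plane => b₁) q := differentiableAt_const _
    have e5 : DifferentiableAt ℝ (fun _ : Plane => b₂) q := differentiableAt_const _
    have hfq := hF.f_pos q (hWB hq)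
    rw [hσ', dir_sub (e1.fun_sub (e2.fun_smul e4)) (((e2.fun_mul e2).fun_mul e3).fun_smul e5),
      dir_sub e1 (e2.fun_smul e4), dir_smul e2 e4, dir_smul ((e2.fun_mul e2).fun_mul e3) e5,
      dir_mul (e2.fun_mul e2) e3, dir_mul e2 e2, dir_const, dir_const, dv2 q hq,
      dir_rpow (df q (hWB hq)) hfq.ne', hF.f2 q (hWB hq), hF.dir₂ q (hWB hq),
      (hb q (hWB hq)).2.1, hwt q (hWB hq)]
    module
  have hf : ∀ u v : ℝ, |u| < ε → |v| < ε → f₀ (Θ.symm !₂[u, v]) = f₀ (Θ.symm !₂[u, 0]) :=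
    hconst (hF.smooth_f.mono hWB) fun q hq => hF.f2 q (hWB hq)
  refine ⟨ε, Θ, fun u => f₀ (Θ.symm !₂[u, 0]), fun u => x (Θ.symm !₂[u, 0]), b₁, b₂, hε,
    fun q hq => hB (hWB (hΘW hq)), hΘ0, ?_, hΘt, sΘ, sΘi, ?_, hf, ?_, hb11, hb2, hb22, hb12, ?_, ?_⟩
  · rw [hΘ, hG0, hxb0]
  · intro u v hu hvε
    have h1 := hconst sσ' dσ' u v hu hvε
    simp only [hσ', hv u v hu hvε, hv u 0 hu h0ε, hf u v hu hvε] at h1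
    have h2 : x (Θ.symm !₂[u, v]) = (x (Θ.symm !₂[u, v]) - v • b₁ -
      (v * v * f₀ (Θ.symm !₂[u, 0]) ^ (3 / 4 : ℝ)) • b₂) + v • b₁ +
      (v ^ 2 * f₀ (Θ.symm !₂[u, 0]) ^ (3 / 4 : ℝ)) • b₂ := by module
    rw [h2, h1]
    module
  · intro u hu
    have hq := (hwd u hu).1
    have h1 := hF.f_pos _ hq
    have h2 := hF.β_pos _ hq
    have h3 := hasDerivAt_comp_curve hF.isOpen hF.smooth_f (w := fun u => Θ.symm !₂[u, 0])
      (hwd u hu).2 hq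
    rw [hF.f1 _ hq] at h3
    simp only [← hβs _ hq]
    exact ⟨h1, h3, by positivity⟩
  · refine (hF.smooth_x.mono hWB).comp (sΘi.comp ?_ fun u hu => htm u 0 (abs_lt.2 hu) h0ε)
      fun u hu => hsm u 0 (abs_lt.2 hu) h0ε
    simp only [point_eq]
    fun_prop
  · intro u hu
    have hq := (hwd u hu).1
    obtain ⟨g1, g2, g3⟩ := hF.curve_geometry (w := fun u => Θ.symm !₂[u, 0]) hwd hu (hk _ hq)
    refine ⟨⟨H.mem _ (hB hq), hv u 0 hu h0ε⟩, ?_, g2, ?_, ?_⟩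
    · rw [g1, (hF.isFrame _ hq).h11]
    · simp only [← hβs _ hq]; exact g3
    · have h1 := (hb _ hq).1
      have h2 := hwt _ hq
      have h3 := Real.rpow_pos_of_pos (hF.f_pos _ hq) (3 / 4)
      have h4 : IsBiconsFrame.wt f₀ (Θ.symm !₂[u, 0]) = (f₀ (Θ.symm !₂[u, 0]) ^ (3 / 4 : ℝ))⁻¹ := by
        rw [← h2, inv_inv]
      rw [h4] at h1
      have : mink (x (Θ.symm !₂[u, 0])) b₂ = -(f₀ (Θ.symm !₂[u, 0]) ^ (3 / 4 : ℝ))⁻¹ / 2 := by linarith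
      simp only [this]
      field_simp

end NormalForm

/-! ### Invariance under changes of coordinates -/

section Reparametrization

variable {x y : Plane → R51} {U V : Set Plane} {θ : Plane → Plane} {q : Plane}

lemma IsPNMCBiconsOn.mono (H : IsPNMCBiconsOn x U) (hVU : V ⊆ U) (hV : IsOpen V) :
    IsPNMCBiconsOn x V where
  isOpen := hV
  smooth := H.smooth.mono hVU
  mem q hq := H.mem q (hVU hq)
  injective q hq := H.injective q (hVU hq)
  pos q hq := H.pos q (hVU hq)
  grad_ne_zero q hq := H.grad_ne_zero q (hVU hq)
  parallel q hq := H.parallel q (hVU hq)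
  biconservative q hq := H.biconservative q (hVU hq)

lemma fderiv_comp_of_eqOn {F : Type*} [NormedAddCommGroup F] [NormedSpace ℝ F] {f g : Plane → F}
    (hU : IsOpen U) (hV : IsOpen V) (hf : ContDiffOn ℝ ∞ f U) (hθ : ContDiffOn ℝ ∞ θ V)
    (hmap : Set.MapsTo θ V U) (heq : ∀ q ∈ V, g q = f (θ q)) (hq : q ∈ V) :
    fderiv ℝ g q = (fderiv ℝ f (θ q)).comp (fderiv ℝ θ q) := by
  rw [Filter.EventuallyEq.fderiv_eq (f := f ∘ θ)
    (Filter.eventuallyEq_of_mem (hV.mem_nhds hq) heq)]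
  exact fderiv_comp q (differentiableAt_of_contDiffOn hU hf (hmap hq))
    (differentiableAt_of_contDiffOn hV hθ hq)

/-- By the chain rule, the second derivatives in the two parametrizations differ by a tangent
vector, which the normal projection annihilates. -/
lemma fderiv_fderiv_comp_of_eqOn (hU : IsOpen U) (hV : IsOpen V) (hx : ContDiffOn ℝ ∞ x U)
    (hy : ContDiffOn ℝ ∞ y V)
    (hθ : ContDiffOn ℝ ∞ θ V) (hmap : Set.MapsTo θ V U) (heq : ∀ q ∈ V, y q = x (θ q)) (hq : q ∈ V)
    (v : Plane) : ∃ z : Plane, fderiv ℝ (fderiv ℝ y) q v v =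
      fderiv ℝ (fderiv ℝ x) (θ q) (fderiv ℝ θ q v) (fderiv ℝ θ q v) + fderiv ℝ x (θ q) z := by
  have hyq := hy.contDiffAt (hV.mem_nhds hq)
  have hxq := hx.contDiffAt (hU.mem_nhds (hmap hq))
  have hθq := hθ.contDiffAt (hV.mem_nhds hq)
  have h1 : dir (fun _ => v) (dir (fun _ => v) y) q = fderiv ℝ (fderiv ℝ y) q v v := by
    rw [dir_dir hyq (differentiableAt_const _), dir_const, map_zero, add_zero]
  have h2 : dir (fun _ => v) (dir (fun _ => v) y) q =
      dir (fun _ => v) (fun r => fderiv ℝ x (θ r) (fderiv ℝ θ r v)) q := by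
    refine dir_congr hV (fun r hr => ?_) hq
    unfold dir
    rw [fderiv_comp_of_eqOn hU hV hx hθ hmap heq hr]; rfl
  have d1 : HasFDerivAt (fun r => fderiv ℝ x (θ r))
      ((fderiv ℝ (fderiv ℝ x) (θ q)).comp (fderiv ℝ θ q)) q :=
    (differentiableAt_fderiv hxq).hasFDerivAt.comp q (hθq.differentiableAt (by simp)).hasFDerivAt
  have d2 : DifferentiableAt ℝ (fun r => fderiv ℝ θ r v) q :=
    (differentiableAt_fderiv hθq).clm_apply (differentiableAt_const _)
  refine ⟨fderiv ℝ (fun r => fderiv ℝ θ r v) q v, ?_⟩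
  rw [← h1, h2]
  unfold dir
  rw [(d1.clm_apply d2.hasFDerivAt).fderiv]
  simp [add_comm]

/-- An orthonormal basis for `y` is pushed by the differential of `θ` to one for `x`, and the frame
formula for the mean curvature vector is the same in both. -/
lemma meanCurvVec_comp (Hx : IsPNMCBiconsOn x U) (Hy : IsPNMCBiconsOn y V)
    (hθ : ContDiffOn ℝ ∞ θ V) (hmap : Set.MapsTo θ V U) (heq : ∀ q ∈ V, y q = x (θ q)) (hq : q ∈ V) :
    meanCurvVec y q = meanCurvVec x (θ q) := by
  obtain ⟨X₁, X₂, hX⟩ := (Hy.isSpacelikeAt hq).exists_isOrthonormalAt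
  have hd := fun v => congrArg (fun A : Plane →L[ℝ] R51 => A v)
    (fderiv_comp_of_eqOn Hx.isOpen Hy.isOpen Hx.smooth hθ hmap heq hq)
  simp only [ContinuousLinearMap.comp_apply] at hd
  have hX' : IsOrthonormalAt x (θ q) (fderiv ℝ θ q X₁) (fderiv ℝ θ q X₂) := by
    have := hX
    obtain ⟨a, b, c⟩ := this
    rw [hd, hd] at b
    rw [hd] at a c
    exact ⟨a, b, c⟩
  have hn : ∀ w, normalPart y q w = normalPart x (θ q) w := by
    intro w
    rw [normalPart, normalPart, hX.tangentPart_eq, hX'.tangentPart_eq, heq q hq, hd, hd]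
  have hz : ∀ v, normalPart y q (fderiv ℝ (fderiv ℝ y) q v v) = normalPart x (θ q)
      (fderiv ℝ (fderiv ℝ x) (θ q) (fderiv ℝ θ q v) (fderiv ℝ θ q v)) := by
    intro v
    obtain ⟨z, hz⟩ := fderiv_fderiv_comp_of_eqOn Hx.isOpen Hy.isOpen Hx.smooth Hy.smooth hθ hmap heq
      hq v
    rw [hn, hz, normalPart_add, normalPart_fderiv (Hx.isSpacelikeAt (hmap hq))
      (Hx.mink_fderiv (hmap hq)), add_zero]
  rw [hX.meanCurvVec_eq (Hy.smooth.contDiffAt (Hy.isOpen.mem_nhds hq)),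
    hX'.meanCurvVec_eq (Hx.smooth.contDiffAt (Hx.isOpen.mem_nhds (hmap hq))), hz, hz]

lemma meanCurv_comp (Hx : IsPNMCBiconsOn x U) (Hy : IsPNMCBiconsOn y V)
    (hθ : ContDiffOn ℝ ∞ θ V) (hmap : Set.MapsTo θ V U) (heq : ∀ q ∈ V, y q = x (θ q)) (hq : q ∈ V) :
    meanCurv y q = meanCurv x (θ q) := by
  rw [meanCurv, meanCurv, meanCurvVec_comp Hx Hy hθ hmap heq hq]

lemma gradMeanCurv_comp (Hx : IsPNMCBiconsOn x U) (Hy : IsPNMCBiconsOn y V)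
    (hθ : ContDiffOn ℝ ∞ θ V) (hmap : Set.MapsTo θ V U) (heq : ∀ q ∈ V, y q = x (θ q)) (hq : q ∈ V) :
    gradMeanCurv y q = gradMeanCurv x (θ q) := by
  obtain ⟨X₁, X₂, hX⟩ := (Hy.isSpacelikeAt hq).exists_isOrthonormalAt
  have hd := fun v => congrArg (fun A : Plane →L[ℝ] R51 => A v)
    (fderiv_comp_of_eqOn Hx.isOpen Hy.isOpen Hx.smooth hθ hmap heq hq)
  have hm := fun v => congrArg (fun A : Plane →L[ℝ] ℝ => A v)
    (fderiv_comp_of_eqOn Hx.isOpen Hy.isOpen Hx.contDiffOn_meanCurv hθ hmap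
      (fun q hq => meanCurv_comp Hx Hy hθ hmap heq hq) hq)
  simp only [ContinuousLinearMap.comp_apply] at hd hm
  have hX' : IsOrthonormalAt x (θ q) (fderiv ℝ θ q X₁) (fderiv ℝ θ q X₂) := by
    have := hX
    obtain ⟨a, b, c⟩ := this
    rw [hd, hd] at b
    rw [hd] at a c
    exact ⟨a, b, c⟩
  rw [hX.gradMeanCurv_eq, hX'.gradMeanCurv_eq, hd, hd, hm, hm]

end Reparametrization

/-! ### Surfaces in charts -/

section Charts

variable {M : Type*} [TopologicalSpace M] [ChartedSpace Plane M]
  {φ : M → H4} {e e' : OpenPartialHomeomorph M Plane}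

lemma contDiffOn_inChart (hφ : ContMDiff (𝓡 2) 𝓘(ℝ, R51) ∞ (toR51 φ))
    (he : e ∈ IsManifold.maximalAtlas (𝓡 2) ∞ M) : ContDiffOn ℝ ∞ (inChart φ e) e.target := by
  rw [← contMDiffOn_iff_contDiffOn]
  exact hφ.comp_contMDiffOn (contMDiffOn_symm_of_mem_maximalAtlas he)

lemma injective_fderiv_inChart (hφ : IsPNMCBiconservative φ)
    (he : e ∈ IsManifold.maximalAtlas (𝓡 2) ∞ M) {q : Plane} (hq : q ∈ e.target) :
    Function.Injective (fderiv ℝ (inChart φ e) q) := by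
  have hmd : e.MDifferentiable (𝓡 2) (𝓡 2) :=
    ⟨(contMDiffOn_of_mem_maximalAtlas he).mdifferentiableOn (by simp),
      (contMDiffOn_symm_of_mem_maximalAtlas he).mdifferentiableOn (by simp)⟩
  have h1 : mfderiv (𝓡 2) 𝓘(ℝ, R51) (inChart φ e) q =
      (mfderiv (𝓡 2) 𝓘(ℝ, R51) (toR51 φ) (e.symm q)).comp (mfderiv (𝓡 2) (𝓡 2) e.symm q) :=
    mfderiv_comp q (hφ.smooth.mdifferentiableAt (by simp)) (hmd.mdifferentiableAt_symm hq)
  have h2 : Function.Injective (mfderiv (𝓡 2) 𝓘(ℝ, R51) (inChart φ e) q) := by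
    rw [h1]
    exact (hφ.immersion (e.symm q)).comp (hmd.symm.mfderiv_injective hq)
  rw [mfderiv_eq_fderiv] at h2
  exact h2

lemma IsPNMCBiconservative.isPNMCBiconsOn (hφ : IsPNMCBiconservative φ)
    (he : e ∈ IsManifold.maximalAtlas (𝓡 2) ∞ M) : IsPNMCBiconsOn (inChart φ e) e.target where
  isOpen := e.open_target
  smooth := contDiffOn_inChart hφ.smooth he
  mem q _ := (φ (e.symm q)).2
  injective _ hq := injective_fderiv_inChart hφ he hq
  pos := hφ.meanCurv_pos e he
  grad_ne_zero := hφ.grad_ne_zero e he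
  parallel := hφ.parallel e he
  biconservative := hφ.biconservative e he

lemma IsPNMCBiconservative.chart_independence (hφ : IsPNMCBiconservative φ)
    (he : e ∈ IsManifold.maximalAtlas (𝓡 2) ∞ M) (he' : e' ∈ IsManifold.maximalAtlas (𝓡 2) ∞ M)
    {p : M} (hp : p ∈ e.source) (hp' : p ∈ e'.source) :
    meanCurv (inChart φ e) (e p) = meanCurv (inChart φ e') (e' p) ∧
    gradMeanCurv (inChart φ e) (e p) = gradMeanCurv (inChart φ e') (e' p) := by
  set V := (e.symm.trans e').source with hV
  have hVo : IsOpen V := (e.symm.trans e').open_source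
  have hVe : V ⊆ e.target := fun q hq => hq.1
  have Hy := (hφ.isPNMCBiconsOn he).mono hVe hVo
  have Hx := hφ.isPNMCBiconsOn he'
  have hθ : ContDiffOn ℝ ∞ (e.symm.trans e') V := by
    rw [← contMDiffOn_iff_contDiffOn]
    exact (contMDiffOn_of_mem_maximalAtlas he').comp
      ((contMDiffOn_symm_of_mem_maximalAtlas he).mono hVe) fun q hq => hq.2
  have hmap : Set.MapsTo (e.symm.trans e') V e'.target := fun q hq => e'.map_source hq.2
  have heq : ∀ q ∈ V, inChart φ e q = inChart φ e' ((e.symm.trans e') q) := by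
    intro q hq
    unfold inChart
    congr 1
    exact (e'.left_inv hq.2).symm
  have hq : e p ∈ V := ⟨e.map_source hp, by
    change e.symm (e p) ∈ e'.source
    rwa [e.left_inv hp]⟩
  have hθp : (e.symm.trans e') (e p) = e' p := by
    change e' (e.symm (e p)) = e' p
    rw [e.left_inv hp]
  have h1 := meanCurv_comp Hx Hy hθ hmap heq hq
  have h2 := gradMeanCurv_comp Hx Hy hθ hmap heq hq
  rw [hθp] at h1 h2
  exact ⟨h1, h2⟩

/-- The relation `HasIntegrationConstants` at the points of `W`. -/
def RelationOn (φ : M → H4) (W : Set M) (c C : ℝ) : Prop :=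
  ∀ e ∈ IsManifold.maximalAtlas (𝓡 2) ∞ M, ∀ p ∈ e.source, p ∈ W →
    len (gradMeanCurv (inChart φ e) (e p)) = 4 / 3 * meanCurv (inChart φ e) (e p) *
      Real.sqrt (radicand c C (meanCurv (inChart φ e) (e p)))

lemma hasIntegrationConstants_iff {c C : ℝ} :
    HasIntegrationConstants φ c C ↔ RelationOn φ Set.univ c C := by
  constructor
  · intro h e he p hp _
    exact h e he _ (e.map_source hp)
  · intro h e he q hq
    have := h e he _ (e.map_target hq) trivial
    rw [e.right_inv hq] at this
    exact this

lemma RelationOn.mono {c C : ℝ} {W W' : Set M} (h : RelationOn φ W c C) (hW : W' ⊆ W) :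
    RelationOn φ W' c C := fun e he p hp hpW => h e he p hp (hW hpW)

lemma IsPNMCBiconservative.relationOn_unique [IsManifold (𝓡 2) ∞ M]
    (hφ : IsPNMCBiconservative φ) {c C d D : ℝ}
    {W : Set M} (hW : IsOpen W) (hne : W.Nonempty) (h1 : RelationOn φ W c C)
    (h2 : RelationOn φ W d D) : c ^ 2 = d ^ 2 ∧ C = D := by
  obtain ⟨p, hp⟩ := hne
  set e := chartAt Plane p
  have he : e ∈ IsManifold.maximalAtlas (𝓡 2) ∞ M := IsManifold.chart_mem_maximalAtlas p
  have hps : p ∈ e.source := mem_chart_source Plane p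
  have hVo : IsOpen (e.target ∩ e.symm ⁻¹' W) := e.isOpen_inter_preimage_symm hW
  have H := (hφ.isPNMCBiconsOn he).mono Set.inter_subset_left hVo
  have hq₀ : e p ∈ e.target ∩ e.symm ⁻¹' W := ⟨e.map_source hps, by
    rw [Set.mem_preimage, e.left_inv hps]; exact hp⟩
  obtain ⟨ε, hε, hB, X₁, X₂, E₁, E₂, E₃, E₄, k, β, hF, hg⟩ := H.exists_isBiconsFrame hq₀
  have hm := Metric.mem_ball_self (x := e p) hε
  obtain ⟨q, hq, hne⟩ := hF.exists_ne hm
  have key : ∀ {a b : ℝ}, RelationOn φ W a b → ∀ r ∈ Metric.ball (e p) ε,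
      β r ^ 2 = radicand a b (meanCurv (inChart φ e) r) := by
    intro a b h r hr
    have := h e he _ (e.map_target (hB hr).1) (hB hr).2
    rw [e.right_inv (hB hr).1] at this
    exact radicand_eq_of_relation (hF.f_pos r hr) (hF.β_pos r hr) (by rw [← hg r hr, this])
  exact constants_unique (hF.f_pos q hq) (hF.f_pos _ hm) hne
    ((key h1 q hq).symm.trans (key h2 q hq)) ((key h1 _ hm).symm.trans (key h2 _ hm))

/-- The relation is proved in one chart around `p` and carried to all charts by chart independence.
-/
lemma IsPNMCBiconservative.exists_relationOn [IsManifold (𝓡 2) ∞ M]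
    (hφ : IsPNMCBiconservative φ) (p : M) :
    ∃ W : Set M, IsOpen W ∧ p ∈ W ∧ ∃ c C : ℝ, c ≠ 0 ∧ RelationOn φ W c C := by
  set e := chartAt Plane p
  have he : e ∈ IsManifold.maximalAtlas (𝓡 2) ∞ M := IsManifold.chart_mem_maximalAtlas p
  have hps : p ∈ e.source := mem_chart_source Plane p
  obtain ⟨ε, hε, hB, c, C, hc, hr⟩ := (hφ.isPNMCBiconsOn he).exists_constants (e.map_source hps) (by
    intro V hV hVo hVn n hn hcon
    refine hφ.full (e.source ∩ e ⁻¹' V) (e.isOpen_inter_preimage hVo) ?_ n hn ?_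
    · obtain ⟨q, hq⟩ := hVn
      exact ⟨e.symm q, e.map_target (hV hq), by rwa [Set.mem_preimage, e.right_inv (hV hq)]⟩
    · rintro r ⟨hr, hrV⟩
      have := hcon _ hrV
      rwa [inChart, e.left_inv hr] at this)
  refine ⟨e.source ∩ e ⁻¹' Metric.ball (e p) ε, e.isOpen_inter_preimage Metric.isOpen_ball,
    ⟨hps, Metric.mem_ball_self hε⟩, c, C, hc, ?_⟩
  intro e' he' r hr' hrW
  obtain ⟨g1, g2⟩ := hφ.chart_independence he he' hrW.1 hr'
  rw [← g1, ← g2]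
  exact hr _ hrW.2

/-- Uniqueness on overlaps makes the pair `(c², C)` locally constant, hence constant by
connectedness. The square is used because the sign of the local `c` is arbitrary. -/
lemma IsPNMCBiconservative.exists_integrationConstants [IsManifold (𝓡 2) ∞ M]
    [ConnectedSpace M]
    (hφ : IsPNMCBiconservative φ) : ∃ c C : ℝ, c ≠ 0 ∧ HasIntegrationConstants φ c C := by
  choose W hWo hWp c C hc hrel using hφ.exists_relationOn
  have hloc : IsLocallyConstant fun p => (c p ^ 2, C p) := by
    rw [IsLocallyConstant.iff_eventually_eq]
    intro p
    filter_upwards [(hWo p).mem_nhds (hWp p)] with p' hp'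
    obtain ⟨h1, h2⟩ := hφ.relationOn_unique ((hWo p').inter (hWo p)) ⟨p', hWp p', hp'⟩
      ((hrel p').mono Set.inter_subset_left) ((hrel p).mono Set.inter_subset_right)
    rw [h1, h2]
  obtain ⟨p₀⟩ := (inferInstance : Nonempty M)
  refine ⟨c p₀, C p₀, hc p₀, hasIntegrationConstants_iff.2 ?_⟩
  intro e he p hp _
  have h1 := hloc.apply_eq_of_preconnectedSpace p p₀
  have h2 := hrel p e he p hp (hWp p)
  rw [Prod.mk.injEq] at h1
  rw [h2, radicand, radicand, h1.1, h1.2]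

lemma trans_mem_maximalAtlas [IsManifold (𝓡 2) ∞ M]
    {Θ : OpenPartialHomeomorph Plane Plane}
    (he : e ∈ IsManifold.maximalAtlas (𝓡 2) ∞ M) (hΘe : Θ.source ⊆ e.target)
    (hΘ : ContDiffOn ℝ ∞ Θ Θ.source) (hΘ' : ContDiffOn ℝ ∞ Θ.symm Θ.target) :
    e.trans Θ ∈ IsManifold.maximalAtlas (𝓡 2) ∞ M ∧ (e.trans Θ).target = Θ.target := by
  have ht : (e.trans Θ).target = Θ.target := by
    rw [OpenPartialHomeomorph.trans_target]
    exact Set.inter_eq_left.2 fun q hq => hΘe (Θ.map_target hq)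
  refine ⟨OpenPartialHomeomorph.mem_maximalAtlas_of_contMDiffOn _ ?_ ?_, ht⟩
  · exact (contMDiffOn_iff_contDiffOn.2 hΘ).comp
      ((contMDiffOn_of_mem_maximalAtlas he).mono fun p hp => hp.1) fun p hp => hp.2
  · rw [ht]
    exact (contMDiffOn_symm_of_mem_maximalAtlas he).comp (contMDiffOn_iff_contDiffOn.2 hΘ')
      fun q hq => hΘe (Θ.map_target hq)

end Charts

end BiconservativeH4

end

theorem mainTheorem1 {M : Type*} [TopologicalSpace M] [ConnectedSpace M]
    [ChartedSpace Plane M] [IsManifold (𝓡 2) ∞ M]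
    (φ : M → H4) (hφ : IsPNMCBiconservative φ) :
    (∃ c C : ℝ, c ≠ 0 ∧ HasIntegrationConstants φ c C) ∧
    ∀ c : ℝ, HasIntegrationConstants φ c 0 → c ≠ 0 ∧
      ∀ p₀ : M, ∃ (ε δ : ℝ) (ψ : OpenPartialHomeomorph M Plane)
        (f : ℝ → ℝ) (σ : ℝ → R51) (b₁ b₂ : R51),
        0 < ε ∧ 0 < δ ∧
        -- `(u, v)` are local coordinates of `M` on a neighbourhood of `p₀`
        ψ ∈ IsManifold.maximalAtlas (𝓡 2) ∞ M ∧ p₀ ∈ ψ.source ∧ ψ p₀ = !₂[0, 0] ∧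
        ψ.target = {q : Plane | |q 0| < ε ∧ |q 1| < δ} ∧
        (∀ u v : ℝ, |u| < ε → |v| < δ →
          toR51 φ (ψ.symm !₂[u, v]) = σ u + v • b₁ + (v ^ 2 * f u ^ (3 / 4 : ℝ)) • b₂) ∧
        -- `f` is the mean curvature function, and solves the first-order equation
        (∀ u v : ℝ, |u| < ε → |v| < δ → meanCurv (inChart φ ψ) !₂[u, v] = f u) ∧
        (∀ u : ℝ, |u| < ε → 0 < f u ∧
          HasDerivAt f (4 / 3 * f u * Real.sqrt (1 - 9 * f u ^ 2 - c ^ 2 * f u ^ 3)) u ∧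
          0 < 4 / 3 * f u * Real.sqrt (1 - 9 * f u ^ 2 - c ^ 2 * f u ^ 3)) ∧
        -- the constant vectors
        mink b₁ b₁ = 1 ∧ b₂ ≠ 0 ∧ mink b₂ b₂ = 0 ∧ mink b₁ b₂ = 0 ∧
        -- the directrix, an arc-length curve in the `ℍ³` orthogonal to `b₁`
        ContDiffOn ℝ ∞ σ (Set.Ioo (-ε) ε) ∧
        (∀ u : ℝ, |u| < ε →
          σ u ∈ hypersurfaceH3 b₁ ∧
          mink (deriv σ u) (deriv σ u) = 1 ∧
          curveCurvature σ u = f u * Real.sqrt (1 + c ^ 2 * f u) ∧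
          curveTorsion σ u = 2 * |c| * Real.sqrt (f u) / (3 * (1 + c ^ 2 * f u)) *
            Real.sqrt (1 - 9 * f u ^ 2 - c ^ 2 * f u ^ 3) ∧
          mink (σ u) b₂ = -1 / (2 * f u ^ (3 / 4 : ℝ))) := by
  refine ⟨hφ.exists_integrationConstants, fun c hc => ⟨?_, fun p₀ => ?_⟩⟩
  -- Any admissible `c` has the same square as the nonzero constant found above.
  · obtain ⟨c', C, hc', h⟩ := hφ.exists_integrationConstants
    have := (hφ.relationOn_unique isOpen_univ Set.univ_nonempty (hasIntegrationConstants_iff.1 hc)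
      (hasIntegrationConstants_iff.1 h)).1
    rintro rfl
    exact hc' (pow_eq_zero_iff two_ne_zero |>.1 (by rw [← this]; ring))
  · set e := chartAt Plane p₀
    have he : e ∈ IsManifold.maximalAtlas (𝓡 2) ∞ M := IsManifold.chart_mem_maximalAtlas p₀
    have hps : p₀ ∈ e.source := mem_chart_source Plane p₀
    obtain ⟨ε, Θ, f, σ, b₁, b₂, hε, hΘe, hΘp, hΘ0, hΘt, hΘs, hΘs', hΦ, hf, hode, hb11, hb2, hb22,
      hb12, hσ, hcurve⟩ := (hφ.isPNMCBiconsOn he).exists_normal_form (e.map_source hps) (c := c)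
        (fun q hq => hc e he q hq)
    obtain ⟨hψ, hψt⟩ := trans_mem_maximalAtlas he hΘe hΘs hΘs'
    refine ⟨ε, ε, e.trans Θ, f, σ, b₁, b₂, hε, hε, hψ, ⟨hps, hΘp⟩, hΘ0, hψt.trans hΘt, hΦ, ?_, hode,
      hb11, hb2, hb22, hb12, hσ, hcurve⟩
    intro u v hu hv
    have hq : !₂[u, v] ∈ (e.trans Θ).target := by
      rw [hψt, hΘt]
      exact ⟨hu, hv⟩
    -- The normal form computes the mean curvature in the chart `e`; chart independence transfers
    -- the value to the new chart at the same point of `M`.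
    have hp := (e.trans Θ).map_target hq
    have key := (hφ.chart_independence hψ he hp hp.1).1
    rw [(e.trans Θ).right_inv hq] at key
    rw [key, ← hf u v hu hv]
    congr 1
    exact e.right_inv (hΘe (Θ.map_target (hψt ▸ hq)))
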